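/- Let $m\ge 2$, and let $\mathcal M\subset\mathbb R^d$ be a compact, connected, smooth $m$-dimensional embedded submanifold without boundary, with the induced Riemannian metric, volume measure $\mathcal V$ and geodesic distance $d(\cdot,\cdot)$. Let $R$ be the reach of $\mathcal M$, let $\alpha$ be the volume of the unit ball of $\mathbb R^m$, and write $\mathcal B(x,r)=\{y\in\mathcal M: d(x,y)<r\}$. Let $p\in C^2(\mathcal M)$ be a positive probability density with respect to $\mathcal V$, and $p_{\min}=\min_{\mathcal M}p$. Let $\eta=1_{[0,1]}$. For integers $1\le k\le n$ put $$\varepsilon(x)=\Big(\frac{k}{n\alpha p(x)}\Big)^{1/m},\qquad \varepsilon^\star=\max_{x\in\mathcal M}\varepsilon(x),$$ $$w(x,y)=\int_{\mathcal M}\eta\Big(\frac{d(x,z)}{\varepsilon(x)}\Big)\eta\Big(\frac{d(y,z)}{\varepsilon(y)}\Big)p(z)\,d\mathcal V(z),$$ $$\mathcal L^2f(x)=\frac{(\alpha n/k)^{2+2/m}}{\alpha 2^{m+2}}\int_{\mathcal B(x,2\varepsilon^\star)}w(x,y)(f(x)-f(y))p(y)\,d\mathcal V(y).$$ For points $x_1,\dots,x_n\in\mathcal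 M$ let $\varepsilon_k(x)$ be the least $\epsilon>0$ for which at least $k$ indices $i$ satisfy $0<|x_i-x|\le\epsilon$, where $|\cdot|$ is the Euclidean norm of $\mathbb R^d$, and put $$w_k(x,y)=\int_{\mathcal M}\eta\Big(\frac{d(x,z)}{\varepsilon_k(x)}\Big)\eta\Big(\frac{d(y,z)}{\varepsilon_k(y)}\Big)p(z)\,d\mathcal V(z),$$ $$\mathcal L^1f(x)=\frac{(\alpha n/k)^{1+2/m}}{2^{m+2}k}\sum_{i=1}^n w_k(x,x_i)(f(x)-f(x_i)).$$ For $B\subset\mathcal M$ let $[f]_{1;B}=\sup_{y\ne z\in B}|f(y)-f(z)|/d(y,z)$. Then there are constants $C_p,c_p>0$, depending only on $\mathcal M$ and $p$, such that the following holds for all integers $1\le k\le n$ with $$3(k/n)^{1/m}<(\alpha p_{\min})^{1/m}\min\{1,R/2\}.$$ If $x_1,\dots,x_n$ are independent random points of $\mathcal M$ with density $p$, $f:\mathcal M\to\mathbb R$ is Lipschitz, $x\in\mathcal M$ and $(k/n)^{1/m}\le t\le(k/n)^{-1/m}$, then $$\mathbb P\Big(\big|\mathcal L^1f(x)-\mathcal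 L^2f(x)\big|>C_p\,[f]_{1;\mathcal B(x,3\varepsilon^\star)}\,t\Big)\le C_p\,n\exp\!\big(-c_p\,k\,(k/n)^{2/m}t^2\big).$$ -/

import Mathlib

open MeasureTheory ProbabilityTheory
open scoped Manifold ContDiff

namespace SNN

noncomputable section

/-- The volume `α` of the unit ball of `ℝᵐ`. -/
def ballVol (m : ℕ) : ℝ :=
  (volume : Measure (EuclideanSpace ℝ (Fin m))).real (Metric.ball 0 1)

/-- The Riemannian volume measure of the metric induced on `M` by the embedding `ι : M → ℝᵈ`:
the `m`-dimensional Hausdorff measure of `ℝᵈ`, normalized so that it agrees with Lebesgue measure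
on `m`-dimensional planes, pulled back along `ι`. -/
def vol (m : ℕ) {d : ℕ} {M : Type*} [MeasurableSpace M]
    (ι : M → EuclideanSpace ℝ (Fin d)) : Measure M :=
  (Measure.euclideanHausdorffMeasure m : Measure (EuclideanSpace ℝ (Fin d))).comap ι

/-- The reach of a set `S`: the supremum of all `r ≥ 0` such that every point at distance less
than `r` from `S` has exactly one nearest point in `S`. -/
def reach {d : ℕ} (S : Set (EuclideanSpace ℝ (Fin d))) : ℝ :=
  sSup {r : ℝ | 0 ≤ r ∧ ∀ z, Metric.infDist z S < r →
    ∃! y, y ∈ S ∧ dist z y = Metric.infDist z S}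

/-- The geodesic distance of the induced metric: the infimum of the lengths of the `C¹` curves
in `M` from `x` to `y`. Since `ι` is a smooth embedding, a curve `γ` in `M` is `C¹` iff `ι ∘ γ`
is, and the induced length of its velocity is the Euclidean length of `(ι ∘ γ)'`. -/
def geoDist {d : ℕ} {M : Type*} (ι : M → EuclideanSpace ℝ (Fin d)) (x y : M) : ℝ :=
  sInf {l : ℝ | ∃ γ : ℝ → M, ContDiffOn ℝ 1 (ι ∘ γ) (Set.Icc 0 1) ∧ γ 0 = x ∧ γ 1 = y ∧
    l = ∫ t in (0 : ℝ)..1, ‖derivWithin (ι ∘ γ) (Set.Icc 0 1) t‖}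

/-- The open geodesic ball. -/
def geoBall {d : ℕ} {M : Type*} (ι : M → EuclideanSpace ℝ (Fin d)) (x : M) (r : ℝ) : Set M :=
  {y | geoDist ι x y < r}

/-- `f ∈ C^{0,1}(M)`: Lipschitz for the geodesic distance. -/
def IsLip {d : ℕ} {M : Type*} (ι : M → EuclideanSpace ℝ (Fin d)) (f : M → ℝ) : Prop :=
  ∃ L : ℝ, ∀ y z, |f y - f z| ≤ L * geoDist ι y z

/-- The Lipschitz seminorm of `f` on a set `B`. -/
def lipSeminorm {d : ℕ} {M : Type*} (ι : M → EuclideanSpace ℝ (Fin d)) (f : M → ℝ)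
    (B : Set M) : ℝ :=
  sSup {q : ℝ | ∃ y ∈ B, ∃ z ∈ B, y ≠ z ∧ q = |f y - f z| / geoDist ι y z}

/-- The function `η = 1_{[0,1]}`. -/
def eta : ℝ → ℝ := Set.indicator (Set.Icc 0 1) 1

/-- The number `N_r(x)` of indices `i` with `0 < |x_i - x| ≤ r`. -/
def nbrCount {d : ℕ} {M : Type*} (ι : M → EuclideanSpace ℝ (Fin d)) {n : ℕ} (ξ : Fin n → M)
    (r : ℝ) (x : M) : ℕ :=
  Set.ncard {i : Fin n | 0 < dist (ι (ξ i)) (ι x) ∧ dist (ι (ξ i)) (ι x) ≤ r}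

/-- The `k`-nearest neighbour radius `ε_k(x) = min {r > 0 : N_r(x) ≥ k}`. -/
def knnRadius {d : ℕ} {M : Type*} (ι : M → EuclideanSpace ℝ (Fin d)) {n : ℕ} (ξ : Fin n → M)
    (k : ℕ) (x : M) : ℝ :=
  sInf {r : ℝ | 0 < r ∧ k ≤ nbrCount ι ξ r x}

/-- The deterministic radius `ε(x)`, with `k / n = α p(x) ε(x)ᵐ`. -/
def detRadius (m : ℕ) {M : Type*} (p : M → ℝ) (n k : ℕ) (x : M) : ℝ :=
  ((k : ℝ) / (n * ballVol m * p x)) ^ (1 / (m : ℝ))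

/-- `ε⋆`, the maximum of `ε` over `M`. -/
def maxRadius (m : ℕ) {M : Type*} (p : M → ℝ) (n k : ℕ) : ℝ :=
  ⨆ x, detRadius m p n k x

/-- For a radius function `ρ`, the weight
`∫ η(d(x,z)/ρ(x)) η(d(y,z)/ρ(y)) p(z) dV(z)`. -/
def weight (m : ℕ) {d : ℕ} {M : Type*} [MeasurableSpace M] (ι : M → EuclideanSpace ℝ (Fin d))
    (p : M → ℝ) (ρ : M → ℝ) (x y : M) : ℝ :=
  ∫ z, eta (geoDist ι x z / ρ x) * eta (geoDist ι y z / ρ y) * p z ∂(vol m ι)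

/-- The operator `L¹` of the sample `ξ`. -/
def L1 (m : ℕ) {d : ℕ} {M : Type*} [MeasurableSpace M] (ι : M → EuclideanSpace ℝ (Fin d))
    (p : M → ℝ) {n : ℕ} (k : ℕ) (ξ : Fin n → M) (f : M → ℝ) (x : M) : ℝ :=
  (ballVol m * n / k) ^ (1 + 2 / (m : ℝ)) / (2 ^ (m + 2) * k) *
    ∑ i, weight m ι p (knnRadius ι ξ k) x (ξ i) * (f x - f (ξ i))

/-- The operator `L²`. -/
def L2 (m : ℕ) {d : ℕ} {M : Type*} [MeasurableSpace M] (ι : M → EuclideanSpace ℝ (Fin d))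
    (p : M → ℝ) (n k : ℕ) (f : M → ℝ) (x : M) : ℝ :=
  (ballVol m * n / k) ^ (2 + 2 / (m : ℝ)) / (ballVol m * 2 ^ (m + 2)) *
    ∫ y in geoBall ι x (2 * maxRadius m p n k),
      weight m ι p (detRadius m p n k) x y * (f x - f y) * p y ∂(vol m ι)

end

end SNN

/-! ### Uniform charts for a compact immersed manifold -/

namespace SNN

open Filter Topology Metric

/-! Put `μ = p dV`, `h = (k/n)^{1/m}` and `σ = (α p)^{-1/m}`, so that `ε = h σ`. For positive radii
the weight of `x` and `y` is the `μ`-mass of the intersection of two geodesic balls. Both operators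
share a prefactor of order `1 / (k h^{m+2})`; what remains is a sum over the sample with the random
radii `ε_k`, minus `n` times an integral with the radii `ε`, cut off at distance `2 ε⋆`.

Small `h` (`exists_small_scale`). A ball of radius `s` about `x` has mass `(s/σ(x))^m (1 + O(s²))`
by `exists_measure_ball_bounds`: tangential projection distorts lengths only to second order, and
the linear term of `p` integrates to zero over a centred ball. Take `δ ≥ h²`. A Bernstein bound,
applied at `x` and at each sample point, gives `ε_k = (1 + O(δ)) ε` at all these points, outside an
event of probability `O(n exp(-k δ²/4))`; the bias `O(h²)` is absorbed in `δ`. Intersection masses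
then move by `O(h^m δ)`, because only thin annuli are affected (`exists_abs_interMass_sub_le`).
There are `O(k)` relevant sample points and `f` varies by `O([f] h)` among them, so the change of
radii costs `O(k h^m δ [f] h)`. Bernstein again bounds the deviation of the sum with radii `ε` from
its mean by the same quantity. The prefactor turns this into `[f] δ / h`, and `δ` comparable to `h
t` gives the claim; `h ≤ t ≤ 1/h` says that `h² ≤ h t ≤ 1`.

Large `h` (`large_scale`). Now `k/n` is bounded below and crude bounds suffice, provided that only
points within `3 ε⋆` of `x` interact. For this `ε_k ≤ 6/5 ε⋆` is enough, hence a ball of radius `6/5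
ε⋆` must have mass at least `13/10 · k/n`. The hypothesis on `k/n` gives `6 ε⋆ ≤ R`. Federer's
inequality (`two_mul_norm_orthogonal_le`) controls the normal part of a chord by its squared length
over `2R`; a continuity argument (`exists_starProjection_eq_of_norm_le`) then shows that the
tangential projection of the ball covers a Euclidean ball of radius `117/100 ε⋆`, and projection
does not increase volume. -/

theorem two_le_infty : (2 : WithTop ℕ∞) ≤ ∞ := by
  have : ((2 : ℕ∞) : WithTop ℕ∞) ≤ ((⊤ : ℕ∞) : WithTop ℕ∞) := WithTop.coe_le_coe.2 le_top
  exact this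

/-- If the derivative is `K`-Lipschitz on a ball around `0`, the map is close to its linearization
at `0`, in the sense of `ApproximatesLinearOn`. -/
theorem norm_sub_sub_le_of_lipschitz_deriv {V W : Type*} [NormedAddCommGroup V] [NormedSpace ℝ V]
    [NormedAddCommGroup W] [NormedSpace ℝ W] {f : V → W} {D : V → V →L[ℝ] W} {K ρ s : ℝ}
    (hD : ∀ a, ‖a‖ < ρ → HasFDerivAt f (D a) a)
    (hL : ∀ a b, ‖a‖ < ρ → ‖b‖ < ρ → ‖D a - D b‖ ≤ K * ‖a - b‖) (hK : 0 ≤ K) (hs : s < ρ)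
    {a b : V} (ha : ‖a‖ ≤ s) (hb : ‖b‖ ≤ s) :
    ‖f a - f b - D 0 (a - b)‖ ≤ K * s * ‖a - b‖ := by
  have hs0 : 0 ≤ s := (norm_nonneg a).trans ha
  refine (convex_closedBall (0 : V) s).norm_image_sub_le_of_norm_hasFDerivWithin_le'
    (f' := D) (fun z hz => ?_) (fun z hz => ?_) (by simpa using hb) (by simpa using ha)
  · exact (hD z ((by simpa using hz : ‖z‖ ≤ s).trans_lt hs)).hasFDerivWithinAt
  · have hz : ‖z‖ ≤ s := by simpa using hz
    have := hL z 0 (hz.trans_lt hs) (by simpa using hs0.trans_lt hs)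
    rw [sub_zero] at this
    exact this.trans (by gcongr)

/-- A parametrization `q` of a neighbourhood of `x` in `M`, centred at `x`, in which `ι` is an
immersion and `ι`, `p` have derivatives that are bounded and Lipschitz with constant `K`. -/
structure ControlledChart (m : ℕ) {d : ℕ} {M : Type*} (ι : M → EuclideanSpace ℝ (Fin d))
    (p : M → ℝ) (K ρ r : ℝ) (x : M) where
  q : EuclideanSpace ℝ (Fin m) → M
  D : EuclideanSpace ℝ (Fin m) → EuclideanSpace ℝ (Fin m) →L[ℝ] EuclideanSpace ℝ (Fin d)
  g : EuclideanSpace ℝ (Fin m) → EuclideanSpace ℝ (Fin m) →L[ℝ] ℝ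
  q_zero : q 0 = x
  hasFDerivAt : ∀ a, ‖a‖ < ρ → HasFDerivAt (ι ∘ q) (D a) a
  lip : ∀ a b, ‖a‖ < ρ → ‖b‖ < ρ → ‖D a - D b‖ ≤ K * ‖a - b‖
  norm_le : ‖D 0‖ ≤ K
  le_norm : ∀ v, ‖v‖ ≤ K * ‖D 0 v‖
  hasFDerivAt_density : ∀ a, ‖a‖ < ρ → HasFDerivAt (p ∘ q) (g a) a
  lip_density : ∀ a b, ‖a‖ < ρ → ‖b‖ < ρ → ‖g a - g b‖ ≤ K * ‖a - b‖
  norm_density_le : ‖g 0‖ ≤ K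
  surj : ∀ y, ‖ι y - ι x‖ < r → ∃ a, ‖a‖ ≤ K * ‖ι y - ι x‖ ∧ ‖a‖ < ρ ∧ q a = y

/-- The condition `K * r' ≤ ρ'` keeps the parameters supplied by `surj` inside the smaller domain.
-/
theorem nonempty_controlledChart_mono {m d : ℕ} {M : Type*} {ι : M → EuclideanSpace ℝ (Fin d)} {p : M → ℝ}
    {K K' ρ ρ' r r' : ℝ} {x : M} (h : Nonempty (ControlledChart m ι p K ρ r x)) (hK0 : 0 < K) (hK : K ≤ K')
    (hρ : ρ' ≤ ρ) (hr : r' ≤ r) (hr' : K * r' ≤ ρ') : Nonempty (ControlledChart m ι p K' ρ' r' x) := by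
  obtain ⟨⟨q, D, g, h0, h1, h2, h3, h4, h5, h6, h7, h8⟩⟩ := h
  refine ⟨q, D, g, h0, fun a ha => h1 a (ha.trans_le hρ), fun a b ha hb => ?_, h3.trans hK,
    fun v => (h4 v).trans (by gcongr), fun a ha => h5 a (ha.trans_le hρ), fun a b ha hb => ?_,
    h7.trans hK, fun y hy => ?_⟩
  · exact (h2 a b (ha.trans_le hρ) (hb.trans_le hρ)).trans (by gcongr)
  · exact (h6 a b (ha.trans_le hρ) (hb.trans_le hρ)).trans (by gcongr)
  · obtain ⟨a, ha, -, hq⟩ := h8 y (hy.trans_le hr)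
    exact ⟨a, ha.trans (by gcongr), (ha.trans_lt (by gcongr)).trans_le hr', hq⟩

section

variable {m d : ℕ} {M : Type*} [TopologicalSpace M]
    [ChartedSpace (EuclideanSpace ℝ (Fin m)) M]
    {ι : M → EuclideanSpace ℝ (Fin d)} {p : M → ℝ}

/-- An immersion has a chart in which it is smooth with injective derivative at the base point. -/
theorem exists_chart_injective_fderiv {x : M}
    (hι : Manifold.IsImmersionAt (𝓡 m) 𝓘(ℝ, EuclideanSpace ℝ (Fin d)) ∞ ι x)
    (hp : ContMDiff (𝓡 m) 𝓘(ℝ, ℝ) 2 p) :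
    ∃ e : OpenPartialHomeomorph M (EuclideanSpace ℝ (Fin m)), x ∈ e.source ∧
      ContDiffOn ℝ ∞ (ι ∘ e.symm) e.target ∧ ContDiffOn ℝ 2 (p ∘ e.symm) e.target ∧
      Function.Injective (fderiv ℝ (ι ∘ e.symm) (e x)) := by
  have hmem := hι.domChart_mem_maximalAtlas
  set e := hι.domChart with he
  have hx : x ∈ e.source := hι.mem_domChart_source
  have hsymm : ContMDiffOn (𝓡 m) (𝓡 m) ∞ e.symm e.target :=
    contMDiffOn_symm_of_mem_maximalAtlas hmem
  have hψ : ContDiffOn ℝ ∞ (ι ∘ e.symm) e.target := by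
    rw [← contMDiffOn_iff_contDiffOn]
    exact hι.contMDiffOn.comp hsymm fun a ha => e.map_target ha
  refine ⟨e, hx, hψ, ?_, ?_⟩
  · rw [← contMDiffOn_iff_contDiffOn]
    exact hp.comp_contMDiffOn (hsymm.of_le two_le_infty)
  · have hex : e x ∈ e.target := e.map_source hx
    set c := hι.codChart with hc
    have hcd : DifferentiableAt ℝ c (ι x) := by
      have h1 : ContMDiffAt 𝓘(ℝ, EuclideanSpace ℝ (Fin d)) 𝓘(ℝ, EuclideanSpace ℝ (Fin d)) ∞ c
          (ι x) := contMDiffAt_of_mem_maximalAtlas hι.codChart_mem_maximalAtlas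
            hι.mem_codChart_source
      exact (contMDiffAt_iff_contDiffAt.1 h1).differentiableAt (by simp)
    have hψd : DifferentiableAt ℝ (ι ∘ e.symm) (e x) :=
      (hψ.contDiffAt (e.open_target.mem_nhds hex)).differentiableAt (by simp)
    have hpt : (ι ∘ e.symm) (e x) = ι x := by simp [e.left_inv hx]
    have hcomp : HasFDerivAt (c ∘ (ι ∘ e.symm))
        ((fderiv ℝ c (ι x)).comp (fderiv ℝ (ι ∘ e.symm) (e x))) (e x) := by
      refine HasFDerivAt.comp _ ?_ hψd.hasFDerivAt
      rw [hpt]; exact hcd.hasFDerivAt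
    -- In the charts of an immersion `ι` reads `v ↦ (v, 0)`. The chain rule makes this injective
    -- linear map factor through the derivative of `ι ∘ e.symm`.
    let j : EuclideanSpace ℝ (Fin m) →L[ℝ] EuclideanSpace ℝ (Fin d) :=
      hι.equiv.toContinuousLinearMap.comp (ContinuousLinearMap.inl ℝ _ _)
    have hev : (c ∘ (ι ∘ e.symm)) =ᶠ[𝓝 (e x)] j := by
      filter_upwards [e.open_target.mem_nhds hex] with a ha
      have := hι.writtenInCharts (show a ∈ (hι.domChart.extend (𝓡 m)).target by
        simpa [OpenPartialHomeomorph.extend] using ha)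
      simpa [OpenPartialHomeomorph.extend, j] using this
    have huniq := (hcomp.congr_of_eventuallyEq hev.symm).unique j.hasFDerivAt
    intro a b hab
    have h1 : j a = j b := by
      rw [← huniq]; simp [hab]
    have h2 := hι.equiv.injective h1
    simpa using congrArg Prod.fst h2

set_option maxHeartbeats 1000000 in
-- Translating one fixed chart moves its origin to any nearby `x`. The derivative is Lipschitz near
-- `e x₀` because the maps are `C²`, and a lower bound on the derivative survives small
-- perturbations, so the same constants serve all these centres. In `surj` the lower bound on the
-- derivative beats the quadratic error.
theorem eventually_controlledChart (hι : Topology.IsEmbedding ι) {x₀ : M}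
    (e : OpenPartialHomeomorph M (EuclideanSpace ℝ (Fin m))) (hx₀ : x₀ ∈ e.source)
    (hψ : ContDiffOn ℝ ∞ (ι ∘ e.symm) e.target) (hpe : ContDiffOn ℝ 2 (p ∘ e.symm) e.target)
    (hinj : Function.Injective (fderiv ℝ (ι ∘ e.symm) (e x₀))) :
    ∃ K ρ r : ℝ, 0 < K ∧ 0 < ρ ∧ 0 < r ∧ ∀ᶠ x in 𝓝 x₀, Nonempty (ControlledChart m ι p K ρ r x) := by
  set ψ := ι ∘ e.symm with hψdef
  set π := p ∘ e.symm with hπdef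
  have hex : e x₀ ∈ e.target := e.map_source hx₀
  have htgt := e.open_target.mem_nhds hex
  have h2 : ContDiffAt ℝ 2 ψ (e x₀) :=
    (hψ.contDiffAt htgt).of_le two_le_infty
  obtain ⟨L₁, s₁, hs₁, hL₁⟩ :=
    (h2.fderiv_right (m := 1) (by norm_num)).exists_lipschitzOnWith
  obtain ⟨L₂, s₂, hs₂, hL₂⟩ :=
    ((hpe.contDiffAt htgt).fderiv_right (m := 1) (by norm_num)).exists_lipschitzOnWith
  obtain ⟨K₁, hK₁, hanti⟩ := (fderiv ℝ ψ (e x₀)).toLinearMap.exists_antilipschitzWith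
    (LinearMap.ker_eq_bot.2 hinj)
  have hlow : ∀ v, ‖v‖ ≤ K₁ * ‖fderiv ℝ ψ (e x₀) v‖ := fun v => by
    simpa using hanti.le_mul_dist v 0
  set K : ℝ := L₁ + L₂ + 4 * K₁ + (‖fderiv ℝ ψ (e x₀)‖ + 1) + (‖fderiv ℝ π (e x₀)‖ + 1) with hK
  have hK₁' : (0 : ℝ) < K₁ := by exact_mod_cast hK₁
  have hL₁0 : (0 : ℝ) ≤ L₁ := L₁.2
  have hL₂0 : (0 : ℝ) ≤ L₂ := L₂.2
  have hn1 := norm_nonneg (fderiv ℝ ψ (e x₀))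
  have hn2 := norm_nonneg (fderiv ℝ π (e x₀))
  have hKpos : 0 < K := by positivity
  obtain ⟨ρ₀, hρ₀, hball⟩ := Metric.mem_nhds_iff.1 (inter_mem htgt (inter_mem hs₁ hs₂))
  -- The first bound leaves room for a centre and a displacement, the second lets errors be absorbed
  -- into the lower bound on the derivative, the third lets its norm grow by at most one.
  obtain ⟨ρ, hρ, hρρ₀, hρK⟩ : ∃ ρ : ℝ, 0 < ρ ∧ 2 * ρ ≤ ρ₀ ∧ 4 * K ^ 2 * ρ ≤ 1 ∧ K * ρ ≤ 1 := by
    refine ⟨min (ρ₀ / 2) (min (1 / (4 * K ^ 2)) (1 / K)), by positivity, ?_, ?_, ?_⟩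
    · linarith [min_le_left (ρ₀ / 2) (min (1 / (4 * K ^ 2)) (1 / K))]
    · have := (min_le_right (ρ₀ / 2) (min (1 / (4 * K ^ 2)) (1 / K))).trans (min_le_left _ _)
      rw [le_div_iff₀ (by positivity)] at this; linarith
    · have := (min_le_right (ρ₀ / 2) (min (1 / (4 * K ^ 2)) (1 / K))).trans (min_le_right _ _)
      rw [le_div_iff₀ (by positivity)] at this; linarith
  have hρK' := hρK.2
  replace hρK := hρK.1
  have hnear : ∀ᶠ y in 𝓝 x₀, y ∈ e.source ∧ e y ∈ ball (e x₀) (ρ / 2) :=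
    (e.open_source.eventually_mem hx₀).and
      ((e.continuousAt hx₀).eventually (ball_mem_nhds _ (by positivity)))
  -- The topology of `M` is induced by `ι`, so points that are close in the ambient space are close
  -- in the chart; this excludes distant sheets of `M`.
  obtain ⟨r, hr, hrnear⟩ : ∃ r > 0, ∀ y, dist (ι y) (ι x₀) < 2 * r →
      y ∈ e.source ∧ e y ∈ ball (e x₀) (ρ / 2) := by
    have h := hnear
    rw [hι.isInducing.nhds_eq_comap] at h
    obtain ⟨t, ht, htt⟩ := mem_comap.1 h
    obtain ⟨r, hr, hrt⟩ := Metric.mem_nhds_iff.1 ht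
    exact ⟨r / 2, by positivity, fun y hy => htt (hrt (by simpa [mul_div_cancel₀] using hy))⟩
  refine ⟨K, ρ, r, hKpos, hρ, hr, ?_⟩
  have hxnear : ∀ᶠ x in 𝓝 x₀, dist (ι x) (ι x₀) < r :=
    hι.continuous.continuousAt.eventually (ball_mem_nhds _ hr)
  filter_upwards [hxnear] with x hx
  obtain ⟨hxs, hxb⟩ := hrnear x (by linarith)
  have hin : ∀ a, ‖a‖ < ρ → e x + a ∈ ball (e x₀) ρ₀ := fun a ha => by
    rw [mem_ball, dist_eq_norm] at hxb ⊢
    calc ‖e x + a - e x₀‖ = ‖(e x - e x₀) + a‖ := by congr 1; abel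
      _ ≤ ‖e x - e x₀‖ + ‖a‖ := norm_add_le _ _
      _ < ρ₀ := by linarith
  have hshift : ∀ a : EuclideanSpace ℝ (Fin m), HasFDerivAt (fun a => e x + a)
      (ContinuousLinearMap.id ℝ (EuclideanSpace ℝ (Fin m))) a :=
    fun a => (hasFDerivAt_id a).const_add _
  have hDd : ∀ a, ‖a‖ < ρ → HasFDerivAt (ι ∘ fun a => e.symm (e x + a))
      (fderiv ℝ ψ (e x + a)) a := fun a ha => by
    have h1 : DifferentiableAt ℝ ψ (e x + a) := (hψ.contDiffAt
      (e.open_target.mem_nhds (hball (hin a ha)).1)).differentiableAt (by simp)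
    have h2 := HasFDerivAt.comp a h1.hasFDerivAt (hshift a)
    rw [ContinuousLinearMap.comp_id] at h2
    exact h2
  have hgd : ∀ a, ‖a‖ < ρ → HasFDerivAt (p ∘ fun a => e.symm (e x + a))
      (fderiv ℝ π (e x + a)) a := fun a ha => by
    have h1 : DifferentiableAt ℝ π (e x + a) := (hpe.contDiffAt
      (e.open_target.mem_nhds (hball (hin a ha)).1)).differentiableAt (by simp)
    have h2 := HasFDerivAt.comp a h1.hasFDerivAt (hshift a)
    rw [ContinuousLinearMap.comp_id] at h2
    exact h2
  have hDL : ∀ a b, ‖a‖ < ρ → ‖b‖ < ρ →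
      ‖fderiv ℝ ψ (e x + a) - fderiv ℝ ψ (e x + b)‖ ≤ L₁ * ‖a - b‖ := fun a b ha hb => by
    simpa [dist_eq_norm] using hL₁.dist_le_mul _ (hball (hin a ha)).2.1 _ (hball (hin b hb)).2.1
  have hgL : ∀ a b, ‖a‖ < ρ → ‖b‖ < ρ →
      ‖fderiv ℝ π (e x + a) - fderiv ℝ π (e x + b)‖ ≤ L₂ * ‖a - b‖ := fun a b ha hb => by
    simpa [dist_eq_norm] using hL₂.dist_le_mul _ (hball (hin a ha)).2.2 _ (hball (hin b hb)).2.2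
  have hback : ‖e x₀ - e x‖ < ρ := by
    rw [mem_ball, dist_eq_norm, norm_sub_rev] at hxb; linarith
  have h00 : ‖(0 : EuclideanSpace ℝ (Fin m))‖ < ρ := by simpa
  have hD0 := hDL 0 (e x₀ - e x) h00 hback
  have hg0 := hgL 0 (e x₀ - e x) h00 hback
  simp only [add_sub_cancel, zero_sub, norm_neg] at hD0 hg0
  have hLK₁ : (L₁ : ℝ) ≤ K := by linarith
  have hLK₂ : (L₂ : ℝ) ≤ K := by linarith
  have hsmall : (L₁ : ℝ) * ‖e x₀ - e x‖ ≤ K * ρ := by gcongr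
  have hlow' : ∀ v, ‖v‖ ≤ 2 * K₁ * ‖fderiv ℝ ψ (e x + 0) v‖ := fun v => by
    have h1 := hlow v
    have h2 : ‖fderiv ℝ ψ (e x₀) v‖ ≤ ‖fderiv ℝ ψ (e x + 0) v‖ + K * ρ * ‖v‖ := by
      have : fderiv ℝ ψ (e x₀) v = fderiv ℝ ψ (e x + 0) v -
        (fderiv ℝ ψ (e x + 0) - fderiv ℝ ψ (e x₀)) v := by simp
      rw [this]
      refine (norm_sub_le _ _).trans ?_
      gcongr
      exact (ContinuousLinearMap.le_opNorm _ _).trans (by gcongr; linarith)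
    have h3 : (K₁ : ℝ) * (K * ρ) ≤ 1 / 2 := by
      have : (K₁ : ℝ) * (K * ρ) ≤ K * (K * ρ) := by gcongr; linarith
      linarith [show K * (K * ρ) = K ^ 2 * ρ by ring]
    nlinarith [norm_nonneg v, mul_le_mul_of_nonneg_left h2 hK₁'.le,
      mul_le_mul_of_nonneg_right h3 (norm_nonneg v)]
  refine ⟨fun a => e.symm (e x + a), fun a => fderiv ℝ ψ (e x + a), fun a => fderiv ℝ π (e x + a),
    by simp [e.left_inv hxs], hDd, fun a b ha hb => (hDL a b ha hb).trans (by gcongr), ?_, ?_,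
    hgd, fun a b ha hb => (hgL a b ha hb).trans (by gcongr), ?_, ?_⟩
  · have := norm_sub_norm_le (fderiv ℝ ψ (e x + 0)) (fderiv ℝ ψ (e x₀))
    linarith
  · exact fun v => (hlow' v).trans (by gcongr; linarith)
  · have := norm_sub_norm_le (fderiv ℝ π (e x + 0)) (fderiv ℝ π (e x₀))
    have : (L₂ : ℝ) * ‖e x₀ - e x‖ ≤ K * ρ := by gcongr
    linarith
  · intro y hy
    obtain ⟨hys, hyb⟩ := hrnear y (by
      rw [← dist_eq_norm] at hy
      linarith [dist_triangle (ι y) (ι x) (ι x₀)])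
    set a := e y - e x with ha
    have haρ : ‖a‖ < ρ := by
      rw [mem_ball] at hxb hyb
      rw [ha, ← dist_eq_norm]
      linarith [dist_triangle_right (e y) (e x) (e x₀)]
    have hqa : e.symm (e x + a) = y := by simp [ha, e.left_inv hys]
    refine ⟨a, ?_, haρ, hqa⟩
    have happ := norm_sub_sub_le_of_lipschitz_deriv hDd hDL hL₁0 haρ le_rfl
      (b := 0) (by simp)
    simp only [Function.comp_apply, hqa, add_zero, e.left_inv hxs, sub_zero] at happ
    have hl := hlow' a
    rw [add_zero] at hl
    have h1 : ‖fderiv ℝ ψ (e x) a‖ ≤ ‖ι y - ι x‖ + L₁ * ‖a‖ * ‖a‖ := by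
      have : fderiv ℝ ψ (e x) a = (ι y - ι x) - (ι y - ι x - fderiv ℝ ψ (e x) a) := by abel
      rw [this]
      exact (norm_sub_le _ _).trans (by gcongr)
    have h2 : 2 * K₁ * (L₁ * ‖a‖) ≤ 1 / 2 := by
      have h5 : 2 * K₁ ≤ K := by linarith
      have h6 : L₁ * ‖a‖ ≤ K * ρ := by gcongr
      have h7 : 2 * K₁ * (L₁ * ‖a‖) ≤ K * (K * ρ) := by gcongr
      linarith [show K * (K * ρ) = K ^ 2 * ρ by ring]
    have h3 : ‖a‖ ≤ 4 * K₁ * ‖ι y - ι x‖ := by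
      nlinarith [norm_nonneg a, mul_le_mul_of_nonneg_left h1 (by positivity : (0 : ℝ) ≤ 2 * K₁),
        mul_le_mul_of_nonneg_right h2 (norm_nonneg a)]
    exact h3.trans (by gcongr; linarith)

/-- Constants for two sets are merged by the larger `K`, the smaller `ρ`, and an `r` below `ρ / K`;
compactness does the rest. -/
theorem exists_controlledChart [CompactSpace M]
    (hι : Manifold.IsSmoothEmbedding (𝓡 m) 𝓘(ℝ, EuclideanSpace ℝ (Fin d)) ∞ ι)
    (hp : ContMDiff (𝓡 m) 𝓘(ℝ, ℝ) 2 p) :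
    ∃ K ρ r : ℝ, 0 < K ∧ 0 < ρ ∧ 0 < r ∧ ∀ x, Nonempty (ControlledChart m ι p K ρ r x) := by
  suffices h : ∃ K ρ r : ℝ, 0 < K ∧ 0 < ρ ∧ 0 < r ∧
      ∀ x ∈ (Set.univ : Set M), Nonempty (ControlledChart m ι p K ρ r x) by simpa using h
  refine isCompact_univ.induction_on (p := fun s => ∃ K ρ r : ℝ, 0 < K ∧ 0 < ρ ∧ 0 < r ∧
      ∀ x ∈ s, Nonempty (ControlledChart m ι p K ρ r x)) ?_ ?_ ?_ ?_
  · exact ⟨1, 1, 1, one_pos, one_pos, one_pos, by simp⟩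
  · rintro s t hst ⟨K, ρ, r, h0, h1, h2, h3⟩
    exact ⟨K, ρ, r, h0, h1, h2, fun x hx => h3 x (hst hx)⟩
  · rintro s t ⟨K₁, ρ₁, r₁, h01, h11, h21, h31⟩ ⟨K₂, ρ₂, r₂, h02, h12, h22, h32⟩
    have hρ : 0 < min ρ₁ ρ₂ := lt_min h11 h12
    have hK : 0 < max K₁ K₂ := lt_max_of_lt_left h01
    have hr : 0 < min (min r₁ r₂) (min ρ₁ ρ₂ / max K₁ K₂) :=
      lt_min (lt_min h21 h22) (div_pos hρ hK)
    have hmul : max K₁ K₂ * min (min r₁ r₂) (min ρ₁ ρ₂ / max K₁ K₂) ≤ min ρ₁ ρ₂ := by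
      have := min_le_right (min r₁ r₂) (min ρ₁ ρ₂ / max K₁ K₂)
      rwa [le_div_iff₀ hK, mul_comm] at this
    refine ⟨max K₁ K₂, min ρ₁ ρ₂, min (min r₁ r₂) (min ρ₁ ρ₂ / max K₁ K₂), hK, hρ, hr, ?_⟩
    rintro x (hx | hx)
    · exact nonempty_controlledChart_mono (h31 x hx) h01 (le_max_left _ _) (min_le_left _ _)
        ((min_le_left _ _).trans (min_le_left _ _))
        (le_trans (by gcongr; exact le_max_left _ _) hmul)
    · exact nonempty_controlledChart_mono (h32 x hx) h02 (le_max_right _ _) (min_le_right _ _)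
        ((min_le_left _ _).trans (min_le_right _ _))
        (le_trans (by gcongr; exact le_max_right _ _) hmul)
  · intro x _
    obtain ⟨e, he, h1, h2, h3⟩ := exists_chart_injective_fderiv (hι.isImmersion.isImmersionAt x) hp
    obtain ⟨K, ρ, r, hK, hρ, hr, hev⟩ := eventually_controlledChart hι.isEmbedding e he h1 h2 h3
    exact ⟨_, mem_nhdsWithin_of_mem_nhds hev, K, ρ, r, hK, hρ, hr, fun x hx => hx⟩

end

end SNN

/-! ### Second-order geometry relative to tangent spaces -/

namespace SNN

open Filter Topology Metric

namespace ControlledChart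

variable {m d : ℕ} {M : Type*} {ι : M → EuclideanSpace ℝ (Fin d)} {p : M → ℝ} {K ρ r : ℝ} {x : M}

/-- The tangent space at the centre of the chart. -/
noncomputable def tangent (c : ControlledChart m ι p K ρ r x) :
    Submodule ℝ (EuclideanSpace ℝ (Fin d)) :=
  (c.D 0).toLinearMap.range

theorem D_mem (c : ControlledChart m ι p K ρ r x) (v) : c.D 0 v ∈ c.tangent := ⟨v, rfl⟩

theorem injective (c : ControlledChart m ι p K ρ r x) :
    Function.Injective (c.D 0).toLinearMap := by
  rw [← LinearMap.ker_eq_bot, LinearMap.ker_eq_bot']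
  intro v hv
  have := c.le_norm v
  rw [show c.D 0 v = 0 from hv] at this
  simpa using this

theorem finrank_tangent (c : ControlledChart m ι p K ρ r x) :
    Module.finrank ℝ c.tangent = m := by
  rw [tangent, LinearMap.finrank_range_of_inj c.injective]; simp

theorem linear_approx (c : ControlledChart m ι p K ρ r x) (hK : 1 ≤ K) {s : ℝ} (hs : s < ρ)
    {a b} (ha : ‖a‖ ≤ s) (hb : ‖b‖ ≤ s) :
    ‖ι (c.q a) - ι (c.q b) - c.D 0 (a - b)‖ ≤ K * s * ‖a - b‖ :=
  norm_sub_sub_le_of_lipschitz_deriv c.hasFDerivAt c.lip (by linarith) hs ha hb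

theorem norm_sub_le (c : ControlledChart m ι p K ρ r x) (hK : 1 ≤ K) {s : ℝ} (hs : s < ρ)
    (hs1 : s ≤ 1) {a} (ha : ‖a‖ ≤ s) :
    ‖ι (c.q a) - ι x‖ ≤ 2 * K * ‖a‖ := by
  have hs0 : 0 ≤ s := (norm_nonneg a).trans ha
  have h := c.linear_approx hK hs ha (b := 0) (by simpa)
  rw [c.q_zero, sub_zero] at h
  have h2 : ‖c.D 0 a‖ ≤ K * ‖a‖ := (c.D 0).le_of_opNorm_le c.norm_le a
  have h3 : K * s * ‖a‖ ≤ K * 1 * ‖a‖ := by gcongr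
  calc ‖ι (c.q a) - ι x‖ = ‖(ι (c.q a) - ι x - c.D 0 a) + c.D 0 a‖ := by congr 1; abel
    _ ≤ _ := (norm_add_le _ _).trans (by linarith)

/-- The linear part `D 0 (a - b)` of a chord is tangent, so the normal projection sees only the
linearization error; the lower bound on `D 0` compares `‖a - b‖` with the chord. -/
theorem norm_orthogonal_sub_le (c : ControlledChart m ι p K ρ r x) (hK : 1 ≤ K) {s : ℝ} {y y' : M}
    (hsr : s < r) (hsρ : K * s < ρ) (hsK : 2 * K ^ 3 * s ≤ 1)
    (hy : ‖ι y - ι x‖ ≤ s) (hy' : ‖ι y' - ι x‖ ≤ s) :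
    ‖c.tangentᗮ.starProjection (ι y - ι y')‖ ≤ 2 * K ^ 3 * s * ‖ι y - ι y'‖ := by
  obtain ⟨a, ha, -, rfl⟩ := c.surj y (hy.trans_lt hsr)
  obtain ⟨b, hb, -, rfl⟩ := c.surj y' (hy'.trans_lt hsr)
  have hK0 : 0 < K := by linarith
  have hs0 : 0 ≤ s := (norm_nonneg _).trans hy
  have h := c.linear_approx hK hsρ (ha.trans (by gcongr)) (hb.trans (by gcongr))
  set Δ := ι (c.q a) - ι (c.q b)
  have hQ : c.tangentᗮ.starProjection Δ = c.tangentᗮ.starProjection (Δ - c.D 0 (a - b)) := by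
    rw [map_sub _ Δ, Submodule.starProjection_orthogonal_apply_eq_zero (c.D_mem _), sub_zero]
  have hle := c.le_norm (a - b)
  have h2 : ‖c.D 0 (a - b)‖ ≤ ‖Δ‖ + K * (K * s) * ‖a - b‖ := by
    calc ‖c.D 0 (a - b)‖ = ‖Δ - (Δ - c.D 0 (a - b))‖ := by congr 1; abel
      _ ≤ _ := (_root_.norm_sub_le _ _).trans (by linarith)
  have h3 : ‖a - b‖ ≤ 2 * K * ‖Δ‖ := by
    nlinarith [mul_le_mul_of_nonneg_left h2 hK0.le,
      mul_le_mul_of_nonneg_right hsK (norm_nonneg (a - b))]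
  rw [hQ]
  refine (Submodule.norm_starProjection_apply_le _ _).trans (h.trans ?_)
  calc K * (K * s) * ‖a - b‖ ≤ K * (K * s) * (2 * K * ‖Δ‖) := by gcongr
    _ = _ := by ring

/-- A quantitative inverse function theorem for the projection onto `S`, a space that may be tilted
against the tangent space by an angle of sine at most `3/5`. This tolerance makes it usable far from
the point where `S` is tangent. -/
theorem exists_starProjection_eq (c : ControlledChart m ι p K ρ r x) (hK : 1 ≤ K)
    (S : Submodule ℝ (EuclideanSpace ℝ (Fin d))) (hS : Module.finrank ℝ S = m)
    (hang : ∀ u ∈ c.tangent, ‖Sᗮ.starProjection u‖ ≤ 3 / 5 * ‖u‖)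
    {v : EuclideanSpace ℝ (Fin d)} (hv : v ∈ S)
    (hvρ : 5 * K / 2 * ‖v‖ < ρ) (hvK : 25 * K ^ 3 / 4 * ‖v‖ ≤ 1) :
    ∃ y', S.starProjection (ι y' - ι x) = v ∧ ‖ι y' - ι x‖ ≤ 5 * K ^ 2 * ‖v‖ := by
  have hK0 : 0 < K := by linarith
  let f' : EuclideanSpace ℝ (Fin m) →L[ℝ] S := S.orthogonalProjectionOnto.comp (c.D 0)
  have hf' : ∀ a, ‖a‖ ≤ 5 / 4 * K * ‖f' a‖ := fun a => by
    have h1 := hang _ (c.D_mem a)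
    have h2 := S.norm_sq_eq_add_norm_sq_starProjection (c.D 0 a)
    have h3 : ‖S.starProjection (c.D 0 a)‖ = ‖f' a‖ := rfl
    -- Pythagoras: sine at most `3/5` means cosine at least `4/5`.
    have h4 : ‖c.D 0 a‖ ≤ 5 / 4 * ‖f' a‖ := by
      rw [h3] at h2
      have := norm_nonneg (Sᗮ.starProjection (c.D 0 a))
      refine abs_le_of_sq_le_sq' ?_ (by positivity) |>.2
      nlinarith [norm_nonneg (c.D 0 a)]
    calc ‖a‖ ≤ K * ‖c.D 0 a‖ := c.le_norm a
      _ ≤ K * (5 / 4 * ‖f' a‖) := by gcongr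
      _ = _ := by ring
  have hinj : Function.Injective f'.toLinearMap := by
    rw [← LinearMap.ker_eq_bot, LinearMap.ker_eq_bot']
    intro a ha
    have := hf' a
    rw [show f' a = 0 from ha] at this
    simpa using this
  let e := f'.toLinearMap.linearEquivOfInjective hinj (by rw [hS]; simp)
  have he : ∀ a, e a = f' a := fun a => rfl
  let inv : f'.NonlinearRightInverse :=
    ⟨e.symm, .mk (5 / 4 * K) (by positivity), fun y => by
      have := hf' (e.symm y)
      rwa [← he, e.apply_symm_apply] at this, fun y => by rw [← he]; simp⟩
  -- The linear part expands at rate at least `4 / (5K)`. Half of that rate is left after the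
  -- nonlinear error, and `2 / (5K) * s = ‖v‖`.
  set s := 5 * K / 2 * ‖v‖ with hsdef
  have hs0 : 0 ≤ s := by positivity
  have happ : ApproximatesLinearOn (fun a => S.orthogonalProjectionOnto (ι (c.q a))) f'
      (closedBall 0 s) (.mk (K * s) (by positivity)) := by
    intro a ha b hb
    have h := c.linear_approx hK hvρ (by simpa using ha) (by simpa using hb)
    simp only [f', ContinuousLinearMap.comp_apply, ← map_sub]
    exact (Submodule.norm_orthogonalProjectionOnto_apply_le _ _).trans h
  have hsurj := happ.surjOn_closedBall_of_nonlinearRightInverse inv hs0 subset_rfl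
  have hrad : ‖v‖ ≤ ((5 / 4 * K)⁻¹ - K * s) * s := by
    have h1 : K * s ≤ 2 / (5 * K) := by
      rw [le_div_iff₀ (by positivity), hsdef]
      nlinarith
    have h2 : (5 / 4 * K)⁻¹ - K * s ≥ 2 / (5 * K) := by
      have : (5 / 4 * K)⁻¹ = 2 / (5 * K) + 2 / (5 * K) := by field_simp; norm_num
      linarith
    calc ‖v‖ = 2 / (5 * K) * s := by rw [hsdef]; field_simp
      _ ≤ _ := by gcongr
  obtain ⟨a, ha, hav⟩ := hsurj (show (S.orthogonalProjectionOnto (ι (c.q 0)) + ⟨v, hv⟩) ∈ _ by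
    rw [mem_closedBall, dist_eq_norm, add_sub_cancel_left]
    exact hrad)
  have ha : ‖a‖ ≤ s := by simpa using ha
  refine ⟨c.q a, ?_, ?_⟩
  · have : S.orthogonalProjectionOnto (ι (c.q a) - ι x) = ⟨v, hv⟩ := by
      simp only [c.q_zero] at hav
      rw [map_sub, hav]; simp
    rw [Submodule.starProjection_apply, this]
  · have hs1 : s ≤ 1 := by
      have : 1 ≤ K ^ 2 := one_le_pow₀ hK
      have hk3 : K ≤ K ^ 3 := by nlinarith
      have : 5 * K / 2 * ‖v‖ ≤ 25 * K ^ 3 / 4 * ‖v‖ := by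
        have := norm_nonneg v
        nlinarith
      linarith
    calc _ ≤ 2 * K * ‖a‖ := c.norm_sub_le hK hvρ hs1 ha
      _ ≤ 2 * K * s := by gcongr
      _ = _ := by rw [hsdef]; ring

/-- The functional is `g 0` composed with the inverse of `D 0` on the tangent space. Linearizing `p`
and linearizing the chord both cost a quadratic error. -/
theorem exists_taylor (c : ControlledChart m ι p K ρ r x) (hK : 1 ≤ K) :
    ∃ ℓ : EuclideanSpace ℝ (Fin d) →L[ℝ] ℝ, ‖ℓ‖ ≤ K ^ 2 ∧ ∀ y, ‖ι y - ι x‖ < r →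
      |p y - p x - ℓ (c.tangent.starProjection (ι y - ι x))| ≤ 2 * K ^ 5 * ‖ι y - ι x‖ ^ 2 := by
  have hK0 : 0 < K := by linarith
  let e : EuclideanSpace ℝ (Fin m) ≃ₗ[ℝ] c.tangent := LinearEquiv.ofInjective _ c.injective
  have he : ∀ a, (e a : EuclideanSpace ℝ (Fin d)) = c.D 0 a := fun a => rfl
  let A : c.tangent →L[ℝ] EuclideanSpace ℝ (Fin m) := LinearMap.toContinuousLinearMap e.symm
  have hA : ∀ u, ‖A u‖ ≤ K * ‖u‖ := fun u => by
    have h := c.le_norm (e.symm u)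
    rw [← he, LinearEquiv.apply_symm_apply] at h
    exact h
  let ℓ : EuclideanSpace ℝ (Fin d) →L[ℝ] ℝ := (c.g 0).comp (A.comp c.tangent.orthogonalProjectionOnto)
  have hℓ : ∀ w, ‖ℓ w‖ ≤ K ^ 2 * ‖w‖ := fun w => by
    calc ‖ℓ w‖ ≤ K * ‖A (c.tangent.orthogonalProjectionOnto w)‖ :=
          (c.g 0).le_of_opNorm_le c.norm_density_le _
      _ ≤ K * (K * ‖c.tangent.orthogonalProjectionOnto w‖) := by gcongr; exact hA _
      _ ≤ K * (K * ‖w‖) := by gcongr; exact Submodule.norm_orthogonalProjectionOnto_apply_le _ _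
      _ = _ := by ring
  refine ⟨ℓ, ContinuousLinearMap.opNorm_le_bound _ (by positivity) hℓ, fun y hy => ?_⟩
  obtain ⟨a, ha, haρ, rfl⟩ := c.surj y hy
  have happ := c.linear_approx hK haρ le_rfl (b := 0) (by simp)
  have hpp := norm_sub_sub_le_of_lipschitz_deriv c.hasFDerivAt_density c.lip_density hK0.le haρ
    le_rfl (b := 0) (by simp)
  simp only [Function.comp_apply, c.q_zero, sub_zero] at happ hpp
  set w := ι (c.q a) - ι x
  have hℓD : ℓ (c.D 0 a) = c.g 0 a := by
    have : c.tangent.orthogonalProjectionOnto (c.D 0 a) = e a :=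
      Submodule.orthogonalProjectionOnto_mem_subspace_eq_self (e a)
    simp only [ℓ, ContinuousLinearMap.comp_apply, this]
    congr 1
    exact e.symm_apply_apply a
  have hproj : ℓ (c.tangent.starProjection w) = ℓ w := by
    simp only [ℓ, ContinuousLinearMap.comp_apply, Submodule.starProjection_apply,
      Submodule.orthogonalProjectionOnto_mem_subspace_eq_self]
  have h1 : p (c.q a) - p x - ℓ (c.tangent.starProjection w) =
      (p (c.q a) - p x - c.g 0 a) - ℓ (w - c.D 0 a) := by
    rw [hproj, map_sub _ w, hℓD]; ring
  rw [h1]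
  have h2 := hℓ (w - c.D 0 a)
  rw [Real.norm_eq_abs] at h2 hpp
  have h3 : K ^ 2 * ‖w - c.D 0 a‖ ≤ K ^ 2 * (K * ‖a‖ * ‖a‖) := by gcongr
  have h4 : K * ‖a‖ * ‖a‖ ≤ K * (K * ‖w‖) * (K * ‖w‖) := by gcongr
  have h5 : K * ‖a‖ * ‖a‖ ≤ K ^ 2 * (K * ‖a‖ * ‖a‖) :=
    le_mul_of_one_le_left (by positivity) (one_le_pow₀ hK)
  have h6 : K ^ 2 * (K * ‖a‖ * ‖a‖) ≤ K ^ 2 * (K * (K * ‖w‖) * (K * ‖w‖)) := by gcongr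
  calc _ ≤ |p (c.q a) - p x - c.g 0 a| + |ℓ (w - c.D 0 a)| := abs_sub _ _
    _ ≤ 2 * (K ^ 2 * (K * (K * ‖w‖) * (K * ‖w‖))) := by linarith
    _ = _ := by ring

/-- The curve is the image of a straight segment in the chart. Its velocity differs from the chord
`w` by a second-order vector, and only the square of that difference, divided by `‖w‖`, lengthens
the curve: the excess is of third order. -/
theorem exists_path (c : ControlledChart m ι p K ρ r x) (hK : 1 ≤ K) {y : M}
    (hy : ‖ι y - ι x‖ < r) :
    ∃ γ : ℝ → M, ContDiffOn ℝ 1 (ι ∘ γ) (Set.Icc 0 1) ∧ γ 0 = x ∧ γ 1 = y ∧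
      ∫ t in (0 : ℝ)..1, ‖derivWithin (ι ∘ γ) (Set.Icc 0 1) t‖ ≤
        ‖ι y - ι x‖ + 2 * K ^ 6 * ‖ι y - ι x‖ ^ 3 := by
  have hK0 : 0 < K := by linarith
  obtain ⟨a, ha, haρ, rfl⟩ := c.surj y hy
  set V : ℝ → EuclideanSpace ℝ (Fin d) := fun t => c.D (t • a) a with hV
  have hta : ∀ t ∈ Set.Icc (0 : ℝ) 1, ‖t • a‖ ≤ ‖a‖ := fun t ht => by
    rw [norm_smul, Real.norm_of_nonneg ht.1]
    exact mul_le_of_le_one_left (norm_nonneg _) ht.2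
  have hder : ∀ t ∈ Set.Icc (0 : ℝ) 1, HasDerivAt (ι ∘ fun t : ℝ => c.q (t • a)) (V t) t := by
    intro t ht
    have h1 : HasDerivAt (fun t : ℝ => t • a) a t := by
      simpa using (hasDerivAt_id t).smul_const a
    exact (c.hasFDerivAt _ ((hta t ht).trans_lt haρ)).comp_hasDerivAt t h1
  have hVc : ContinuousOn V (Set.Icc 0 1) := by
    have hlip : LipschitzOnWith (.mk (K * ‖a‖ * ‖a‖) (by positivity)) V (Set.Icc 0 1) := by
      refine LipschitzOnWith.of_dist_le_mul fun s hs t ht => ?_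
      rw [dist_eq_norm, hV]
      simp only [← _root_.sub_apply]
      refine (ContinuousLinearMap.le_opNorm _ _).trans ?_
      have := c.lip (s • a) (t • a) ((hta s hs).trans_lt haρ) ((hta t ht).trans_lt haρ)
      rw [← sub_smul, norm_smul] at this
      calc _ ≤ K * (‖s - t‖ * ‖a‖) * ‖a‖ := by gcongr
        _ = _ := by rw [dist_eq_norm, NNReal.coe_mk]; ring
    exact hlip.continuousOn
  have hdw : ∀ t ∈ Set.Icc (0 : ℝ) 1,
      derivWithin (ι ∘ fun t : ℝ => c.q (t • a)) (Set.Icc 0 1) t = V t := fun t ht =>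
    (hder t ht).hasDerivWithinAt.derivWithin (uniqueDiffOn_Icc one_pos t ht)
  refine ⟨fun t => c.q (t • a), ?_, by simp [c.q_zero], by simp, ?_⟩
  · rw [contDiffOn_one_iff_derivWithin (uniqueDiffOn_Icc one_pos)]
    exact ⟨fun t ht => (hder t ht).differentiableAt.differentiableWithinAt, hVc.congr hdw⟩
  · set w := ι (c.q a) - ι x with hw
    have huI : Set.uIcc (0 : ℝ) 1 = Set.Icc 0 1 := Set.uIcc_of_le zero_le_one
    rw [intervalIntegral.integral_congr (g := fun t => ‖V t‖) (fun t ht => by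
      rw [huI] at ht; simp only [hdw t ht])]
    rcases eq_or_ne w 0 with hw0 | hw0
    · have ha0 : a = 0 := by
        rw [hw0] at ha; simpa using ha
      simp [hV, ha0, hw0]
    have hwpos : 0 < ‖w‖ := norm_pos_iff.2 hw0
    have hVw : ∀ t ∈ Set.Icc (0 : ℝ) 1, ‖V t - w‖ ≤ 2 * K * ‖a‖ ^ 2 := by
      intro t ht
      have happ := c.linear_approx hK haρ le_rfl (b := 0) (by simp)
      simp only [c.q_zero, sub_zero] at happ
      have h0 : ‖(0 : EuclideanSpace ℝ (Fin m))‖ < ρ := by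
        simpa using (norm_nonneg a).trans_lt haρ
      have h1 : ‖V t - c.D 0 a‖ ≤ K * ‖a‖ * ‖a‖ := by
        rw [hV]; simp only [← _root_.sub_apply]
        refine (ContinuousLinearMap.le_opNorm _ _).trans ?_
        have := c.lip (t • a) 0 ((hta t ht).trans_lt haρ) h0
        rw [sub_zero] at this
        gcongr
        exact this.trans (by gcongr; exact hta t ht)
      calc ‖V t - w‖ = ‖(V t - c.D 0 a) - (w - c.D 0 a)‖ := by congr 1; abel
        _ ≤ _ := (_root_.norm_sub_le _ _).trans (by linarith)
    -- This is `2 ‖w‖ ‖V‖ ≤ ‖w‖² + ‖V‖² = 2 ⟨w, V⟩ + ‖V - w‖²`. The inner product integrates to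
    -- `‖w‖²` exactly.
    have hpt : ∀ t ∈ Set.Icc (0 : ℝ) 1,
        ‖V t‖ ≤ inner ℝ w (V t) / ‖w‖ + (2 * K * ‖a‖ ^ 2) ^ 2 / (2 * ‖w‖) := by
      intro t ht
      have h1 := hVw t ht
      have h2 : ‖V t - w‖ ^ 2 ≤ (2 * K * ‖a‖ ^ 2) ^ 2 := by gcongr
      have h3 := norm_sub_sq_real (V t) w
      rw [real_inner_comm] at h3
      rw [div_add_div _ _ hwpos.ne' (by positivity), le_div_iff₀ (by positivity)]
      nlinarith [sq_nonneg (‖V t‖ - ‖w‖), mul_le_mul_of_nonneg_left h2 hwpos.le,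
        mul_nonneg hwpos.le (sq_nonneg (‖V t‖ - ‖w‖))]
    have hint1 : IntervalIntegrable (fun t => ‖V t‖) volume 0 1 :=
      ContinuousOn.intervalIntegrable (by rw [huI]; exact hVc.norm)
    have hint2 : IntervalIntegrable (fun t => inner ℝ w (V t)) volume 0 1 :=
      ContinuousOn.intervalIntegrable (by rw [huI]; exact continuousOn_const.inner hVc)
    have hftc : ∫ t in (0 : ℝ)..1, inner ℝ w (V t) = ‖w‖ ^ 2 := by
      rw [intervalIntegral.integral_eq_sub_of_hasDerivAt
        (f := fun t => inner ℝ w ((ι ∘ fun t : ℝ => c.q (t • a)) t)) (fun t ht => ?_) hint2]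
      · simp only [Function.comp_apply, one_smul, zero_smul, c.q_zero]
        rw [← inner_sub_right, ← hw, real_inner_self_eq_norm_sq]
      · rw [huI] at ht
        simpa using (hasDerivAt_const t w).inner ℝ (hder t ht)
    calc ∫ t in (0 : ℝ)..1, ‖V t‖
        ≤ ∫ t in (0 : ℝ)..1, (inner ℝ w (V t) / ‖w‖ + (2 * K * ‖a‖ ^ 2) ^ 2 / (2 * ‖w‖)) :=
          intervalIntegral.integral_mono_on zero_le_one hint1
            ((hint2.div_const _).add intervalIntegrable_const) hpt
      _ = ‖w‖ + (2 * K * ‖a‖ ^ 2) ^ 2 / (2 * ‖w‖) := by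
          rw [intervalIntegral.integral_add (hint2.div_const _) intervalIntegrable_const,
            intervalIntegral.integral_div, hftc]
          simp only [intervalIntegral.integral_const, sub_zero, one_smul]
          congr 1
          field_simp
      _ ≤ ‖w‖ + (2 * K * (K * ‖w‖) ^ 2) ^ 2 / (2 * ‖w‖) := by gcongr
      _ = _ := by field_simp

end ControlledChart

/-- Uniform second-order information on an embedded manifold: approximate tangent spaces, local
surjectivity of tangential projections, a Taylor expansion of `p` and short curves. -/
structure TangentData (m : ℕ) {d : ℕ} {M : Type*} (ι : M → EuclideanSpace ℝ (Fin d))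
    (p : M → ℝ) where
  T : M → Submodule ℝ (EuclideanSpace ℝ (Fin d))
  K : ℝ
  r : ℝ
  one_le : 1 ≤ K
  r_pos : 0 < r
  finrank_eq : ∀ x, Module.finrank ℝ (T x) = m
  flat : ∀ x y y' s, s < r → ‖ι y - ι x‖ ≤ s → ‖ι y' - ι x‖ ≤ s →
    ‖(T x)ᗮ.starProjection (ι y - ι y')‖ ≤ K * s * ‖ι y - ι y'‖
  surj : ∀ x y, (∀ u ∈ T y, ‖(T x)ᗮ.starProjection u‖ ≤ 3 / 5 * ‖u‖) → ∀ v ∈ T x, ‖v‖ < r →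
    ∃ y', (T x).starProjection (ι y' - ι y) = v ∧ ‖ι y' - ι y‖ ≤ K * ‖v‖
  taylor : ∀ x, ∃ ℓ : EuclideanSpace ℝ (Fin d) →L[ℝ] ℝ, ‖ℓ‖ ≤ K ∧ ∀ y, ‖ι y - ι x‖ < r →
    |p y - p x - ℓ ((T x).starProjection (ι y - ι x))| ≤ K * ‖ι y - ι x‖ ^ 2
  path : ∀ x y, ‖ι y - ι x‖ < r → ∃ γ : ℝ → M, ContDiffOn ℝ 1 (ι ∘ γ) (Set.Icc 0 1) ∧
    γ 0 = x ∧ γ 1 = y ∧ ∫ t in (0 : ℝ)..1, ‖derivWithin (ι ∘ γ) (Set.Icc 0 1) t‖ ≤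
      ‖ι y - ι x‖ + K * ‖ι y - ι x‖ ^ 3

theorem nonempty_tangentData {m d : ℕ} {M : Type*} [TopologicalSpace M]
    [ChartedSpace (EuclideanSpace ℝ (Fin m)) M] [CompactSpace M]
    {ι : M → EuclideanSpace ℝ (Fin d)} {p : M → ℝ}
    (hι : Manifold.IsSmoothEmbedding (𝓡 m) 𝓘(ℝ, EuclideanSpace ℝ (Fin d)) ∞ ι)
    (hp : ContMDiff (𝓡 m) 𝓘(ℝ, ℝ) 2 p) : Nonempty (TangentData m ι p) := by
  obtain ⟨K₀, ρ, r₀, hK₀, hρ, hr₀, hch⟩ := exists_controlledChart hι hp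
  obtain ⟨K, hK, r₁, hr₁, hKr₁, hch⟩ : ∃ K : ℝ, 1 ≤ K ∧ ∃ r₁ > 0, K * r₁ ≤ ρ ∧
      ∀ x, Nonempty (ControlledChart m ι p K ρ r₁ x) := by
    have hM : 0 < max K₀ 1 := lt_max_of_lt_left hK₀
    have hmul : max K₀ 1 * min r₀ (ρ / max K₀ 1) ≤ ρ := by
      have := min_le_right r₀ (ρ / max K₀ 1)
      rwa [le_div_iff₀ hM, mul_comm] at this
    refine ⟨max K₀ 1, le_max_right _ _, min r₀ (ρ / max K₀ 1), lt_min hr₀ (div_pos hρ hM), hmul,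
      fun x => ?_⟩
    exact nonempty_controlledChart_mono (hch x) hK₀ (le_max_left _ _) le_rfl (min_le_left _ _)
      (le_trans (by gcongr; exact le_max_left _ _) hmul)
  have c := fun x => (hch x).some
  have hK0 : 0 < K := by linarith
  have hK1 : ∀ n : ℕ, 1 ≤ K ^ n := fun n => one_le_pow₀ hK
  have hKle : ∀ a b : ℕ, a ≤ b → K ^ a ≤ K ^ b := fun a b h => pow_le_pow_right₀ hK h
  set r := min r₁ (min (ρ / (5 * K)) (1 / (10 * K ^ 3))) with hr
  have hrr₁ : r ≤ r₁ := min_le_left _ _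
  have hrρ : 5 * K * r ≤ ρ := by
    have : r ≤ ρ / (5 * K) := (min_le_right _ _).trans (min_le_left _ _)
    rwa [le_div_iff₀ (by positivity), mul_comm] at this
  have hrK : 10 * K ^ 3 * r ≤ 1 := by
    have : r ≤ 1 / (10 * K ^ 3) := (min_le_right _ _).trans (min_le_right _ _)
    rwa [le_div_iff₀ (by positivity), mul_comm] at this
  have hr0 : 0 < r := by positivity
  refine ⟨⟨fun x => (c x).tangent, 5 * K ^ 6, r, by linarith [hK1 6], hr0,
    fun x => (c x).finrank_tangent, ?_, ?_, ?_, ?_⟩⟩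
  · intro x y y' s hs hy hy'
    have hs0 : 0 ≤ s := (norm_nonneg _).trans hy
    refine ((c x).norm_orthogonal_sub_le hK (hs.trans_le hrr₁) ?_ ?_ hy hy').trans ?_
    · nlinarith
    · nlinarith [mul_lt_mul_of_pos_left hs (by positivity : 0 < K ^ 3)]
    · gcongr
      · norm_num
      · norm_num
  · intro x y hang v hv hvr
    obtain ⟨y', h1, h2⟩ := (c y).exists_starProjection_eq hK _ (c x).finrank_tangent hang hv
      (by nlinarith [norm_nonneg v])
      (by nlinarith [mul_lt_mul_of_pos_left hvr (by positivity : 0 < K ^ 3)])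
    refine ⟨y', h1, h2.trans ?_⟩
    have : 5 * K ^ 2 ≤ 5 * K ^ 6 := by linarith [hKle 2 6 (by norm_num)]
    exact mul_le_mul_of_nonneg_right this (by positivity)
  · intro x
    obtain ⟨ℓ, h1, h2⟩ := (c x).exists_taylor hK
    refine ⟨ℓ, h1.trans (by nlinarith [hKle 2 6 (by norm_num)]), fun y hy =>
      (h2 y (hy.trans_le hrr₁)).trans ?_⟩
    have : 2 * K ^ 5 ≤ 5 * K ^ 6 := by linarith [hKle 5 6 (by norm_num), hK1 6]
    exact mul_le_mul_of_nonneg_right this (by positivity)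
  · intro x y hy
    obtain ⟨γ, h1, h2, h3, h4⟩ := (c x).exists_path hK (hy.trans_le hrr₁)
    refine ⟨γ, h1, h2, h3, h4.trans ?_⟩
    gcongr
    norm_num

end SNN

/-! ### The geodesic distance -/

namespace SNN

open Filter Topology Metric

section Curves

variable {d : ℕ} {M : Type*} {ι : M → EuclideanSpace ℝ (Fin d)}

/-- The lengths of the `C¹` curves from `x` to `y`. -/
def lengthSet (ι : M → EuclideanSpace ℝ (Fin d)) (x y : M) : Set ℝ :=
  {l : ℝ | ∃ γ : ℝ → M, ContDiffOn ℝ 1 (ι ∘ γ) (Set.Icc 0 1) ∧ γ 0 = x ∧ γ 1 = y ∧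
    l = ∫ t in (0 : ℝ)..1, ‖derivWithin (ι ∘ γ) (Set.Icc 0 1) t‖}

/-- There is a curve of length `l` from `x` to `y` that is `C¹` on the whole line and stationary
outside of `[0, 1]`. -/
def HasStationaryCurve (ι : M → EuclideanSpace ℝ (Fin d)) (x y : M) (l : ℝ) : Prop :=
  ∃ (γ : ℝ → M) (v : ℝ → EuclideanSpace ℝ (Fin d)), (∀ t, HasDerivAt (ι ∘ γ) (v t) t) ∧
    Continuous v ∧ (∀ t ≤ 0, γ t = x) ∧ (∀ t, 1 ≤ t → γ t = y) ∧ (∀ t ≤ 0, v t = 0) ∧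
    (∀ t, 1 ≤ t → v t = 0) ∧ l = ∫ t in (0 : ℝ)..1, ‖v t‖

theorem HasStationaryCurve.mem_lengthSet {x y : M} {l : ℝ} (h : HasStationaryCurve ι x y l) :
    l ∈ lengthSet ι x y := by
  obtain ⟨γ, v, hd, hc, h0, h1, -, -, hl⟩ := h
  have hdw : ∀ t ∈ Set.Icc (0 : ℝ) 1, derivWithin (ι ∘ γ) (Set.Icc 0 1) t = v t := fun t ht =>
    (hd t).hasDerivWithinAt.derivWithin (uniqueDiffOn_Icc one_pos t ht)
  refine ⟨γ, ?_, h0 0 le_rfl, h1 1 le_rfl, ?_⟩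
  · rw [contDiffOn_one_iff_derivWithin (uniqueDiffOn_Icc one_pos)]
    exact ⟨fun t ht => (hd t).differentiableAt.differentiableWithinAt,
      hc.continuousOn.congr hdw⟩
  · rw [hl]
    refine intervalIntegral.integral_congr fun t ht => ?_
    rw [Set.uIcc_of_le zero_le_one] at ht
    simp only [hdw t ht]

/-- Reparametrizing by a monotone smooth step keeps the length and makes the velocity vanish at both
ends, so that such curves can be concatenated without losing `C¹`. The triangle inequality for
`geoDist` rests on this. -/
theorem hasStationaryCurve_of_mem_lengthSet {x y : M} {l : ℝ} (h : l ∈ lengthSet ι x y) :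
    HasStationaryCurve ι x y l := by
  obtain ⟨γ, hγ, h0, h1, rfl⟩ := h
  obtain ⟨hdiff, hcont⟩ := (contDiffOn_one_iff_derivWithin (uniqueDiffOn_Icc one_pos)).1 hγ
  set w := derivWithin (ι ∘ γ) (Set.Icc 0 1) with hw
  set W : ℝ → EuclideanSpace ℝ (Fin d) := Set.IccExtend zero_le_one ((Set.Icc (0 : ℝ) 1).domRestrict w)
    with hW
  have hWc : Continuous W := (continuousOn_iff_continuous_domRestrict.1 hcont).Icc_extend'
  have hWw : ∀ t ∈ Set.Icc (0 : ℝ) 1, W t = w t := fun t ht => by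
    rw [hW, Set.IccExtend_of_mem _ _ ht]; rfl
  have hder : ∀ t ∈ Set.Ioo (0 : ℝ) 1, HasDerivAt (ι ∘ γ) (W t) t := fun t ht => by
    rw [hWw t (Set.Ioo_subset_Icc_self ht), hw]
    have := (hdiff t (Set.Ioo_subset_Icc_self ht)).hasDerivWithinAt
    exact this.hasDerivAt (Icc_mem_nhds ht.1 ht.2)
  -- An extension of `ι ∘ γ` to the whole line, so that the chain rule also applies where the smooth
  -- step takes the values `0` and `1`.
  set e : ℝ → EuclideanSpace ℝ (Fin d) := fun t => ι x + ∫ s in (0 : ℝ)..t, W s with he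
  have hed : ∀ t, HasDerivAt e (W t) t := fun t =>
    (hWc.integral_hasStrictDerivAt 0 t).hasDerivAt.const_add _
  have hec : ∀ t ∈ Set.Icc (0 : ℝ) 1, e t = ι (γ t) := by
    intro t ht
    have := intervalIntegral.integral_eq_sub_of_hasDerivAt_of_le ht.1
      (hγ.continuousOn.mono (Set.Icc_subset_Icc_right ht.2))
      (fun s hs => hder s ⟨hs.1, hs.2.trans_le ht.2⟩) (hWc.intervalIntegrable 0 t)
    simp [he, this, h0]
  set σ := Real.smoothTransition with hσ
  have hσI : ∀ t, σ t ∈ Set.Icc (0 : ℝ) 1 := fun t =>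
    ⟨Real.smoothTransition.nonneg t, Real.smoothTransition.le_one t⟩
  have hσd : ∀ t, HasDerivAt σ (deriv σ t) t := fun t =>
    (Real.smoothTransition.contDiff (n := 1)).differentiable (by simp) t |>.hasDerivAt
  have hσc : Continuous (deriv σ) :=
    (Real.smoothTransition.contDiff (n := 1)).continuous_deriv le_rfl
  have hσ0 : ∀ t ≤ 0, deriv σ t = 0 := fun t ht => by
    refine IsLocalMin.deriv_eq_zero (Eventually.of_forall fun s => ?_)
    rw [hσ, Real.smoothTransition.zero_of_nonpos ht]
    exact Real.smoothTransition.nonneg s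
  have hσ1 : ∀ t, 1 ≤ t → deriv σ t = 0 := fun t ht => by
    refine IsLocalMax.deriv_eq_zero (Eventually.of_forall fun s => ?_)
    rw [hσ, Real.smoothTransition.one_of_one_le ht]
    exact Real.smoothTransition.le_one s
  have hσnn : ∀ t, 0 ≤ deriv σ t := fun t => Real.smoothTransition.monotone.deriv_nonneg
  refine ⟨fun t => γ (σ t), fun t => deriv σ t • W (σ t), fun t => ?_,
    hσc.smul (hWc.comp Real.smoothTransition.continuous), fun t ht => ?_, fun t ht => ?_,
    fun t ht => by simp [hσ0 t ht], fun t ht => by simp [hσ1 t ht], ?_⟩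
  · have : (ι ∘ fun t => γ (σ t)) = e ∘ σ := funext fun t => (hec _ (hσI t)).symm
    rw [this]
    exact (hed (σ t)).scomp t (hσd t)
  · simp [hσ, Real.smoothTransition.zero_of_nonpos ht, h0]
  · simp [hσ, Real.smoothTransition.one_of_one_le ht, h1]
  · have h2 := intervalIntegral.integral_comp_mul_deriv_of_deriv_nonneg (a := 0) (b := 1)
      (f := σ) (f' := deriv σ) (g := fun t => ‖W t‖)
      Real.smoothTransition.continuous.continuousOn (fun t _ => hσd t) (fun t _ => hσnn t)
    rw [hσ, Real.smoothTransition.zero, Real.smoothTransition.one] at h2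
    calc ∫ t in (0 : ℝ)..1, ‖w t‖ = ∫ t in (0 : ℝ)..1, ‖W t‖ := by
          refine intervalIntegral.integral_congr fun t ht => ?_
          rw [Set.uIcc_of_le zero_le_one] at ht
          simp only [hWw t ht]
      _ = _ := by
          rw [← h2]
          refine intervalIntegral.integral_congr fun t _ => ?_
          simp only [Function.comp_apply, norm_smul, Real.norm_of_nonneg (hσnn t)]
          exact mul_comm _ _

theorem HasStationaryCurve.trans {x y z : M} {l l' : ℝ} (h : HasStationaryCurve ι x y l)
    (h' : HasStationaryCurve ι y z l') : HasStationaryCurve ι x z (l + l') := by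
  obtain ⟨γ₁, v₁, hd₁, hc₁, h0₁, h1₁, hv0₁, hv1₁, rfl⟩ := h
  obtain ⟨γ₂, v₂, hd₂, hc₂, h0₂, h1₂, hv0₂, hv1₂, rfl⟩ := h'
  have hcase : ∀ t : ℝ, t ≤ 1 / 2 ∨ 1 / 2 ≤ t := fun t => le_total _ _
  refine ⟨fun t => if t ≤ 1 / 2 then γ₁ (2 * t) else γ₂ (2 * t - 1),
    fun t => (2 : ℝ) • v₁ (2 * t) + (2 : ℝ) • v₂ (2 * t - 1), fun t => ?_, by fun_prop,
    fun t ht => ?_, fun t ht => ?_, fun t ht => ?_, fun t ht => ?_, ?_⟩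
  -- At each time one of the two curves rests at `y`, so the concatenation is a sum and no
  -- differentiation of a case split is needed.
  · have hfun : (ι ∘ fun t : ℝ => if t ≤ 1 / 2 then γ₁ (2 * t) else γ₂ (2 * t - 1)) =
        fun t => (ι ∘ γ₁) (2 * t) + (ι ∘ γ₂) (2 * t - 1) - ι y := by
      funext s
      by_cases hs : s ≤ 1 / 2
      · simp only [Function.comp_apply, if_pos hs, h0₂ (2 * s - 1) (by linarith), add_sub_cancel_right]
      · simp only [Function.comp_apply, if_neg hs, h1₁ (2 * s) (by linarith), add_sub_cancel_left]
    rw [hfun]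
    have e1 : HasDerivAt (fun t : ℝ => 2 * t) 2 t := by simpa using (hasDerivAt_id t).const_mul 2
    have e2 : HasDerivAt (fun t : ℝ => 2 * t - 1) 2 t := e1.sub_const 1
    exact (((hd₁ _).scomp t e1).add ((hd₂ _).scomp t e2)).sub_const _
  · have : t ≤ 1 / 2 := by linarith
    simp only [if_pos this]
    exact h0₁ _ (by linarith)
  · have : ¬ t ≤ 1 / 2 := by linarith
    simp only [if_neg this]
    exact h1₂ _ (by linarith)
  · simp [hv0₁ (2 * t) (by linarith), hv0₂ (2 * t - 1) (by linarith)]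
  · simp [hv1₁ (2 * t) (by linarith), hv1₂ (2 * t - 1) (by linarith)]
  · have hn : ∀ t : ℝ, ‖(2 : ℝ) • v₁ (2 * t) + (2 : ℝ) • v₂ (2 * t - 1)‖ =
        2 * ‖v₁ (2 * t)‖ + 2 * ‖v₂ (2 * t - 1)‖ := fun t => by
      rcases hcase t with ht | ht
      · simp [hv0₂ (2 * t - 1) (by linarith), norm_smul]
      · simp [hv1₁ (2 * t) (by linarith), norm_smul]
    simp only [hn]
    rw [intervalIntegral.integral_add (Continuous.intervalIntegrable (by fun_prop) _ _)
      (Continuous.intervalIntegrable (by fun_prop) _ _), intervalIntegral.integral_const_mul,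
      intervalIntegral.integral_const_mul,
      intervalIntegral.mul_integral_comp_mul_left (f := fun t => ‖v₁ t‖),
      intervalIntegral.mul_integral_comp_mul_sub (f := fun t => ‖v₂ t‖)]
    norm_num
    rw [← intervalIntegral.integral_add_adjacent_intervals (a := 0) (b := 1) (c := 2)
      (hc₁.norm.intervalIntegrable _ _) (hc₁.norm.intervalIntegrable _ _),
      ← intervalIntegral.integral_add_adjacent_intervals (a := -1) (b := 0) (c := 1)
      (hc₂.norm.intervalIntegrable _ _) (hc₂.norm.intervalIntegrable _ _)]
    have z1 : ∫ t in (1 : ℝ)..2, ‖v₁ t‖ = 0 := by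
      rw [intervalIntegral.integral_congr (g := fun _ => (0 : ℝ)) fun t ht => by
        rw [Set.uIcc_of_le (by norm_num)] at ht
        simp [hv1₁ t ht.1]]
      simp
    have z2 : ∫ t in (-1 : ℝ)..0, ‖v₂ t‖ = 0 := by
      rw [intervalIntegral.integral_congr (g := fun _ => (0 : ℝ)) fun t ht => by
        rw [Set.uIcc_of_le (by norm_num)] at ht
        simp [hv0₂ t ht.2]]
      simp
    rw [z1, z2]; ring

theorem HasStationaryCurve.symm {x y : M} {l : ℝ} (h : HasStationaryCurve ι x y l) :
    HasStationaryCurve ι y x l := by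
  obtain ⟨γ, v, hd, hc, h0, h1, hv0, hv1, rfl⟩ := h
  refine ⟨fun t => γ (1 - t), fun t => -v (1 - t), fun t => ?_, by fun_prop,
    fun t ht => h1 _ (by linarith), fun t ht => h0 _ (by linarith),
    fun t ht => by simp [hv1 (1 - t) (by linarith)],
    fun t ht => by simp [hv0 (1 - t) (by linarith)], ?_⟩
  · have e : HasDerivAt (fun t : ℝ => 1 - t) (-1) t := by
      simpa using (hasDerivAt_id t).const_sub 1
    have := (hd _).scomp t e
    rw [neg_one_smul] at this
    exact this
  · simp only [norm_neg]
    rw [intervalIntegral.integral_comp_sub_left (fun t => ‖v t‖)]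
    simp

theorem HasStationaryCurve.norm_sub_le {x y : M} {l : ℝ} (h : HasStationaryCurve ι x y l) :
    ‖ι y - ι x‖ ≤ l := by
  obtain ⟨γ, v, hd, hc, h0, h1, -, -, rfl⟩ := h
  have := intervalIntegral.integral_eq_sub_of_hasDerivAt (fun t _ => hd t)
    (hc.intervalIntegrable 0 1)
  simp only [Function.comp_apply, h0 0 le_rfl, h1 1 le_rfl] at this
  rw [← this]
  exact intervalIntegral.norm_integral_le_integral_norm zero_le_one

theorem lengthSet_add {x y z : M} {l l' : ℝ} (h : l ∈ lengthSet ι x y)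
    (h' : l' ∈ lengthSet ι y z) : l + l' ∈ lengthSet ι x z :=
  ((hasStationaryCurve_of_mem_lengthSet h).trans
    (hasStationaryCurve_of_mem_lengthSet h')).mem_lengthSet

theorem lengthSet_comm (x y : M) : lengthSet ι x y = lengthSet ι y x :=
  Set.Subset.antisymm (fun _ h => (hasStationaryCurve_of_mem_lengthSet h).symm.mem_lengthSet)
    (fun _ h => (hasStationaryCurve_of_mem_lengthSet h).symm.mem_lengthSet)

theorem norm_sub_le_of_mem_lengthSet {x y : M} {l : ℝ} (h : l ∈ lengthSet ι x y) :
    ‖ι y - ι x‖ ≤ l :=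
  (hasStationaryCurve_of_mem_lengthSet h).norm_sub_le

theorem geoDist_eq (x y : M) : geoDist ι x y = sInf (lengthSet ι x y) := rfl

theorem bddBelow_lengthSet (x y : M) : BddBelow (lengthSet ι x y) :=
  ⟨‖ι y - ι x‖, fun _ h => norm_sub_le_of_mem_lengthSet h⟩

theorem geoDist_comm (x y : M) : geoDist ι x y = geoDist ι y x := by
  rw [geoDist_eq, lengthSet_comm, geoDist_eq]

theorem geoDist_self (x : M) : geoDist ι x x = 0 := by
  have h : (0 : ℝ) ∈ lengthSet ι x x :=
    ⟨fun _ => x, contDiffOn_const, rfl, rfl, by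
      have : (ι ∘ fun _ : ℝ => x) = fun _ => ι x := rfl
      simp [this]⟩
  refine le_antisymm (csInf_le (bddBelow_lengthSet x x) h) (le_csInf ⟨0, h⟩ fun l hl => ?_)
  exact (norm_nonneg _).trans (norm_sub_le_of_mem_lengthSet hl)

theorem geoDist_nonneg (x y : M) : 0 ≤ geoDist ι x y :=
  Real.sInf_nonneg fun _ hl => (norm_nonneg _).trans (norm_sub_le_of_mem_lengthSet hl)

/-- Nonemptiness matters: without a connecting curve the infimum would be the default value `0`. -/
theorem norm_sub_le_geoDist_of_nonempty {x y : M} (h : (lengthSet ι x y).Nonempty) :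
    ‖ι y - ι x‖ ≤ geoDist ι x y :=
  le_csInf h fun _ hl => norm_sub_le_of_mem_lengthSet hl

theorem geoDist_triangle_of_nonempty {x y z : M} (h : (lengthSet ι x y).Nonempty)
    (h' : (lengthSet ι y z).Nonempty) : geoDist ι x z ≤ geoDist ι x y + geoDist ι y z := by
  refine le_of_forall_pos_le_add fun ε hε => ?_
  obtain ⟨l, hl, hlε⟩ := Real.lt_sInf_add_pos h (half_pos hε)
  obtain ⟨l', hl', hlε'⟩ := Real.lt_sInf_add_pos h' (half_pos hε)
  have := csInf_le (bddBelow_lengthSet x z) (lengthSet_add hl hl')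
  rw [geoDist_eq, geoDist_eq, geoDist_eq]
  linarith

end Curves

namespace TangentData

variable {m d : ℕ} {M : Type*} {ι : M → EuclideanSpace ℝ (Fin d)} {p : M → ℝ}

theorem geoDist_le (G : TangentData m ι p) {x y : M} (h : ‖ι y - ι x‖ < G.r) :
    geoDist ι x y ≤ ‖ι y - ι x‖ + G.K * ‖ι y - ι x‖ ^ 3 := by
  obtain ⟨γ, h1, h2, h3, h4⟩ := G.path x y h
  exact (csInf_le (bddBelow_lengthSet x y) ⟨γ, h1, h2, h3, rfl⟩).trans h4

variable [TopologicalSpace M] [ConnectedSpace M]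

/-- Short curves exist locally, so the set of points reachable from `x` is clopen, and `M` is
connected. -/
theorem nonempty_lengthSet (G : TangentData m ι p) (hι : Continuous ι) (x y : M) :
    (lengthSet ι x y).Nonempty := by
  have hloc : ∀ a b, ‖ι b - ι a‖ < G.r → (lengthSet ι a b).Nonempty := fun a b h => by
    obtain ⟨γ, h1, h2, h3, -⟩ := G.path a b h
    exact ⟨_, γ, h1, h2, h3, rfl⟩
  have hnear : ∀ a : M, ∀ᶠ b in 𝓝 a, ‖ι b - ι a‖ < G.r := fun a => by
    have := (hι.continuousAt (x := a)).eventually (ball_mem_nhds _ G.r_pos)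
    simpa [dist_eq_norm] using this
  have hclopen : IsClopen {b | (lengthSet ι x b).Nonempty} := by
    constructor
    · rw [← isOpen_compl_iff, isOpen_iff_mem_nhds]
      intro a ha
      filter_upwards [hnear a] with b hb hxb
      obtain ⟨l, hl⟩ := hxb
      obtain ⟨l', hl'⟩ := hloc b a (by rwa [norm_sub_rev])
      exact ha ⟨_, lengthSet_add hl hl'⟩
    · rw [isOpen_iff_mem_nhds]
      rintro a ⟨l, hl⟩
      filter_upwards [hnear a] with b hb
      obtain ⟨l', hl'⟩ := hloc a b hb
      exact ⟨_, lengthSet_add hl hl'⟩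
  have := hclopen.eq_univ ⟨x, hloc x x (by simpa using G.r_pos)⟩
  exact this.symm.subset (Set.mem_univ y)

theorem norm_sub_le_geoDist (G : TangentData m ι p) (hι : Continuous ι) (x y : M) :
    ‖ι y - ι x‖ ≤ geoDist ι x y :=
  norm_sub_le_geoDist_of_nonempty (G.nonempty_lengthSet hι x y)

theorem geoDist_triangle (G : TangentData m ι p) (hι : Continuous ι) (x y z : M) :
    geoDist ι x z ≤ geoDist ι x y + geoDist ι y z :=
  geoDist_triangle_of_nonempty (G.nonempty_lengthSet hι x y) (G.nonempty_lengthSet hι y z)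

theorem continuous_geoDist (G : TangentData m ι p) (hι : Continuous ι) :
    Continuous fun z : M × M => geoDist ι z.1 z.2 := by
  have hsmall : ∀ a : M, Tendsto (fun b => geoDist ι a b) (𝓝 a) (𝓝 0) := fun a => by
    have h1 : Tendsto (fun b => ‖ι b - ι a‖) (𝓝 a) (𝓝 0) := by
      have : Continuous fun b => ‖ι b - ι a‖ := by fun_prop
      simpa using this.tendsto a
    have h2 : Tendsto (fun b => ‖ι b - ι a‖ + G.K * ‖ι b - ι a‖ ^ 3) (𝓝 a) (𝓝 0) := by
      simpa using h1.add ((h1.pow 3).const_mul G.K)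
    refine tendsto_of_tendsto_of_tendsto_of_le_of_le' tendsto_const_nhds h2
      (Eventually.of_forall fun b => geoDist_nonneg a b) ?_
    filter_upwards [h1.eventually (gt_mem_nhds G.r_pos)] with b hb using G.geoDist_le hb
  rw [continuous_iff_continuousAt]
  rintro ⟨a, b⟩
  have hlim : Tendsto (fun z : M × M => geoDist ι a z.1 + geoDist ι b z.2) (𝓝 (a, b)) (𝓝 0) := by
    simpa using ((hsmall a).comp (continuous_fst.tendsto (a, b))).add
      ((hsmall b).comp (continuous_snd.tendsto (a, b)))
  rw [ContinuousAt, tendsto_iff_dist_tendsto_zero]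
  refine squeeze_zero (fun _ => dist_nonneg) (fun z => ?_) hlim
  rw [Real.dist_eq, abs_le]
  have t1 := G.geoDist_triangle hι z.1 a z.2
  have t2 := G.geoDist_triangle hι a b z.2
  have t3 := G.geoDist_triangle hι a z.1 b
  have t4 := G.geoDist_triangle hι z.1 z.2 b
  rw [geoDist_comm z.1 a] at t1
  rw [geoDist_comm z.2 b] at t4
  constructor <;> linarith

end TangentData

end SNN

/-! ### Consequences of positive reach -/

namespace SNN

open Filter Topology Metric

section UniqueNearest

variable {F : Type*} [NormedAddCommGroup F] [InnerProductSpace ℝ F] [FiniteDimensional ℝ F]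
  {S : Set F}

/-- Where the nearest point of `S` is unique, the distance to `S` grows at unit rate in the
direction pointing away from the nearest point. -/
theorem exists_infDist_lt_of_unique (hS : IsCompact S) {z y : F} (hy : y ∈ S)
    (hyz : dist z y = infDist z S)
    (huniq : ∀ y', y' ∈ S → dist z y' = infDist z S → y' = y) (hz : 0 < infDist z S)
    {η τ₀ : ℝ} (hη : 0 < η) (hτ₀ : 0 < τ₀) :
    ∃ τ, 0 < τ ∧ τ < τ₀ ∧
      infDist z S + (1 - η) * τ < infDist (z + τ • ((infDist z S)⁻¹ • (z - y))) S := by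
  have := FiniteDimensional.proper_real F
  set δ := infDist z S with hδ
  set u : F := δ⁻¹ • (z - y) with hu
  have hnu : ‖u‖ = 1 := by
    rw [hu, norm_smul, ← dist_eq_norm, hyz, norm_inv, Real.norm_of_nonneg hz.le,
      inv_mul_cancel₀ hz.ne']
  -- If the growth fails along a sequence of steps tending to zero, the nearest points of the moved
  -- points subconverge to a nearest point of `z`, which is `y` by uniqueness. Expanding squares
  -- then gives `⟨u, z - y⟩ ≤ δ (1 - η)`, whereas this inner product equals `δ`.
  by_contra! hcon
  set τ : ℕ → ℝ := fun n => τ₀ / (n + 2) with hτ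
  have hτpos : ∀ n, 0 < τ n := fun n => by positivity
  have hτlt : ∀ n, τ n < τ₀ := fun n => by
    rw [hτ]; simp only
    rw [div_lt_iff₀ (by positivity)]
    nlinarith [(Nat.cast_nonneg n : (0 : ℝ) ≤ n)]
  have hτ0 : Tendsto τ atTop (𝓝 0) := by
    refine tendsto_const_nhds.div_atTop ?_
    exact tendsto_atTop_add_const_right _ _ tendsto_natCast_atTop_atTop
  choose b hbS hb using fun n => hS.exists_infDist_eq_dist ⟨y, hy⟩ (z + τ n • u)
  obtain ⟨b', hb'S, φ, hφ, hbφ⟩ := hS.tendsto_subseq hbS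
  have hτφ : Tendsto (τ ∘ φ) atTop (𝓝 0) := hτ0.comp hφ.tendsto_atTop
  have hkey : ∀ n, 2 * inner ℝ u (z - b n) + τ n ≤ 2 * δ * (1 - η) + (1 - η) ^ 2 * τ n := by
    intro n
    have h1 := hcon (τ n) (hτpos n) (hτlt n)
    rw [hb n, dist_eq_norm] at h1
    have h2 : δ ≤ ‖z - b n‖ := by rw [← dist_eq_norm]; exact infDist_le_dist_of_mem (hbS n)
    have h3 := norm_add_sq_real (z - b n) (τ n • u)
    rw [real_inner_smul_right, norm_smul, hnu, Real.norm_of_nonneg (hτpos n).le,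
      real_inner_comm] at h3
    rw [show z + τ n • u - b n = z - b n + τ n • u by abel] at h1
    have h4 : ‖z - b n + τ n • u‖ ^ 2 ≤ (δ + (1 - η) * τ n) ^ 2 := by gcongr
    have h5 : δ ^ 2 ≤ ‖z - b n‖ ^ 2 := by gcongr
    have h6 : τ n * (2 * inner ℝ u (z - b n) + τ n) ≤
        τ n * (2 * δ * (1 - η) + (1 - η) ^ 2 * τ n) := by nlinarith
    exact le_of_mul_le_mul_left h6 (hτpos n)
  have hb'z : dist z b' = δ := by
    have e1 : Tendsto (fun n => dist (z + (τ ∘ φ) n • u) ((b ∘ φ) n)) atTop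
        (𝓝 (dist (z + (0 : ℝ) • u) b')) :=
      (tendsto_const_nhds.add (hτφ.smul_const u)).dist hbφ
    have e2 : Tendsto (fun n => infDist (z + (τ ∘ φ) n • u) S) atTop
        (𝓝 (infDist (z + (0 : ℝ) • u) S)) :=
      (continuous_infDist_pt S).continuousAt.tendsto.comp
        (tendsto_const_nhds.add (hτφ.smul_const u))
    have e3 : (fun n => infDist (z + (τ ∘ φ) n • u) S) =
        fun n => dist (z + (τ ∘ φ) n • u) ((b ∘ φ) n) := funext fun n => hb (φ n)
    rw [e3] at e2
    simpa using tendsto_nhds_unique e1 e2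
  rw [huniq b' hb'S hb'z] at hbφ
  have l1 : Tendsto (fun n => 2 * inner ℝ u (z - (b ∘ φ) n) + (τ ∘ φ) n) atTop
      (𝓝 (2 * inner ℝ u (z - y) + 0)) :=
    ((tendsto_const_nhds.inner (tendsto_const_nhds.sub hbφ)).const_mul 2).add hτφ
  have l2 : Tendsto (fun n => 2 * δ * (1 - η) + (1 - η) ^ 2 * (τ ∘ φ) n) atTop
      (𝓝 (2 * δ * (1 - η) + (1 - η) ^ 2 * 0)) :=
    tendsto_const_nhds.add (hτφ.const_mul _)
  have h := le_of_tendsto_of_tendsto' l1 l2 fun n => hkey (φ n)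
  have hin : inner ℝ u (z - y) = δ := by
    rw [hu, real_inner_smul_left, real_inner_self_eq_norm_sq, ← dist_eq_norm, hyz]
    field_simp
  rw [hin] at h
  nlinarith

/-- If all points within distance `R` of `S` have a unique nearest point, then a normal segment
along which the distance to `S` is the length can be prolonged up to length `R`. -/
theorem infDist_add_smul_eq (hS : IsCompact S) {R : ℝ}
    (huniq : ∀ z, infDist z S < R → ∃! y, y ∈ S ∧ dist z y = infDist z S)
    {x ν : F} (hx : x ∈ S) (hν : ‖ν‖ = 1) {s s' : ℝ} (hs : 0 < s) (hss' : s ≤ s') (hs' : s' < R)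
    (h : infDist (x + s • ν) S = s) : infDist (x + s' • ν) S = s' := by
  have := FiniteDimensional.proper_real F
  set a := x + s • ν with ha
  set L := s' - s with hL
  have hL0 : 0 ≤ L := by linarith
  have hne : S.Nonempty := ⟨x, hx⟩
  have hcont := continuous_infDist_pt S
  have hlip : ∀ z, infDist z S ≤ s + ‖z - a‖ := fun z => by
    have := infDist_le_infDist_add_dist (s := S) (x := z) (y := a)
    rw [h, dist_eq_norm] at this; exact this
  obtain ⟨z, hzB, hzmax⟩ := (isCompact_closedBall a L).exists_isMaxOn
    ⟨a, mem_closedBall_self hL0⟩ hcont.continuousOn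
  have hzn : ‖z - a‖ ≤ L := by rwa [mem_closedBall, dist_eq_norm] at hzB
  have hzδ : s + L ≤ infDist z S := by
    refine le_of_forall_pos_le_add fun ε hε => ?_
    obtain ⟨η, hη0, hη1, hηε⟩ : ∃ η : ℝ, 0 < η ∧ η < 1 ∧ η * L ≤ ε := by
      refine ⟨min (1 / 2) (ε / (L + 1)), by positivity, ?_, ?_⟩
      · exact (min_le_left _ _).trans_lt (by norm_num)
      · calc _ ≤ ε / (L + 1) * L := by gcongr; exact min_le_right _ _
          _ ≤ ε := by
            rw [div_mul_eq_mul_div, div_le_iff₀ (by positivity)]; nlinarith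
    -- A maximizer of the penalized distance cannot be interior, since the distance to `S` can grow
    -- there at a rate above `1 - η`. On the boundary sphere its value gives a distance of at least
    -- `s + (1 - η) L`.
    obtain ⟨c, hcB, hcmax⟩ := (isCompact_closedBall a L).exists_isMaxOn
      ⟨a, mem_closedBall_self hL0⟩ (f := fun z => infDist z S - (1 - η) * ‖z - a‖) (by fun_prop)
    have hcn : ‖c - a‖ ≤ L := by rwa [mem_closedBall, dist_eq_norm] at hcB
    have hca : s ≤ infDist c S - (1 - η) * ‖c - a‖ := by
      have := hcmax (mem_closedBall_self hL0)
      simpa [h] using this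
    have hcpos : 0 < infDist c S := by nlinarith [norm_nonneg (c - a)]
    have hcL : ‖c - a‖ = L := by
      by_contra hne'
      have hlt : ‖c - a‖ < L := lt_of_le_of_ne hcn hne'
      obtain ⟨y, ⟨hyS, hyc⟩, hyu⟩ := huniq c ((hlip c).trans_lt (by linarith))
      obtain ⟨τ, hτ0, hτ1, hτ⟩ := exists_infDist_lt_of_unique hS hyS hyc
        (fun y' h1 h2 => hyu y' ⟨h1, h2⟩) hcpos hη0 (sub_pos.2 hlt)
      set u : F := (infDist c S)⁻¹ • (c - y) with hu
      have hnu : ‖u‖ = 1 := by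
        rw [hu, norm_smul, ← dist_eq_norm, hyc, norm_inv, Real.norm_of_nonneg hcpos.le,
          inv_mul_cancel₀ hcpos.ne']
      have hnn : ‖c + τ • u - a‖ ≤ ‖c - a‖ + τ := by
        calc ‖c + τ • u - a‖ = ‖(c - a) + τ • u‖ := by congr 1; abel
          _ ≤ ‖c - a‖ + ‖τ • u‖ := norm_add_le _ _
          _ = _ := by rw [norm_smul, hnu, Real.norm_of_nonneg hτ0.le, mul_one]
      have hmem : c + τ • u ∈ closedBall a L := by
        rw [mem_closedBall, dist_eq_norm]; linarith
      have hle := hcmax hmem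
      simp only [Set.mem_ofPred_eq] at hle
      nlinarith
    have := hzmax hcB
    simp only [Set.mem_ofPred_eq] at this
    nlinarith
  -- Equality in the triangle inequality for `x`, `a`, `z`; it forces `z` onto the ray from `x` in
  -- the direction `ν`.
  have hzx : s + L ≤ ‖s • ν + (z - a)‖ := by
    refine hzδ.trans ((infDist_le_dist_of_mem hx).trans_eq ?_)
    rw [dist_eq_norm, ha]; congr 1; abel
  have h1 := norm_add_sq_real (s • ν) (z - a)
  rw [norm_smul, hν, Real.norm_of_nonneg hs.le, real_inner_smul_left] at h1
  have h2 : (s + L) ^ 2 ≤ ‖s • ν + (z - a)‖ ^ 2 := by gcongr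
  have h3 : ‖z - a‖ ^ 2 ≤ L ^ 2 := by gcongr
  have h4 : L ≤ inner ℝ ν (z - a) := by
    have : s * L ≤ s * inner ℝ ν (z - a) := by nlinarith
    exact le_of_mul_le_mul_left this hs
  have h5 : ‖(z - a) - L • ν‖ ^ 2 ≤ 0 := by
    rw [norm_sub_sq_real, real_inner_smul_right, norm_smul, hν, Real.norm_of_nonneg hL0,
      real_inner_comm]
    nlinarith
  have h6 : z = x + s' • ν := by
    have : (z - a) - L • ν = 0 := by
      rw [← norm_eq_zero]
      exact pow_eq_zero_iff (two_ne_zero) |>.1 (le_antisymm h5 (sq_nonneg _))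
    rw [sub_sub, sub_eq_zero] at this
    rw [this, ha, hL, sub_smul]; abel
  rw [← h6]
  refine le_antisymm ?_ (by linarith)
  have := hlip z
  linarith

end UniqueNearest

theorem existsUnique_of_infDist_lt_reach {d : ℕ} {S : Set (EuclideanSpace ℝ (Fin d))}
    (z : EuclideanSpace ℝ (Fin d)) (hz : infDist z S < reach S) :
    ∃! y, y ∈ S ∧ dist z y = infDist z S := by
  have hne : {r : ℝ | 0 ≤ r ∧ ∀ z, infDist z S < r →
      ∃! y, y ∈ S ∧ dist z y = infDist z S}.Nonempty := by
    by_contra! hcon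
    rw [reach, hcon, Real.sSup_empty] at hz
    exact absurd infDist_nonneg (not_le.2 hz)
  obtain ⟨r, hr, hzr⟩ := exists_lt_of_lt_csSup hne hz
  exact hr.2 z hzr

namespace TangentData

variable {m d : ℕ} {M : Type*} {ι : M → EuclideanSpace ℝ (Fin d)} {p : M → ℝ}

theorem norm_orthogonal_le (G : TangentData m ι p) {x y : M} (h : ‖ι y - ι x‖ < G.r) :
    ‖(G.T x)ᗮ.starProjection (ι y - ι x)‖ ≤ G.K * ‖ι y - ι x‖ ^ 2 := by
  have := G.flat x y x _ h le_rfl (by simp)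
  linarith [this, sq (‖ι y - ι x‖)]

/-- The initial piece of the normal segment to be prolonged. Nearby points of `M` leave the tangent
space only quadratically, so for `2 K s ≤ 1` they stay outside the ball of radius `s` tangent at
`x`; distant points are excluded by the triangle inequality. -/
theorem exists_infDist_normal (G : TangentData m ι p) (x : M) {ν : EuclideanSpace ℝ (Fin d)}
    (hν : ‖ν‖ = 1) (hνT : ν ∈ (G.T x)ᗮ) :
    ∃ s₀ > 0, ∀ s, 0 < s → s ≤ s₀ → infDist (ι x + s • ν) (Set.range ι) = s := by
  have hK : 0 < G.K := by linarith [G.one_le]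
  have hr := G.r_pos
  refine ⟨min (G.r / 2) (1 / (2 * G.K)), by positivity, fun s hs hs₀ => ?_⟩
  have hs1 : 2 * s ≤ G.r := by linarith [hs₀.trans (min_le_left _ _)]
  have hs2 : 2 * G.K * s ≤ 1 := by
    have := hs₀.trans (min_le_right _ _)
    rwa [le_div_iff₀ (by positivity), mul_comm] at this
  have hsν : ‖s • ν‖ = s := by rw [norm_smul, hν, Real.norm_of_nonneg hs.le, mul_one]
  refine le_antisymm ?_ ?_
  · refine (infDist_le_dist_of_mem (Set.mem_range_self x)).trans_eq ?_
    rw [dist_eq_norm, add_sub_cancel_left, hsν]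
  · rw [le_infDist (Set.range_nonempty_iff_nonempty.2 ⟨x⟩)]
    rintro _ ⟨y, rfl⟩
    rw [dist_eq_norm, show ι x + s • ν - ι y = s • ν - (ι y - ι x) by abel]
    rcases lt_or_ge ‖ι y - ι x‖ G.r with h | h
    · have h1 : inner ℝ ν (ι y - ι x) ≤ G.K * ‖ι y - ι x‖ ^ 2 := by
        have e : inner ℝ ν (ι y - ι x) = inner ℝ ν ((G.T x)ᗮ.starProjection (ι y - ι x)) := by
          conv_lhs => rw [← Submodule.starProjection_eq_self_iff.2 hνT]
          rw [Submodule.inner_starProjection_left_eq_right]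
        rw [e]
        refine (real_inner_le_norm _ _).trans ?_
        rw [hν, one_mul]
        exact G.norm_orthogonal_le h
      refine le_of_sq_le_sq ?_ (norm_nonneg _)
      rw [norm_sub_sq_real, hsν, real_inner_smul_left]
      nlinarith [sq_nonneg ‖ι y - ι x‖, mul_le_mul_of_nonneg_left h1 hs.le]
    · have := norm_sub_norm_le (ι y - ι x) (s • ν)
      rw [norm_sub_rev (ι y - ι x) (s • ν), hsν] at this
      linarith

/-- Federer's characterization of the reach: `M` stays close to its tangent spaces. -/
theorem two_mul_norm_orthogonal_le (G : TangentData m ι p) (hS : IsCompact (Set.range ι)) {R : ℝ}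
    (hR0 : 0 < R) (huniq : ∀ z, infDist z (Set.range ι) < R →
      ∃! y, y ∈ Set.range ι ∧ dist z y = infDist z (Set.range ι)) (x y : M) :
    2 * R * ‖(G.T x)ᗮ.starProjection (ι y - ι x)‖ ≤ ‖ι y - ι x‖ ^ 2 := by
  set n := (G.T x)ᗮ.starProjection (ι y - ι x) with hn
  rcases eq_or_ne n 0 with h0 | h0
  · rw [h0]; simp
  have hn0 : 0 < ‖n‖ := norm_pos_iff.2 h0
  set ν := ‖n‖⁻¹ • n with hν
  have hν1 : ‖ν‖ = 1 := by rw [hν, norm_smul, norm_inv, norm_norm, inv_mul_cancel₀ hn0.ne']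
  have hνT : ν ∈ (G.T x)ᗮ := Submodule.smul_mem _ _ (Submodule.starProjection_apply_mem _ _)
  have hin : inner ℝ ν (ι y - ι x) = ‖n‖ := by
    rw [← Submodule.starProjection_eq_self_iff.2 hνT,
      Submodule.inner_starProjection_left_eq_right, ← hn, hν, real_inner_smul_left,
      real_inner_self_eq_norm_sq]
    field_simp
  obtain ⟨s₀, hs₀, hs⟩ := G.exists_infDist_normal x hν1 hνT
  -- The open ball of radius `s` tangent to `M` at `x` on the side of `n` contains no point of `M`.
  -- Written for `ι y`, this is the inequality, and `s` tends to `R` afterwards.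
  have hlt : ∀ s, 0 < s → s < R → 2 * s * ‖n‖ ≤ ‖ι y - ι x‖ ^ 2 := by
    intro s hs0 hsR
    have h1 : infDist (ι x + s • ν) (Set.range ι) = s := by
      rcases le_total s s₀ with h | h
      · exact hs s hs0 h
      · exact infDist_add_smul_eq hS huniq ⟨x, rfl⟩ hν1 hs₀ h hsR (hs s₀ hs₀ le_rfl)
    have h2 : s ≤ ‖s • ν - (ι y - ι x)‖ := by
      have h3 := infDist_le_dist_of_mem (x := ι x + s • ν) (Set.mem_range_self (f := ι) y)
      rw [h1, dist_eq_norm] at h3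
      rwa [show s • ν - (ι y - ι x) = ι x + s • ν - ι y by abel]
    have h3 : s ^ 2 ≤ ‖s • ν - (ι y - ι x)‖ ^ 2 := by gcongr
    rw [norm_sub_sq_real, real_inner_smul_left, hin, norm_smul, hν1,
      Real.norm_of_nonneg hs0.le] at h3
    linarith
  have hlim : Tendsto (fun s : ℝ => 2 * s * ‖n‖) (𝓝[<] R) (𝓝 (2 * R * ‖n‖)) :=
    ((continuous_const.mul continuous_id).mul continuous_const).continuousWithinAt.tendsto
  refine le_of_tendsto hlim ?_
  filter_upwards [Ioo_mem_nhdsLT hR0] with s hs using hlt s hs.1 hs.2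

/-- Tangent spaces rotate at a rate controlled by the reach. -/
theorem exists_norm_orthogonal_tangent_le (G : TangentData m ι p) (hinj : Function.Injective ι)
    {R : ℝ} (hR0 : 0 < R)
    (hR : ∀ x y, 2 * R * ‖(G.T x)ᗮ.starProjection (ι y - ι x)‖ ≤ ‖ι y - ι x‖ ^ 2) :
    ∃ c > 0, ∀ y y', ‖ι y' - ι y‖ < c → ∀ u ∈ G.T y',
      R * ‖(G.T y)ᗮ.starProjection u‖ ≤ 11 / 5 * ‖ι y' - ι y‖ * ‖u‖ := by
  have hK : 1 ≤ G.K := G.one_le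
  have hr := G.r_pos
  refine ⟨min G.r (R / (10 * G.K ^ 2)), by positivity, fun y y' hc => ?_⟩
  set s := ‖ι y' - ι y‖ with hs
  have hsr : s < G.r := hc.trans_le (min_le_left _ _)
  have hsR : 10 * G.K ^ 2 * s ≤ R := by
    have := hc.le.trans (min_le_right _ _)
    rwa [le_div_iff₀ (by positivity), mul_comm] at this
  rcases (norm_nonneg (ι y' - ι y)).eq_or_lt with h0 | h0
  · have : y' = y := hinj (sub_eq_zero.1 (norm_eq_zero.1 h0.symm))
    subst this
    intro u hu
    rw [Submodule.starProjection_orthogonal_apply_eq_zero hu]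
    simp [hs]
  rw [← hs] at h0
  -- The tangent vector `u` is realized, up to a small normal part `n`, by a chord from `y'` to a
  -- point `z`. The inequality `hR` for `(y, z)`, `(y, y')` and `(y', z)` then bounds the normal
  -- part of `u`. The sign condition keeps `‖ι z - ι y‖²` close to at most `2 s²`; one of `u`, `-u`
  -- satisfies it.
  have hbase : ∀ u ∈ G.T y', ‖u‖ = s → inner ℝ (ι y' - ι y) u ≤ 0 →
      R * ‖(G.T y)ᗮ.starProjection u‖ ≤ 11 / 5 * s * s := by
    intro u hu hus hneg
    obtain ⟨z, hz1, hz2⟩ := G.surj y' y' (fun u hu => by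
      rw [Submodule.starProjection_orthogonal_apply_eq_zero hu, norm_zero]; positivity) u hu
      (by rwa [hus])
    rw [hus] at hz2
    set n := (G.T y')ᗮ.starProjection (ι z - ι y') with hn
    have hsum : ι z - ι y' = u + n := by
      rw [hn, ← hz1, Submodule.starProjection_add_starProjection_orthogonal]
    have hpy := (G.T y').norm_sq_eq_add_norm_sq_starProjection (ι z - ι y')
    rw [hz1, ← hn, hus] at hpy
    have hn1 := hR y' z
    rw [← hn] at hn1
    have hnK : 2 * R * ‖n‖ ≤ (G.K * s) ^ 2 := hn1.trans (by gcongr)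
    have hns : ‖n‖ ≤ s / 20 := by
      have : 2 * R * ‖n‖ ≤ 2 * R * (s / 20) := by
        nlinarith [mul_le_mul_of_nonneg_right hsR h0.le]
      exact le_of_mul_le_mul_left this (by positivity)
    have hn2 : ‖n‖ ^ 2 ≤ (s / 20) ^ 2 := by gcongr
    have ha : ‖(ι y' - ι y) + u‖ ^ 2 ≤ 2 * s ^ 2 := by
      rw [norm_add_sq_real, hus, ← hs]; linarith
    have ha' : ‖(ι y' - ι y) + u‖ ≤ 2 * s := by
      refine (norm_add_le _ _).trans ?_
      rw [hus, ← hs]; linarith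
    have hzy : ‖ι z - ι y‖ ^ 2 ≤ (2 + 1 / 5 + 1 / 400) * s ^ 2 := by
      have e : ι z - ι y = (ι y' - ι y + u) + n := by
        rw [show ι z - ι y = (ι y' - ι y) + (ι z - ι y') by abel, hsum]; abel
      have h1 : ‖ι z - ι y‖ ≤ ‖ι y' - ι y + u‖ + ‖n‖ := by rw [e]; exact norm_add_le _ _
      have h2 : ‖ι z - ι y‖ ^ 2 ≤ (‖ι y' - ι y + u‖ + ‖n‖) ^ 2 := by gcongr
      have h3 : ‖ι y' - ι y + u‖ * ‖n‖ ≤ 2 * s * (s / 20) := by gcongr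
      nlinarith
    have q1 := hR y z
    have q2 := hR y y'
    rw [← hs] at q2
    have hu_eq : u = (ι z - ι y) - (ι y' - ι y) - n := by
      rw [show (ι z - ι y) - (ι y' - ι y) = ι z - ι y' by abel, hsum]; abel
    have hQ : ‖(G.T y)ᗮ.starProjection u‖ ≤ ‖(G.T y)ᗮ.starProjection (ι z - ι y)‖ +
        ‖(G.T y)ᗮ.starProjection (ι y' - ι y)‖ + ‖n‖ := by
      conv_lhs => rw [hu_eq, map_sub _ _ n, map_sub _ (ι z - ι y) (ι y' - ι y)]
      refine (norm_sub_le _ _).trans (add_le_add (norm_sub_le _ _) ?_)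
      exact Submodule.norm_starProjection_apply_le _ _
    -- The total is `(2.2025 + 1 + 1.0025) / 2 * s²`, below `11/5 * s²`; the last summand comes from
    -- `2 R ‖n‖ ≤ s² + ‖n‖²`.
    nlinarith
  have hbase' : ∀ u ∈ G.T y', ‖u‖ = s → R * ‖(G.T y)ᗮ.starProjection u‖ ≤ 11 / 5 * s * s := by
    intro u hu hus
    rcases le_total (inner ℝ (ι y' - ι y) u) 0 with h | h
    · exact hbase u hu hus h
    · have := hbase (-u) (Submodule.neg_mem _ hu) (by rwa [norm_neg])
        (by rw [inner_neg_right]; linarith)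
      rwa [map_neg, norm_neg] at this
  intro u hu
  rcases eq_or_ne u 0 with rfl | hu0
  · simp
  have hun : 0 < ‖u‖ := norm_pos_iff.2 hu0
  have h := hbase' ((s / ‖u‖) • u) (Submodule.smul_mem _ _ hu) (by
    simp only [norm_smul, norm_div, norm_norm, Real.norm_of_nonneg h0.le]; field_simp)
  simp only [map_smul, norm_smul, norm_div, norm_norm, Real.norm_of_nonneg h0.le] at h
  have h2 : R * ‖(G.T y)ᗮ.starProjection u‖ * (s / ‖u‖) ≤ 11 / 5 * s * ‖u‖ * (s / ‖u‖) := by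
    calc _ = R * (s / ‖u‖ * ‖(G.T y)ᗮ.starProjection u‖) := by ring
      _ ≤ _ := h
      _ = _ := by field_simp
  exact le_of_mul_le_mul_right h2 (by positivity)

/-- Below a fifth of the reach, the tangential projection is onto. -/
theorem exists_starProjection_eq_of_norm_le (G : TangentData m ι p) (hinj : Function.Injective ι)
    {R : ℝ} (hR0 : 0 < R)
    (hR : ∀ x y, 2 * R * ‖(G.T x)ᗮ.starProjection (ι y - ι x)‖ ≤ ‖ι y - ι x‖ ^ 2)
    (x : M) {v : EuclideanSpace ℝ (Fin d)} (hv : v ∈ G.T x) (hvR : 5 * ‖v‖ ≤ R) :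
    ∃ y, (G.T x).starProjection (ι y - ι x) = v ∧ ‖ι y - ι x‖ ≤ 51 / 50 * (1001 / 1000) * ‖v‖ := by
  obtain ⟨c, hc, hrot⟩ := G.exists_norm_orthogonal_tangent_le hinj hR0 hR
  have hK : 1 ≤ G.K := G.one_le
  have hr := G.r_pos
  -- Continuity method along the segment to `v`, carrying a bound on the tilt of the tangent space.
  -- A step of length `h ‖v‖` moves the point by at most `127/100` of it and so adds a tilt of at
  -- most `11/5 * 127/100 ≤ 3` times it, over `R`. As `s ‖v‖ ≤ R / 5`, the tilt never exceeds the
  -- `3/5` allowed in `surj`, and the admissible step length is uniform.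
  set S : ℝ → Prop := fun s => ∃ y, (G.T x).starProjection (ι y - ι x) = s • v ∧
    ‖ι y - ι x‖ ≤ 2 * (s * ‖v‖) ∧
    ∀ u ∈ G.T y, R * ‖(G.T x)ᗮ.starProjection u‖ ≤ 3 * (s * ‖v‖) * ‖u‖ with hS
  obtain ⟨h₀, hh₀, hstep⟩ : ∃ h₀ > 0, ∀ s h, 0 ≤ s → 0 < h → h * ‖v‖ ≤ h₀ → s + h ≤ 1 → S s →
      S (s + h) := by
    refine ⟨min (G.r / 2) (min (c / (2 * G.K)) (R / (50 * G.K))), by positivity, ?_⟩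
    rintro s h hs hh hle hsh ⟨y, hy1, hy2, hy3⟩
    have hle1 : h * ‖v‖ < G.r := by linarith [hle.trans (min_le_left _ _)]
    have hle2 : G.K * (h * ‖v‖) < c := by
      have := hle.trans ((min_le_right _ _).trans (min_le_left _ _))
      rw [le_div_iff₀ (by positivity)] at this
      nlinarith
    have hle3 : 50 * (G.K * (h * ‖v‖)) ≤ R := by
      have := hle.trans ((min_le_right _ _).trans (min_le_right _ _))
      rw [le_div_iff₀ (by positivity)] at this
      linarith
    have hang : ∀ u ∈ G.T y, ‖(G.T x)ᗮ.starProjection u‖ ≤ 3 / 5 * ‖u‖ := fun u hu => by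
      have h1 := hy3 u hu
      have h2 : 3 * (s * ‖v‖) * ‖u‖ ≤ R * (3 / 5 * ‖u‖) := by
        have : s * ‖v‖ ≤ R / 5 := by nlinarith [norm_nonneg v]
        calc 3 * (s * ‖v‖) * ‖u‖ ≤ 3 * (R / 5) * ‖u‖ := by gcongr
          _ = _ := by ring
      exact le_of_mul_le_mul_left (h1.trans h2) hR0
    have hnhv : ‖h • v‖ = h * ‖v‖ := by rw [norm_smul, Real.norm_of_nonneg hh.le]
    obtain ⟨y', hy'1, hy'2⟩ := G.surj x y hang (h • v) (Submodule.smul_mem _ _ hv)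
      (by rwa [hnhv])
    rw [hnhv] at hy'2
    set D := ‖ι y' - ι y‖ with hD
    have hDc : D < c := hy'2.trans_lt hle2
    have hDR : 50 * D ≤ R := by linarith
    have hD0 : 0 ≤ D := norm_nonneg _
    have hQn := hR y y'
    set n := (G.T y)ᗮ.starProjection (ι y' - ι y) with hn
    have hnD : ‖n‖ ≤ D / 100 := by
      have : 2 * R * ‖n‖ ≤ 2 * R * (D / 100) := by nlinarith
      exact le_of_mul_le_mul_left this (by positivity)
    have hQD : ‖(G.T x)ᗮ.starProjection (ι y' - ι y)‖ ≤ 61 / 100 * D := by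
      rw [← Submodule.starProjection_add_starProjection_orthogonal (K := G.T y) (ι y' - ι y),
        map_add]
      refine (norm_add_le _ _).trans ?_
      have h1 := hang _ (Submodule.starProjection_apply_mem (G.T y) (ι y' - ι y))
      have h2 := Submodule.norm_starProjection_apply_le (G.T y) (ι y' - ι y)
      have h3 := Submodule.norm_starProjection_apply_le (G.T x)ᗮ n
      linarith
    have hpy := (G.T x).norm_sq_eq_add_norm_sq_starProjection (ι y' - ι y)
    rw [hy'1, hnhv, ← hD] at hpy
    have hD1 : D ≤ 127 / 100 * (h * ‖v‖) := by
      refine le_of_sq_le_sq ?_ (by positivity)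
      have : ‖(G.T x)ᗮ.starProjection (ι y' - ι y)‖ ^ 2 ≤ (61 / 100 * D) ^ 2 := by gcongr
      nlinarith
    refine ⟨y', ?_, ?_, ?_⟩
    · rw [show ι y' - ι x = (ι y - ι x) + (ι y' - ι y) by abel, map_add, hy1, hy'1, add_smul]
    · calc ‖ι y' - ι x‖ = ‖(ι y - ι x) + (ι y' - ι y)‖ := by congr 1; abel
        _ ≤ _ := norm_add_le _ _
        _ ≤ 2 * ((s + h) * ‖v‖) := by
          have : 0 ≤ h * ‖v‖ := by positivity
          linarith
    · intro u hu
      have h1 := hrot y y' hDc u hu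
      have h2 := hy3 _ (Submodule.starProjection_apply_mem (G.T y) u)
      have h3 := Submodule.norm_starProjection_apply_le (G.T y) u
      have h4 := Submodule.norm_starProjection_apply_le (G.T x)ᗮ ((G.T y)ᗮ.starProjection u)
      have h5 : ‖(G.T x)ᗮ.starProjection u‖ ≤
          ‖(G.T x)ᗮ.starProjection ((G.T y).starProjection u)‖ +
            ‖(G.T x)ᗮ.starProjection ((G.T y)ᗮ.starProjection u)‖ := by
        conv_lhs => rw [← Submodule.starProjection_add_starProjection_orthogonal (K := G.T y) u,
          map_add]
        exact norm_add_le _ _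
      have h6 : 11 / 5 * D * ‖u‖ ≤ 3 * (h * ‖v‖) * ‖u‖ := by
        refine mul_le_mul_of_nonneg_right ?_ (norm_nonneg u)
        have : 0 ≤ h * ‖v‖ := by positivity
        linarith
      have h7 : 3 * (s * ‖v‖) * ‖(G.T y).starProjection u‖ ≤ 3 * (s * ‖v‖) * ‖u‖ := by gcongr
      calc R * ‖(G.T x)ᗮ.starProjection u‖ ≤
            R * ‖(G.T x)ᗮ.starProjection ((G.T y).starProjection u)‖ +
              R * ‖(G.T y)ᗮ.starProjection u‖ := by
            rw [← mul_add]; gcongr; linarith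
        _ ≤ 3 * ((s + h) * ‖v‖) * ‖u‖ := by linarith
  have hS0 : S 0 := ⟨x, by simp, by simp, fun u hu => by
    rw [Submodule.starProjection_orthogonal_apply_eq_zero hu]; simp⟩
  obtain ⟨N, hN⟩ := exists_nat_gt (‖v‖ / h₀)
  have hN0 : (0 : ℝ) < N := lt_of_le_of_lt (by positivity) hN
  have hall : ∀ j : ℕ, j ≤ N → S (j / N) := by
    intro j
    induction j with
    | zero => intro _; simpa using hS0
    | succ j ih =>
      intro hj
      have hjN : ((j : ℝ) + 1) ≤ N := by exact_mod_cast hj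
      have := hstep (j / N) (1 / N) (by positivity) (by positivity) (by
        rw [div_lt_iff₀ hh₀] at hN
        rw [one_div_mul_eq_div, div_le_iff₀ hN0]; linarith) (by
        rw [← add_div, div_le_one hN0]; exact hjN) (ih (by omega))
      rw [← add_div] at this
      push_cast
      exact this
  obtain ⟨y, hy1, hy2, -⟩ := hall N le_rfl
  rw [div_self hN0.ne'] at hy1 hy2
  rw [one_smul] at hy1
  rw [one_mul] at hy2
  refine ⟨y, hy1, ?_⟩
  have hQ := hR x y
  have hpy := (G.T x).norm_sq_eq_add_norm_sq_starProjection (ι y - ι x)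
  rw [hy1] at hpy
  set A := ‖ι y - ι x‖
  have hA0 : 0 ≤ A := norm_nonneg _
  -- From `A ≤ 2 ‖v‖ ≤ 2 R / 5`. Then `A² ≤ 25/24 ‖v‖²`, whose root is below the stated constant.
  have hQ' : ‖(G.T x)ᗮ.starProjection (ι y - ι x)‖ ≤ A / 5 := by
    have : 2 * R * ‖(G.T x)ᗮ.starProjection (ι y - ι x)‖ ≤ 2 * R * (A / 5) := by
      nlinarith
    exact le_of_mul_le_mul_left this (by positivity)
  refine le_of_sq_le_sq ?_ (by positivity)
  have : ‖(G.T x)ᗮ.starProjection (ι y - ι x)‖ ^ 2 ≤ (A / 5) ^ 2 := by gcongr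
  nlinarith [sq_nonneg ‖v‖]

end TangentData

end SNN

/-! ### Volumes and masses of small balls -/

namespace SNN

open Filter Topology Metric

theorem euclideanHausdorffMeasure_image_le {X Y : Type*} [MetricSpace X] [MeasurableSpace X]
    [BorelSpace X] [MetricSpace Y] [MeasurableSpace Y] [BorelSpace Y] {C : NNReal} {f : X → Y}
    {s : Set X} (h : LipschitzOnWith C f s) (m : ℕ) :
    (Measure.euclideanHausdorffMeasure m : Measure Y) (f '' s) ≤
      (C : ENNReal) ^ m * (Measure.euclideanHausdorffMeasure m : Measure X) s := by
  simp only [Measure.euclideanHausdorffMeasure_def, Measure.smul_apply, ENNReal.smul_def,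
    smul_eq_mul]
  have := h.hausdorffMeasure_image_le (d := m) (by positivity)
  rw [ENNReal.rpow_natCast] at this
  rw [mul_left_comm]
  gcongr

theorem ballVol_pos (m : ℕ) : 0 < ballVol m :=
  ENNReal.toReal_pos (measure_ball_pos _ _ one_pos).ne' measure_ball_lt_top.ne

theorem volume_closedBall_eq {m : ℕ} {s : ℝ} (hs : 0 ≤ s) :
    (volume : Measure (EuclideanSpace ℝ (Fin m))) (closedBall 0 s) =
      ENNReal.ofReal (ballVol m * s ^ m) := by
  rw [Measure.addHaar_closedBall _ _ hs, finrank_euclideanSpace_fin, mul_comm,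
    ENNReal.ofReal_mul (ballVol_pos m).le, ballVol, ofReal_measureReal measure_ball_lt_top.ne]

/-- A positive affine function has the same integral over a centred ball as its value at `0`. -/
theorem lintegral_closedBall_affine {m : ℕ} (ℓ : EuclideanSpace ℝ (Fin m) →L[ℝ] ℝ) {a s : ℝ}
    (hs : 0 ≤ s) (ha : ‖ℓ‖ * s ≤ a) :
    ∫⁻ u in closedBall 0 s, ENNReal.ofReal (a + ℓ u) = ENNReal.ofReal (a * (ballVol m * s ^ m)) := by
  have hint : IntegrableOn (fun u : EuclideanSpace ℝ (Fin m) => ℓ u) (closedBall 0 s) :=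
    ℓ.continuous.continuousOn.integrableOn_compact (isCompact_closedBall _ _)
  have hconst : IntegrableOn (fun _ : EuclideanSpace ℝ (Fin m) => a) (closedBall 0 s) :=
    continuous_const.continuousOn.integrableOn_compact (isCompact_closedBall _ _)
  have hodd : ∫ u in closedBall (0 : EuclideanSpace ℝ (Fin m)) s, ℓ u = 0 := by
    rw [← integral_indicator measurableSet_closedBall]
    have h := integral_neg_eq_self
      ((closedBall (0 : EuclideanSpace ℝ (Fin m)) s).indicator fun u => ℓ u) volume
    have h2 : (fun u => (closedBall (0 : EuclideanSpace ℝ (Fin m)) s).indicator (fun u => ℓ u) (-u))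
        = fun u => -(closedBall (0 : EuclideanSpace ℝ (Fin m)) s).indicator (fun u => ℓ u) u := by
      funext u
      by_cases hu : u ∈ closedBall (0 : EuclideanSpace ℝ (Fin m)) s
      · have hu' : -u ∈ closedBall (0 : EuclideanSpace ℝ (Fin m)) s := by simpa using hu
        rw [Set.indicator_of_mem hu, Set.indicator_of_mem hu', map_neg]
      · have hu' : -u ∉ closedBall (0 : EuclideanSpace ℝ (Fin m)) s := by simpa using hu
        rw [Set.indicator_of_notMem hu, Set.indicator_of_notMem hu', neg_zero]
    rw [h2, integral_neg] at h
    linarith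
  rw [← ofReal_integral_eq_lintegral_ofReal (f := fun u => a + ℓ u) (hconst.add hint), integral_add hconst hint, hodd,
    setIntegral_const, add_zero, Measure.real, volume_closedBall_eq hs,
    ENNReal.toReal_ofReal (by have := ballVol_pos m; positivity), smul_eq_mul, mul_comm]
  refine (ae_restrict_iff' measurableSet_closedBall).2 (Eventually.of_forall fun u hu => ?_)
  have h1 : ‖ℓ u‖ ≤ ‖ℓ‖ * s := (ℓ.le_opNorm u).trans (by
    gcongr; simpa using hu)
  rw [Real.norm_eq_abs] at h1
  have := neg_abs_le (ℓ u)
  simp only [Pi.zero_apply]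
  linarith

theorem exists_one_add_mul_pow_le {c : ℝ} (hc : 0 ≤ c) (n : ℕ) :
    ∃ C, 0 ≤ C ∧ ∀ t, 0 ≤ t → t ≤ 1 → (1 + c * t) ^ n ≤ 1 + C * t := by
  induction n with
  | zero => exact ⟨0, le_rfl, fun t _ _ => by simp⟩
  | succ n ih =>
    obtain ⟨C, hC, h⟩ := ih
    refine ⟨C + c + C * c, by positivity, fun t ht ht1 => ?_⟩
    rw [pow_succ]
    calc _ ≤ (1 + C * t) * (1 + c * t) := by gcongr; exact h t ht ht1
      _ ≤ _ := by nlinarith [mul_nonneg (mul_nonneg hC hc) (mul_nonneg ht (sub_nonneg.2 ht1))]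

namespace TangentData

variable {m d : ℕ} {M : Type*} {ι : M → EuclideanSpace ℝ (Fin d)} {p : M → ℝ}

/-- An isometric identification of the tangent space with `ℝᵐ`. -/
noncomputable def frame (G : TangentData m ι p) (x : M) : G.T x ≃ₗᵢ[ℝ] EuclideanSpace ℝ (Fin m) :=
  ((stdOrthonormalBasis ℝ (G.T x)).reindex (finCongr (G.finrank_eq x))).repr

/-- The tangential projection, in the coordinates of `frame`. -/
noncomputable def coord (G : TangentData m ι p) (x : M) :
    EuclideanSpace ℝ (Fin d) →L[ℝ] EuclideanSpace ℝ (Fin m) :=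
  (G.frame x).toContinuousLinearEquiv.toContinuousLinearMap.comp (G.T x).orthogonalProjectionOnto

theorem norm_coord (G : TangentData m ι p) (x : M) (v) :
    ‖G.coord x v‖ = ‖(G.T x).starProjection v‖ :=
  (G.frame x).norm_map _

theorem norm_coord_le (G : TangentData m ι p) (x : M) (v) : ‖G.coord x v‖ ≤ ‖v‖ := by
  rw [norm_coord]; exact Submodule.norm_starProjection_apply_le _ _

theorem coord_eq (G : TangentData m ι p) (x : M) {v} {u : EuclideanSpace ℝ (Fin m)}
    (h : (G.T x).starProjection v = ((G.frame x).symm u : G.T x)) : G.coord x v = u := by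
  have h2 : (G.T x).orthogonalProjectionOnto v = (G.frame x).symm u := Subtype.ext h
  change G.frame x ((G.T x).orthogonalProjectionOnto v) = u
  rw [h2, LinearIsometryEquiv.apply_symm_apply]

theorem lipschitz_coord (G : TangentData m ι p) (x : M) :
    LipschitzWith 1 (fun v => G.coord x (v - ι x)) := by
  refine LipschitzWith.of_dist_le_mul fun a b => ?_
  rw [dist_eq_norm, ← map_sub, NNReal.coe_one, one_mul, dist_eq_norm, sub_sub_sub_cancel_right]
  exact G.norm_coord_le x _

/-- By Pythagoras the normal part of size `K s` times the chord changes its length only by a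
relative `O(s²)`. This is why the volume error is of second order. -/
theorem norm_sub_le_coord (G : TangentData m ι p) {x y y' : M} {s : ℝ} (hs : s < G.r)
    (hK : 2 * (G.K * s) ^ 2 ≤ 1) (hy : ‖ι y - ι x‖ ≤ s) (hy' : ‖ι y' - ι x‖ ≤ s) :
    ‖ι y - ι y'‖ ≤ (1 + (G.K * s) ^ 2) * ‖G.coord x (ι y - ι y')‖ := by
  have h1 := G.flat x y y' s hs hy hy'
  have h2 := (G.T x).norm_sq_eq_add_norm_sq_starProjection (ι y - ι y')
  rw [← G.norm_coord] at h2
  have h3 : ‖(G.T x)ᗮ.starProjection (ι y - ι y')‖ ^ 2 ≤ (G.K * s * ‖ι y - ι y'‖) ^ 2 := by gcongr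
  set q := (G.K * s) ^ 2
  have hq : 0 ≤ q := sq_nonneg _
  refine le_of_sq_le_sq ?_ (by positivity)
  have h4 : ‖ι y - ι y'‖ ^ 2 * (1 - q) ≤ ‖G.coord x (ι y - ι y')‖ ^ 2 := by
    rw [mul_pow] at h3; linarith
  have h5 : 1 ≤ (1 + q) ^ 2 * (1 - q) := by
    nlinarith [mul_nonneg hq (by nlinarith : 0 ≤ 1 - q - q ^ 2)]
  calc ‖ι y - ι y'‖ ^ 2 = ‖ι y - ι y'‖ ^ 2 * 1 := by ring
    _ ≤ ‖ι y - ι y'‖ ^ 2 * ((1 + q) ^ 2 * (1 - q)) := by gcongr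
    _ = (1 + q) ^ 2 * (‖ι y - ι y'‖ ^ 2 * (1 - q)) := by ring
    _ ≤ (1 + q) ^ 2 * ‖G.coord x (ι y - ι y')‖ ^ 2 := by gcongr
    _ = _ := by ring

theorem exists_coord_eq (G : TangentData m ι p) (x : M) {u : EuclideanSpace ℝ (Fin m)}
    (hu : G.K * ‖u‖ < G.r) (hK : 2 * (G.K ^ 2 * ‖u‖) ^ 2 ≤ 1) :
    ∃ y, G.coord x (ι y - ι x) = u ∧ ‖ι y - ι x‖ ≤ (1 + G.K ^ 4 * ‖u‖ ^ 2) * ‖u‖ := by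
  have h1 := G.one_le
  have hnorm : ‖((G.frame x).symm u : EuclideanSpace ℝ (Fin d))‖ = ‖u‖ :=
    (G.frame x).symm.norm_map u
  obtain ⟨y, hy1, hy2⟩ := G.surj x x (fun u hu => by
    rw [Submodule.starProjection_orthogonal_apply_eq_zero hu, norm_zero]; positivity)
    ((G.frame x).symm u : G.T x) ((G.frame x).symm u).2 (by
      rw [hnorm]; nlinarith [norm_nonneg u])
  rw [hnorm] at hy2
  have hc := G.coord_eq x hy1
  refine ⟨y, hc, ?_⟩
  have := G.norm_sub_le_coord (x := x) (y := y) (y' := x) hu (by convert hK using 3; ring) hy2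
    (by simpa using (norm_nonneg _).trans hy2)
  rw [hc] at this
  convert this using 3; ring

variable [MeasurableSpace M]

theorem volume_coord_image_le (G : TangentData m ι p) (hι : MeasurableEmbedding ι) (x : M)
    (A : Set M) :
    volume ((fun y => G.coord x (ι y - ι x)) '' A) ≤ vol m ι A := by
  rw [vol, hι.comap_apply, ← EuclideanSpace.euclideanHausdorffMeasure_eq_volume]
  have h := euclideanHausdorffMeasure_image_le ((G.lipschitz_coord x).lipschitzOnWith (s := ι '' A)) m
  rw [Set.image_image] at h
  simpa using h

/-- On `A` the projection is injective with a Lipschitz inverse, so Hausdorff measure grows by at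
most the `m`-th power of the Lipschitz constant. -/
theorem vol_le_volume_coord_image (G : TangentData m ι p) (hι : MeasurableEmbedding ι) {x : M}
    {s : ℝ} (hs : s < G.r) (hK : 2 * (G.K * s) ^ 2 ≤ 1) {A : Set M}
    (hA : ∀ y ∈ A, ‖ι y - ι x‖ ≤ s) :
    vol m ι A ≤ ENNReal.ofReal ((1 + (G.K * s) ^ 2) ^ m) *
      volume ((fun y => G.coord x (ι y - ι x)) '' A) := by
  rcases A.eq_empty_or_nonempty with rfl | ⟨y₀, hy₀⟩
  · simp
  have : Nonempty M := ⟨y₀⟩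
  set θ : M → EuclideanSpace ℝ (Fin m) := fun y => G.coord x (ι y - ι x) with hθ
  have hexp : ∀ y ∈ A, ∀ y' ∈ A, ‖ι y - ι y'‖ ≤ (1 + (G.K * s) ^ 2) * ‖θ y - θ y'‖ := by
    intro y hy y' hy'
    have := G.norm_sub_le_coord hs hK (hA y hy) (hA y' hy')
    rwa [hθ, ← map_sub, sub_sub_sub_cancel_right]
  have hinv : ∀ y ∈ A, ι (Function.invFunOn θ A (θ y)) = ι y := by
    intro y hy
    have hex : ∃ z ∈ A, θ z = θ y := ⟨y, hy, rfl⟩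
    have h1 := Function.invFunOn_mem hex
    have h2 := Function.invFunOn_eq hex
    have h3 := hexp _ h1 y hy
    rw [h2, sub_self, norm_zero, mul_zero] at h3
    exact sub_eq_zero.1 (norm_eq_zero.1 (le_antisymm h3 (norm_nonneg _)))
  have hlip : LipschitzOnWith (.mk (1 + (G.K * s) ^ 2) (by positivity))
      (fun u => ι (Function.invFunOn θ A u)) (θ '' A) := by
    refine LipschitzOnWith.of_dist_le_mul ?_
    rintro _ ⟨y, hy, rfl⟩ _ ⟨y', hy', rfl⟩
    rw [hinv y hy, hinv y' hy', dist_eq_norm, dist_eq_norm]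
    exact hexp y hy y' hy'
  have himg : (fun u => ι (Function.invFunOn θ A u)) '' (θ '' A) = ι '' A := by
    rw [Set.image_image]
    exact Set.image_congr hinv
  have h := euclideanHausdorffMeasure_image_le hlip m
  rw [himg, EuclideanSpace.euclideanHausdorffMeasure_eq_volume] at h
  rw [vol, hι.comap_apply]
  refine h.trans_eq ?_
  congr 1
  rw [ENNReal.ofReal_pow (by positivity), ENNReal.ofReal]
  congr 2
  ext
  rw [Real.coe_toNNReal _ (by positivity)]
  rfl


/-- Tangential projections cover balls of nearly full radius. -/
theorem volume_closedBall_le_vol (G : TangentData m ι p) (hι : MeasurableEmbedding ι) (x : M)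
    {s s' : ℝ} (h : ∀ u : EuclideanSpace ℝ (Fin m), ‖u‖ ≤ s' →
      ∃ y, G.coord x (ι y - ι x) = u ∧ ‖ι y - ι x‖ ≤ s) :
    volume (closedBall (0 : EuclideanSpace ℝ (Fin m)) s') ≤ vol m ι {y | ‖ι y - ι x‖ ≤ s} := by
  refine (measure_mono fun u hu => ?_).trans (G.volume_coord_image_le hι x _)
  obtain ⟨y, h1, h2⟩ := h u (by simpa using hu)
  exact ⟨y, h2, h1⟩

/-- The constants fit because `5 * 117/100 ≤ 6` and `51/50 * 1001/1000 * 117/100 ≤ 6/5`. -/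
theorem le_vol_of_reach (G : TangentData m ι p) (hι : MeasurableEmbedding ι)
    {R : ℝ} (hR0 : 0 < R)
    (hR : ∀ x y, 2 * R * ‖(G.T x)ᗮ.starProjection (ι y - ι x)‖ ≤ ‖ι y - ι x‖ ^ 2)
    (x : M) {e : ℝ} (he : 0 ≤ e) (heR : 6 * e ≤ R) :
    ENNReal.ofReal (ballVol m * (117 / 100 * e) ^ m) ≤
      vol m ι {y | ‖ι y - ι x‖ ≤ 6 / 5 * e} := by
  rw [← volume_closedBall_eq (by positivity)]
  refine G.volume_closedBall_le_vol hι x fun u hu => ?_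
  have hnorm : ‖((G.frame x).symm u : EuclideanSpace ℝ (Fin d))‖ = ‖u‖ :=
    (G.frame x).symm.norm_map u
  obtain ⟨y, hy1, hy2⟩ := G.exists_starProjection_eq_of_norm_le hι.injective hR0 hR x
    ((G.frame x).symm u).2 (by rw [hnorm]; linarith)
  rw [hnorm] at hy2
  exact ⟨y, G.coord_eq x hy1, hy2.trans (by linarith)⟩

set_option maxHeartbeats 1000000 in
/-- The measure with density `p` of a small Euclidean ball is that of a tangential ball, up to a
relative error of second order in the radius. -/
theorem exists_measure_ball_bounds (G : TangentData m ι p) (hι : MeasurableEmbedding ι)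
    {a : ℝ} (ha : 0 < a) (hp : ∀ x, a ≤ p x) :
    ∃ C r₁ : ℝ, 0 ≤ C ∧ 0 < r₁ ∧ r₁ ≤ 1 ∧ C * r₁ ^ 2 ≤ 1 ∧ ∀ (x : M) (s : ℝ), 0 ≤ s → s ≤ r₁ →
      ENNReal.ofReal ((1 - C * s ^ 2) * (p x * (ballVol m * s ^ m))) ≤
        ((vol m ι).withDensity fun x => ENNReal.ofReal (p x)) {y | ‖ι y - ι x‖ ≤ s} ∧
      ((vol m ι).withDensity fun x => ENNReal.ofReal (p x)) {y | ‖ι y - ι x‖ ≤ s} ≤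
        ENNReal.ofReal ((1 + C * s ^ 2) * (p x * (ballVol m * s ^ m))) := by
  have hK := G.one_le
  have hK0 : 0 < G.K := by linarith
  have hr := G.r_pos
  have hα := ballVol_pos m
  set C₁ := 2 * G.K / a with hC₁
  have hC₁0 : 0 < C₁ := by positivity
  obtain ⟨C₂, hC₂, hpow⟩ := exists_one_add_mul_pow_le (c := G.K ^ 2 + C₁) (by positivity) (m + 1)
  set A := G.K ^ 4 with hA
  have hA1 : 1 ≤ A := one_le_pow₀ hK
  set C := C₂ + C₁ + m * A with hC
  have hm0 : (0 : ℝ) ≤ m := Nat.cast_nonneg m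
  have hC0 : 0 < C := by positivity
  obtain ⟨r₁, hr₁0, hr₁1, hr₁C, hr₁r, hr₁K, hr₁a⟩ : ∃ r₁ : ℝ, 0 < r₁ ∧ r₁ ≤ 1 ∧ C * r₁ ≤ 1 ∧
      2 * G.K * r₁ ≤ G.r ∧ 2 * G.K ^ 2 * r₁ ≤ 1 ∧ 2 * G.K * r₁ ≤ a := by
    have key : ∀ b c : ℝ, 0 < b → ∀ r', r' ≤ c / b → b * r' ≤ c := fun b c hb r' h => by
      rwa [le_div_iff₀ hb, mul_comm] at h
    refine ⟨min 1 (min (1 / C) (min (G.r / (2 * G.K)) (min (1 / (2 * G.K ^ 2)) (a / (2 * G.K))))),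
      by positivity, min_le_left _ _, ?_, ?_, ?_, ?_⟩ <;> apply key _ _ (by positivity)
    · exact (min_le_right _ _).trans (min_le_left _ _)
    · exact (min_le_right _ _).trans ((min_le_right _ _).trans (min_le_left _ _))
    · exact (min_le_right _ _).trans ((min_le_right _ _).trans ((min_le_right _ _).trans
        (min_le_left _ _)))
    · exact (min_le_right _ _).trans ((min_le_right _ _).trans ((min_le_right _ _).trans
        (min_le_right _ _)))
  have hr₁sq : r₁ ^ 2 ≤ r₁ := by nlinarith
  refine ⟨C, r₁, hC0.le, hr₁0, hr₁1, by nlinarith, fun x s hs0 hs => ?_⟩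
  have hs1 : s ≤ 1 := hs.trans hr₁1
  have hssq : s ^ 2 ≤ s := by nlinarith
  have hsr : s < G.r := by nlinarith
  have hKs : G.K * s ≤ 1 / 2 := by nlinarith
  have hsK : 2 * (G.K * s) ^ 2 ≤ 1 := by nlinarith [mul_nonneg hK0.le hs0]
  have hsK2 : G.K ^ 2 * s ≤ 1 / 2 := by nlinarith
  set B : Set M := {y | ‖ι y - ι x‖ ≤ s} with hB
  set θ : M → EuclideanSpace ℝ (Fin m) := fun y => G.coord x (ι y - ι x) with hθ
  have hθm : Measurable θ :=
    (G.coord x).continuous.measurable.comp (hι.measurable.sub_const _)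
  have hBm : MeasurableSet B := measurableSet_le (hι.measurable.sub_const _).norm measurable_const
  obtain ⟨ℓ, hℓn, hℓ⟩ := G.taylor x
  let ℓ' : EuclideanSpace ℝ (Fin m) →L[ℝ] ℝ :=
    ℓ.comp ((G.T x).subtypeL.comp (G.frame x).symm.toContinuousLinearEquiv.toContinuousLinearMap)
  have hℓ'θ : ∀ y, ℓ' (θ y) = ℓ ((G.T x).starProjection (ι y - ι x)) := fun y => by
    change ℓ (((G.frame x).symm (G.frame x ((G.T x).orthogonalProjectionOnto (ι y - ι x))) :
      G.T x)) = _
    rw [LinearIsometryEquiv.symm_apply_apply, Submodule.starProjection_apply]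
  have hℓ'n : ‖ℓ'‖ ≤ G.K := by
    refine ContinuousLinearMap.opNorm_le_bound _ hK0.le fun u => ?_
    have h1 : ‖((G.frame x).symm u : EuclideanSpace ℝ (Fin d))‖ = ‖u‖ :=
      (G.frame x).symm.norm_map u
    calc ‖ℓ' u‖ ≤ G.K * ‖((G.frame x).symm u : EuclideanSpace ℝ (Fin d))‖ :=
          ℓ.le_of_opNorm_le hℓn _
      _ = _ := by rw [h1]
  have hℓ's : ‖ℓ'‖ * s ≤ p x := by
    calc ‖ℓ'‖ * s ≤ G.K * r₁ := by gcongr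
      _ ≤ p x := by linarith [hp x]
  -- The density is replaced by an affine function of the tangential coordinate. Since this function
  -- is at least `a / 2`, the Taylor error `K s²` is a relative error `C₁ s²`.
  have hpt : ∀ y ∈ B, a / 2 ≤ p x + ℓ' (θ y) ∧
      (1 - C₁ * s ^ 2) * (p x + ℓ' (θ y)) ≤ p y ∧ p y ≤ (1 + C₁ * s ^ 2) * (p x + ℓ' (θ y)) := by
    intro y hy
    have hys : ‖ι y - ι x‖ ≤ s := hy
    have h1 := hℓ y (hys.trans_lt hsr)
    rw [← hℓ'θ] at h1
    have h2 : |ℓ' (θ y)| ≤ a / 2 := by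
      have h3 := ℓ'.le_of_opNorm_le hℓ'n (θ y)
      have h4 : ‖θ y‖ ≤ s := (G.norm_coord_le x _).trans hys
      rw [Real.norm_eq_abs] at h3
      have : G.K * ‖θ y‖ ≤ G.K * r₁ := by gcongr; exact h4.trans hs
      linarith
    have h5 : a / 2 ≤ p x + ℓ' (θ y) := by linarith [neg_abs_le (ℓ' (θ y)), hp x]
    have h6 : G.K * ‖ι y - ι x‖ ^ 2 ≤ C₁ * s ^ 2 * (p x + ℓ' (θ y)) := by
      calc G.K * ‖ι y - ι x‖ ^ 2 ≤ G.K * s ^ 2 := by gcongr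
        _ = C₁ * s ^ 2 * (a / 2) := by rw [hC₁]; field_simp
        _ ≤ _ := by gcongr
    have h7 := abs_le.1 (h1.trans h6)
    exact ⟨h5, by linarith [h7.1], by linarith [h7.2]⟩
  rw [withDensity_apply _ hBm]
  -- The projected volume is pinched between Lebesgue measure on a ball of radius `s / (1 + A s²)`
  -- and `1 + O(s²)` times Lebesgue measure on the ball of radius `s`. Over both balls the affine
  -- density integrates as the constant `p x`.
  set ν := ((vol m ι).restrict B).map θ with hν
  have hfm : Measurable fun u => ENNReal.ofReal (p x + ℓ' u) := by fun_prop
  have hfθ : Measurable fun y => ENNReal.ofReal (p x + ℓ' (θ y)) := hfm.comp hθm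
  have hmap : ∫⁻ y in B, ENNReal.ofReal (p x + ℓ' (θ y)) ∂(vol m ι) =
      ∫⁻ u, ENNReal.ofReal (p x + ℓ' u) ∂ν := by
    rw [hν, lintegral_map hfm hθm]
  have hνapp : ∀ S, MeasurableSet S → ν S = vol m ι (θ ⁻¹' S ∩ B) := fun S hS => by
    rw [hν, Measure.map_apply hθm hS, Measure.restrict_apply (hθm hS)]
  constructor
  · set s' := s / (1 + A * s ^ 2) with hs'
    have hden : 1 ≤ 1 + A * s ^ 2 := by nlinarith [sq_nonneg s]
    have hs'0 : 0 ≤ s' := by positivity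
    have hs's : s' ≤ s := div_le_self hs0 hden
    have hsurj : ∀ u : EuclideanSpace ℝ (Fin m), ‖u‖ ≤ s' → ∃ y, θ y = u ∧ ‖ι y - ι x‖ ≤ s := by
      intro u hu
      have hus : ‖u‖ ≤ s := hu.trans hs's
      obtain ⟨y, h1, h2⟩ := G.exists_coord_eq x (u := u) (by nlinarith [norm_nonneg u]) (by
        have : G.K ^ 2 * ‖u‖ ≤ 1 / 2 := le_trans (by gcongr) hsK2
        nlinarith [mul_nonneg (sq_nonneg G.K) (norm_nonneg u)])
      refine ⟨y, h1, h2.trans ?_⟩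
      calc _ ≤ (1 + A * s ^ 2) * s' := by gcongr
        _ = s := by rw [hs']; field_simp
    have hνge : volume.restrict (closedBall 0 s') ≤ ν := by
      refine Measure.le_iff.2 fun S hS => ?_
      rw [hνapp S hS, Measure.restrict_apply hS]
      refine (measure_mono ?_).trans (G.volume_coord_image_le hι x _)
      rintro u ⟨huS, hu⟩
      obtain ⟨y, h1, h2⟩ := hsurj u (by simpa using hu)
      exact ⟨y, ⟨by rw [Set.mem_preimage, h1]; exact huS, h2⟩, h1⟩
    have hps' : (1 - m * A * s ^ 2) * s ^ m ≤ s' ^ m := by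
      have h1 : 1 - A * s ^ 2 ≤ 1 / (1 + A * s ^ 2) := by
        rw [le_div_iff₀ (by positivity)]; nlinarith [sq_nonneg (A * s ^ 2)]
      have h2 : -2 ≤ -(A * s ^ 2) := by
        have : A * s ^ 2 = (G.K ^ 2 * s) ^ 2 := by rw [hA]; ring
        rw [this]; nlinarith [mul_nonneg (sq_nonneg G.K) hs0]
      have h3 := one_add_mul_le_pow h2 m
      have h4 : 0 ≤ 1 - A * s ^ 2 := by
        have : A * s ^ 2 = (G.K ^ 2 * s) ^ 2 := by rw [hA]; ring
        rw [this]; nlinarith [mul_nonneg (sq_nonneg G.K) hs0]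
      calc (1 - m * A * s ^ 2) * s ^ m ≤ (1 - A * s ^ 2) ^ m * s ^ m := by
            gcongr
            calc _ = 1 + m * -(A * s ^ 2) := by ring
              _ ≤ _ := h3
              _ = _ := by ring
        _ ≤ (1 / (1 + A * s ^ 2)) ^ m * s ^ m := by gcongr
        _ = s' ^ m := by rw [← mul_pow, hs']; congr 1; ring
    have hCs : (C₁ + m * A) * s ^ 2 ≤ 1 := by
      have : (C₁ + m * A) * s ^ 2 ≤ C * r₁ := by
        have : s ^ 2 ≤ r₁ := hssq.trans hs
        gcongr
        linarith
      linarith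
    have hq0 : 0 ≤ 1 - C₁ * s ^ 2 := by
      nlinarith [mul_nonneg (mul_nonneg hm0 (zero_le_one.trans hA1)) (sq_nonneg s)]
    have hpx : 0 < p x := ha.trans_le (hp x)
    calc ENNReal.ofReal ((1 - C * s ^ 2) * (p x * (ballVol m * s ^ m)))
        ≤ ENNReal.ofReal ((1 - C₁ * s ^ 2) * (p x * (ballVol m * s' ^ m))) := by
          apply ENNReal.ofReal_le_ofReal
          have h1 : (1 - C * s ^ 2) * s ^ m ≤ (1 - C₁ * s ^ 2) * s' ^ m := by
            calc (1 - C * s ^ 2) * s ^ m ≤ ((1 - C₁ * s ^ 2) * (1 - m * A * s ^ 2)) * s ^ m := by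
                  gcongr
                  rw [hC]
                  nlinarith [mul_nonneg hC₂ (sq_nonneg s), mul_nonneg (mul_nonneg hC₁0.le
                    (sq_nonneg s)) (mul_nonneg (mul_nonneg hm0 (zero_le_one.trans hA1))
                    (sq_nonneg s))]
              _ = (1 - C₁ * s ^ 2) * ((1 - m * A * s ^ 2) * s ^ m) := by ring
              _ ≤ _ := by gcongr
          calc _ = p x * ballVol m * ((1 - C * s ^ 2) * s ^ m) := by ring
            _ ≤ p x * ballVol m * ((1 - C₁ * s ^ 2) * s' ^ m) := by gcongr
            _ = _ := by ring
      _ = ENNReal.ofReal (1 - C₁ * s ^ 2) *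
            ∫⁻ u in closedBall 0 s', ENNReal.ofReal (p x + ℓ' u) := by
          rw [lintegral_closedBall_affine ℓ' hs'0 (le_trans (by gcongr) hℓ's),
            ENNReal.ofReal_mul hq0]
      _ ≤ ENNReal.ofReal (1 - C₁ * s ^ 2) * ∫⁻ u, ENNReal.ofReal (p x + ℓ' u) ∂ν := by
          gcongr
      _ = ∫⁻ y in B, ENNReal.ofReal (1 - C₁ * s ^ 2) * ENNReal.ofReal (p x + ℓ' (θ y))
            ∂(vol m ι) := by
          rw [lintegral_const_mul _ hfθ, hmap]
      _ ≤ _ := by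
          refine setLIntegral_mono' hBm fun y hy => ?_
          rw [← ENNReal.ofReal_mul hq0]
          exact ENNReal.ofReal_le_ofReal (hpt y hy).2.1
  · have hνle : ν ≤ ENNReal.ofReal ((1 + (G.K * s) ^ 2) ^ m) • volume.restrict (closedBall 0 s) := by
      refine Measure.le_iff.2 fun S hS => ?_
      rw [hνapp S hS, Measure.smul_apply, Measure.restrict_apply hS, smul_eq_mul]
      refine (G.vol_le_volume_coord_image hι hsr hsK fun y hy => hy.2).trans ?_
      gcongr
      rintro _ ⟨y, ⟨hyS, hyB⟩, rfl⟩
      exact ⟨hyS, by simpa using (G.norm_coord_le x _).trans hyB⟩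
    calc ∫⁻ y in B, ENNReal.ofReal (p y) ∂(vol m ι)
        ≤ ∫⁻ y in B, ENNReal.ofReal (1 + C₁ * s ^ 2) * ENNReal.ofReal (p x + ℓ' (θ y))
            ∂(vol m ι) := by
          refine setLIntegral_mono' hBm fun y hy => ?_
          rw [← ENNReal.ofReal_mul (by positivity)]
          exact ENNReal.ofReal_le_ofReal (hpt y hy).2.2
      _ = ENNReal.ofReal (1 + C₁ * s ^ 2) * ∫⁻ u, ENNReal.ofReal (p x + ℓ' u) ∂ν := by
          rw [lintegral_const_mul _ hfθ, hmap]
      _ ≤ ENNReal.ofReal (1 + C₁ * s ^ 2) * ∫⁻ u, ENNReal.ofReal (p x + ℓ' u)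
            ∂(ENNReal.ofReal ((1 + (G.K * s) ^ 2) ^ m) • volume.restrict (closedBall 0 s)) := by
          gcongr
      _ = ENNReal.ofReal ((1 + C₁ * s ^ 2) * ((1 + (G.K * s) ^ 2) ^ m *
            (p x * (ballVol m * s ^ m)))) := by
          rw [lintegral_smul_measure, lintegral_closedBall_affine ℓ' hs0 hℓ's, smul_eq_mul,
            ENNReal.ofReal_mul (p := 1 + C₁ * s ^ 2) (by positivity),
            ENNReal.ofReal_mul (p := (1 + (G.K * s) ^ 2) ^ m) (by positivity)]
      _ ≤ _ := by
          apply ENNReal.ofReal_le_ofReal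
          have hpx : 0 < p x := ha.trans_le (hp x)
          rw [← mul_assoc]
          refine mul_le_mul_of_nonneg_right ?_ (mul_nonneg hpx.le (by positivity))
          have h1 := hpow (s ^ 2) (sq_nonneg s) (hssq.trans hs1)
          have h2 : (1 + C₁ * s ^ 2) * (1 + (G.K * s) ^ 2) ^ m ≤
              (1 + (G.K ^ 2 + C₁) * s ^ 2) ^ (m + 1) := by
            rw [pow_succ (1 + (G.K ^ 2 + C₁) * s ^ 2) m, mul_comm]
            have e1 : (G.K * s) ^ 2 ≤ (G.K ^ 2 + C₁) * s ^ 2 := by nlinarith [sq_nonneg s]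
            have e2 : C₁ * s ^ 2 ≤ (G.K ^ 2 + C₁) * s ^ 2 := by
              nlinarith [sq_nonneg s, sq_nonneg G.K, mul_nonneg (sq_nonneg s) (sq_nonneg G.K)]
            gcongr
          have h3 : C₂ * s ^ 2 ≤ C * s ^ 2 := by
            gcongr
            have : 0 ≤ m * A := by positivity
            linarith
          linarith

end TangentData

end SNN

/-! ### Exponential deviation bounds -/

namespace SNN

open Filter Topology Metric

section Deviation

variable {α : Type*} [MeasurableSpace α] {μ : Measure α} [IsProbabilityMeasure μ]

/-- A second order bound for the exponential moment of a bounded function supported in `A`. -/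
theorem integral_exp_sub_integral_le {g : α → ℝ} (hg : Measurable g) {A : Set α}
    (hA : MeasurableSet A) {b : ℝ} (hgb : ∀ z, |g z| ≤ b) (hgA : ∀ z ∉ A, g z = 0) {l : ℝ}
    (hl : 0 ≤ l) (hlb : 2 * (l * b) ≤ 1) :
    ∫ z, Real.exp (l * (g z - ∫ z, g z ∂μ)) ∂μ ≤ Real.exp (l ^ 2 * b ^ 2 * μ.real A) := by
  set e := ∫ z, g z ∂μ with he
  have hb : 0 ≤ b := by
    obtain ⟨z⟩ : Nonempty α := nonempty_of_isProbabilityMeasure μ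
    exact (abs_nonneg _).trans (hgb z)
  have hgm : MemLp g 2 μ := MemLp.of_bound hg.aestronglyMeasurable b (ae_of_all _ hgb)
  have hgi : Integrable g μ := hgm.integrable (by norm_num)
  have heb : |e| ≤ b := by
    have := norm_integral_le_of_norm_le_const (μ := μ) (ae_of_all _ hgb : ∀ᵐ z ∂μ, ‖g z‖ ≤ b)
    simpa using this
  have hu : ∀ z, |l * (g z - e)| ≤ 1 := fun z => by
    rw [abs_mul, abs_of_nonneg hl]
    have : |g z - e| ≤ 2 * b := (abs_sub _ _).trans (by linarith [hgb z])
    nlinarith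
  have h2i : Integrable (fun z => (g z - e) ^ 2) μ :=
    (hgm.sub (memLp_const e)).integrable_sq
  have h0i : Integrable (fun z => g z - e) μ := hgi.sub (integrable_const _)
  have h1i : Integrable (fun z => 1 + l * (g z - e)) μ :=
    (integrable_const _).add (h0i.const_mul _)
  have hei : Integrable (fun z => Real.exp (l * (g z - e))) μ := by
    refine Integrable.of_bound (by fun_prop) (Real.exp 1) (ae_of_all _ fun z => ?_)
    rw [Real.norm_eq_abs, Real.abs_exp]
    exact Real.exp_le_exp.2 ((le_abs_self _).trans (hu z))
  have hvar : ∫ z, (g z - e) ^ 2 ∂μ ≤ b ^ 2 * μ.real A := by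
    have h1 : ∫ z, (g z - e) ^ 2 ∂μ = Var[g; μ] := by
      rw [variance_eq_integral hg.aemeasurable]
    have h2 := variance_le_expectation_sq (μ := μ) hg.aestronglyMeasurable
    have h3 : ∫ z, (g ^ 2) z ∂μ ≤ ∫ z, A.indicator (fun _ => b ^ 2) z ∂μ := by
      refine integral_mono hgm.integrable_sq ((integrable_const _).indicator hA) fun z => ?_
      by_cases hz : z ∈ A
      · simp only [Pi.pow_apply, Set.indicator_of_mem hz]
        exact sq_le_sq' (neg_le_of_abs_le (hgb z)) (le_of_abs_le (hgb z))
      · simp [Set.indicator_of_notMem hz, hgA z hz]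
    rw [integral_indicator_const _ hA, smul_eq_mul, mul_comm] at h3
    linarith
  calc ∫ z, Real.exp (l * (g z - e)) ∂μ
      ≤ ∫ z, (1 + l * (g z - e) + l ^ 2 * (g z - e) ^ 2) ∂μ := by
        refine integral_mono hei ?_ fun z => ?_
        · exact h1i.add (h2i.const_mul _)
        · have := (abs_le.1 (Real.abs_exp_sub_one_sub_id_le (hu z))).2
          simp only
          nlinarith
    _ = 1 + l ^ 2 * ∫ z, (g z - e) ^ 2 ∂μ := by
        rw [integral_add h1i (h2i.const_mul _), integral_add (integrable_const _)
          (h0i.const_mul _), integral_const_mul, integral_const_mul,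
          integral_sub hgi (integrable_const _)]
        simp [he]
    _ ≤ 1 + l ^ 2 * b ^ 2 * μ.real A := by nlinarith [sq_nonneg l]
    _ ≤ _ := by linarith [Real.add_one_le_exp (l ^ 2 * b ^ 2 * μ.real A)]

/-- A Bernstein type inequality. -/
theorem measure_pi_lt_sum_sub_le {N : ℕ} {g : α → ℝ} (hg : Measurable g) {A : Set α}
    (hA : MeasurableSet A) {b : ℝ} (hgb : ∀ z, |g z| ≤ b) (hgA : ∀ z ∉ A, g z = 0)
    {k Q δ : ℝ} (hk : 0 ≤ k) (hQ : 1 ≤ Q) (hδ0 : 0 ≤ δ) (hδ1 : δ ≤ 1)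
    (hN : N * μ.real A ≤ Q * k) :
    (Measure.pi fun _ : Fin N => μ).real {ξ | Q * b * k * δ < ∑ i, g (ξ i) - N * ∫ z, g z ∂μ} ≤
      Real.exp (-(k * δ ^ 2 / 4)) := by
  set e := ∫ z, g z ∂μ with he
  have hb : 0 ≤ b := by
    obtain ⟨z⟩ : Nonempty α := nonempty_of_isProbabilityMeasure μ
    exact (abs_nonneg _).trans (hgb z)
  rcases hb.eq_or_lt with rfl | hb
  · have h0 : ∀ z, g z = 0 := fun z => abs_nonpos_iff.1 (hgb z)
    have : {ξ : Fin N → α | Q * 0 * k * δ < ∑ i, g (ξ i) - N * e} = ∅ := by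
      ext ξ
      simp [h0, he]
    rw [this]
    simpa using (Real.exp_pos _).le
  -- With this choice the Chernoff exponent is at most `-Q k δ² / 2 + Q k δ² / 4`.
  set l := δ / (2 * b) with hl
  have hl0 : 0 ≤ l := by positivity
  have hlb : 2 * (l * b) = δ := by rw [hl]; field_simp
  have hint : Integrable (fun z => Real.exp (l * (g z - e))) μ := by
    refine Integrable.of_bound (by fun_prop) (Real.exp (l * (b - e))) (ae_of_all _ fun z => ?_)
    rw [Real.norm_eq_abs, Real.abs_exp]
    have := (le_abs_self _).trans (hgb z)
    gcongr
  have hprod : ∀ ξ : Fin N → α, Real.exp (l * (∑ i, g (ξ i) - N * e)) =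
      ∏ i, Real.exp (l * (g (ξ i) - e)) := fun ξ => by
    rw [← Real.exp_sum, ← Finset.mul_sum, Finset.sum_sub_distrib]
    simp
  have h1 := measure_ge_le_exp_mul_mgf (μ := Measure.pi fun _ : Fin N => μ)
    (X := fun ξ => ∑ i, g (ξ i) - N * e) (t := l) (Q * b * k * δ) hl0 (by
      simp_rw [hprod]
      exact Integrable.fintype_prod fun _ => hint)
  have h2 : mgf (fun ξ : Fin N → α => ∑ i, g (ξ i) - N * e) (Measure.pi fun _ : Fin N => μ) l ≤
      Real.exp (l ^ 2 * b ^ 2 * μ.real A) ^ N := by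
    rw [mgf]
    simp_rw [hprod]
    rw [integral_fintype_prod_eq_pow (fun z => Real.exp (l * (g z - e))), Fintype.card_fin]
    exact pow_le_pow_left₀ (integral_nonneg fun _ => (Real.exp_pos _).le)
      (integral_exp_sub_integral_le hg hA hgb hgA hl0 (by linarith)) N
  have hsub : {ξ : Fin N → α | Q * b * k * δ < ∑ i, g (ξ i) - N * e} ⊆
      {ξ | Q * b * k * δ ≤ ∑ i, g (ξ i) - N * e} := fun ξ hξ => by
    simp only [Set.mem_ofPred_eq] at hξ ⊢
    exact hξ.le
  refine (measureReal_mono hsub).trans (h1.trans ?_)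
  calc _ ≤ Real.exp (-l * (Q * b * k * δ)) * Real.exp (l ^ 2 * b ^ 2 * μ.real A) ^ N := by gcongr
    _ = Real.exp (-(Q * k * δ ^ 2 / 2) + δ ^ 2 / 4 * (N * μ.real A)) := by
        rw [← Real.exp_nat_mul, ← Real.exp_add]
        congr 1
        have h3 : l * b = δ / 2 := by linarith
        calc _ = -(l * b) * (Q * k * δ) + (l * b) ^ 2 * (N * μ.real A) := by ring
          _ = _ := by rw [h3]; ring
    _ ≤ _ := by
        apply Real.exp_le_exp.2
        have h3 : δ ^ 2 / 4 * (N * μ.real A) ≤ δ ^ 2 / 4 * (Q * k) := by gcongr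
        have h4 : 1 * (k * δ ^ 2) ≤ Q * (k * δ ^ 2) := by gcongr
        linarith

/-- The Bernstein inequality for a kernel `g` that is centred at one of the sample points. -/
theorem measure_pi_lt_sum_sub_kernel_le {N : ℕ} {g : α → α → ℝ}
    (hg : Measurable fun z : α × α => g z.1 z.2) (hg0 : ∀ y, g y y = 0) {A : Set (α × α)}
    (hA : MeasurableSet A) {b : ℝ} (hgb : ∀ y z, |g y z| ≤ b)
    (hgA : ∀ y z, (y, z) ∉ A → g y z = 0)
    {k Q δ : ℝ} (hk : 0 ≤ k) (hQ : 1 ≤ Q) (hδ0 : 0 ≤ δ) (hδ1 : δ ≤ 1)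
    (hN : ∀ y, N * μ.real (Prod.mk y ⁻¹' A) ≤ Q * k) (i : Fin (N + 1)) :
    (Measure.pi fun _ : Fin (N + 1) => μ).real
      {ξ | Q * b * k * δ < ∑ j, g (ξ i) (ξ j) - N * ∫ z, g (ξ i) z ∂μ} ≤
      Real.exp (-(k * δ ^ 2 / 4)) := by
  set S : Set (α × (Fin N → α)) :=
    {z | Q * b * k * δ < ∑ j, g z.1 (z.2 j) - N * ∫ z', g z.1 z' ∂μ} with hS
  have hSm : MeasurableSet S := by
    refine measurableSet_lt measurable_const (Measurable.sub ?_ (Measurable.const_mul ?_ _))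
    · exact Finset.measurable_sum _ fun j _ =>
        hg.comp (measurable_fst.prodMk ((measurable_pi_apply j).comp measurable_snd))
    · have : StronglyMeasurable fun y : α => ∫ z', g y z' ∂μ :=
        hg.stronglyMeasurable.integral_prod_right
      exact this.measurable.comp measurable_fst
  -- The centre `ξ i` is split off as one factor of the product measure. The diagonal term vanishes,
  -- so for a fixed centre the sum runs over `N` independent points.
  have hpre : {ξ : Fin (N + 1) → α | Q * b * k * δ <
      ∑ j, g (ξ i) (ξ j) - N * ∫ z, g (ξ i) z ∂μ} =
      MeasurableEquiv.piFinSuccAbove (fun _ => α) i ⁻¹' S := by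
    ext ξ
    simp only [Set.mem_preimage, hS, Set.mem_ofPred_eq, MeasurableEquiv.piFinSuccAbove]
    rw [Fin.sum_univ_succAbove _ i, hg0, zero_add]
    rfl
  rw [hpre, measureReal_def,
    (measurePreserving_piFinSuccAbove (fun _ => μ) i).measure_preimage_equiv,
    Measure.prod_apply hSm]
  refine ENNReal.toReal_le_of_le_ofReal (Real.exp_pos _).le ?_
  calc _ ≤ ∫⁻ _, ENNReal.ofReal (Real.exp (-(k * δ ^ 2 / 4))) ∂μ := by
        refine lintegral_mono fun y => ?_
        rw [← ENNReal.ofReal_toReal (measure_ne_top _ (Prod.mk y ⁻¹' S))]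
        apply ENNReal.ofReal_le_ofReal
        exact measure_pi_lt_sum_sub_le (hg.comp (measurable_const.prodMk measurable_id))
          (measurable_prodMk_left hA) (hgb y) (fun z hz => hgA y z hz) hk hQ hδ0 hδ1 (hN y)
    _ = _ := by simp

end Deviation

end SNN

/-! ### The abstract setting: two distances and masses of balls -/

namespace SNN

open Filter Topology Metric

/-- Two comparable distances `e ≤ D` on a probability space, such that the closed ball of radius
`s` centred at `x` has measure `(s / σ x) ^ m` up to a factor `1 + O(s ^ 2)`. -/
structure BallGeometry {M : Type*} [MeasurableSpace M] (m : ℕ) (μ : Measure M)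
    (e D : M → M → ℝ) (σ : M → ℝ) (K A r : ℝ) : Prop where
  m_ne_zero : m ≠ 0
  one_le : 1 ≤ K
  one_le' : 1 ≤ A
  r_pos : 0 < r
  e_nonneg : ∀ x y, 0 ≤ e x y
  e_self : ∀ x, e x x = 0
  e_le : ∀ x y, e x y ≤ D x y
  D_le : ∀ x y, e x y ≤ r → D x y ≤ e x y + K * e x y ^ 3
  D_comm : ∀ x y, D x y = D y x
  D_triangle : ∀ x y z, D x z ≤ D x y + D y z
  measurable_e : Measurable fun z : M × M => e z.1 z.2
  measurable_D : Measurable fun z : M × M => D z.1 z.2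
  measurable_σ : Measurable σ
  le_σ : ∀ x, A⁻¹ ≤ σ x
  σ_le : ∀ x, σ x ≤ A
  ball_le : ∀ x s, 0 ≤ s → s ≤ r → μ.real {y | e x y ≤ s} ≤ (1 + K * s ^ 2) * (s / σ x) ^ m
  le_ball : ∀ x s, 0 ≤ s → s ≤ r → (1 - K * s ^ 2) * (s / σ x) ^ m ≤ μ.real {y | e x y ≤ s}

namespace BallGeometry

variable {M : Type*} [MeasurableSpace M] {m : ℕ} {μ : Measure M}
  {e D : M → M → ℝ} {σ : M → ℝ} {K A r : ℝ}

theorem σ_pos (B : BallGeometry m μ e D σ K A r) (x : M) : 0 < σ x :=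
  (inv_pos.2 (zero_lt_one.trans_le B.one_le')).trans_le (B.le_σ x)

theorem measurable_e_right (B : BallGeometry m μ e D σ K A r) (x : M) : Measurable (e x) :=
  B.measurable_e.comp measurable_prodMk_left

theorem measurable_D_right (B : BallGeometry m μ e D σ K A r) (x : M) : Measurable (D x) :=
  B.measurable_D.comp measurable_prodMk_left

theorem scaled_le (B : BallGeometry m μ e D σ K A r) (x : M) {h v : ℝ} (h0 : 0 ≤ h) (hv0 : 0 ≤ v)
    (hv : v ≤ 2) : K * (h * σ x * v) ^ 2 ≤ 4 * K * A ^ 2 * h ^ 2 := by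
  have h1 : h * σ x * v ≤ h * A * 2 := by
    have := B.σ_le x
    have := B.σ_pos x
    have := zero_lt_one.trans_le B.one_le'
    gcongr
  have h2 : 0 ≤ h * σ x * v := by have := B.σ_pos x; positivity
  have := B.one_le
  calc K * (h * σ x * v) ^ 2 ≤ K * (h * A * 2) ^ 2 := by gcongr
    _ = _ := by ring

theorem le_real_ball (B : BallGeometry m μ e D σ K A r) (x : M) {h v : ℝ} (h0 : 0 ≤ h)
    (hr : 2 * A * h ≤ r) (hv0 : 0 ≤ v) (hv : v ≤ 2) :
    (1 - 4 * K * A ^ 2 * h ^ 2) * (h ^ m * v ^ m) ≤ μ.real {y | e x y ≤ h * σ x * v} := by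
  have hσ := B.σ_pos x
  have h1 : h * σ x * v ≤ r := by
    have := B.σ_le x
    have := zero_lt_one.trans_le B.one_le'
    calc h * σ x * v ≤ h * A * 2 := by gcongr
      _ ≤ r := by linarith
  refine le_trans ?_ (B.le_ball x _ (by positivity) h1)
  rw [show h * σ x * v / σ x = h * v by field_simp, mul_pow h v m]
  refine mul_le_mul_of_nonneg_right ?_ (by positivity)
  linarith [B.scaled_le x h0 hv0 hv]

theorem real_ball_le (B : BallGeometry m μ e D σ K A r) (x : M) {h v : ℝ} (h0 : 0 ≤ h)
    (hr : 2 * A * h ≤ r) (hv0 : 0 ≤ v) (hv : v ≤ 2) :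
    μ.real {y | e x y ≤ h * σ x * v} ≤ (1 + 4 * K * A ^ 2 * h ^ 2) * (h ^ m * v ^ m) := by
  have hσ := B.σ_pos x
  have h1 : h * σ x * v ≤ r := by
    have := B.σ_le x
    have := zero_lt_one.trans_le B.one_le'
    calc h * σ x * v ≤ h * A * 2 := by gcongr
      _ ≤ r := by linarith
  refine (B.ball_le x _ (by positivity) h1).trans ?_
  rw [show h * σ x * v / σ x = h * v by field_simp, mul_pow h v m]
  refine mul_le_mul_of_nonneg_right ?_ (by positivity)
  linarith [B.scaled_le x h0 hv0 hv]

theorem le_real_ball_one_add (B : BallGeometry m μ e D σ K A r) (x : M) {h u : ℝ} (h0 : 0 ≤ h)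
    (hr : 2 * A * h ≤ r) (hK : 4 * K * A ^ 2 * h ^ 2 ≤ 1) (hu0 : 0 ≤ u) (hu : u ≤ 1) :
    h ^ m * (1 + u - 8 * K * A ^ 2 * h ^ 2) ≤ μ.real {y | e x y ≤ h * σ x * (1 + u)} := by
  refine le_trans ?_ (B.le_real_ball x h0 hr (by linarith : 0 ≤ 1 + u) (by linarith))
  have h1 : 1 + u ≤ (1 + u) ^ m := le_self_pow₀ (by linarith) B.m_ne_zero
  have hc : 0 ≤ 4 * K * A ^ 2 * h ^ 2 := by have := B.one_le; positivity
  calc h ^ m * (1 + u - 8 * K * A ^ 2 * h ^ 2)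
      ≤ h ^ m * ((1 - 4 * K * A ^ 2 * h ^ 2) * (1 + u)) := by gcongr; nlinarith
    _ = (1 - 4 * K * A ^ 2 * h ^ 2) * (h ^ m * (1 + u)) := by ring
    _ ≤ _ := by gcongr

theorem real_ball_one_sub_le (B : BallGeometry m μ e D σ K A r) (x : M) {h u : ℝ} (h0 : 0 ≤ h)
    (hr : 2 * A * h ≤ r) (hu0 : 0 ≤ u) (hu : u ≤ 1) :
    μ.real {y | e x y ≤ h * σ x * (1 - u)} ≤ h ^ m * (1 - u + 4 * K * A ^ 2 * h ^ 2) := by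
  refine (B.real_ball_le x h0 hr (by linarith : 0 ≤ 1 - u) (by linarith)).trans ?_
  have h1 : (1 - u) ^ m ≤ 1 - u := pow_le_of_le_one (by linarith) (by linarith) B.m_ne_zero
  have hc : 0 ≤ 4 * K * A ^ 2 * h ^ 2 := by have := B.one_le; positivity
  calc _ ≤ (1 + 4 * K * A ^ 2 * h ^ 2) * (h ^ m * (1 - u)) := by gcongr
    _ = h ^ m * ((1 + 4 * K * A ^ 2 * h ^ 2) * (1 - u)) := by ring
    _ ≤ _ := by gcongr; nlinarith

variable [IsProbabilityMeasure μ]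

/-- The measure of a thin geodesic annulus. -/
theorem exists_real_annulus_le (B : BallGeometry m μ e D σ K A r) : ∃ C, 0 ≤ C ∧ ∀ x h u, 0 ≤ h →
    2 * A * h ≤ r → 4 * K * A ^ 2 * h ^ 2 ≤ 1 → 0 ≤ u → u ≤ 1 →
    μ.real ({y | D x y ≤ h * σ x * (1 + u)} \ {y | D x y ≤ h * σ x * (1 - u)}) ≤
      C * h ^ m * (u + h ^ 2) := by
  obtain ⟨C, hC, hpow⟩ := exists_one_add_mul_pow_le zero_le_one m
  set c := 4 * K * A ^ 2 with hc
  have hc0 : 0 ≤ c := by have := B.one_le; positivity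
  refine ⟨C + c + C * c + m + m * c + c, by positivity, fun x h u h0 hr hK hu0 hu => ?_⟩
  have hσ := B.σ_pos x
  set s := h * σ x * (1 - u) with hs
  have hs0 : 0 ≤ s := mul_nonneg (by positivity) (by linarith)
  have hKs : K * s ^ 2 ≤ c * h ^ 2 := B.scaled_le x h0 (by linarith) (by linarith)
  have hKs0 : 0 ≤ K * s ^ 2 := by have := B.one_le; positivity
  have hsr : s ≤ r := by
    have := B.σ_le x
    have := zero_lt_one.trans_le B.one_le'
    calc h * σ x * (1 - u) ≤ h * A * 2 := by gcongr; linarith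
      _ ≤ r := by linarith
  -- Shrunk so that `e ≤ h * σ x * v` implies `D ≤ s`, because `s (1 - K s²) + K s³ = s`. The
  -- geodesic annulus then lies in an annulus for `e`, where masses are known.
  set v := (1 - u) * (1 - K * s ^ 2) with hv
  have hv0 : 0 ≤ v := mul_nonneg (by linarith) (by linarith)
  have hv1 : v ≤ 1 := by nlinarith
  have hlow := B.le_real_ball x h0 hr hv0 (by linarith)
  have hup := B.real_ball_le x h0 hr (by linarith : 0 ≤ 1 + u) (by linarith)
  have hss : h * σ x * v = s * (1 - K * s ^ 2) := by rw [hv, hs]; ring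
  have hsub : {y | D x y ≤ h * σ x * (1 + u)} \ {y | D x y ≤ s} ⊆
      {y | e x y ≤ h * σ x * (1 + u)} \ {y | e x y ≤ h * σ x * v} := by
    intro y hy
    simp only [Set.mem_sdiff, Set.mem_ofPred_eq] at hy ⊢
    refine ⟨(B.e_le x y).trans hy.1, fun h1 => hy.2 ?_⟩
    rw [hss] at h1
    have h2 : e x y ≤ s := h1.trans (mul_le_of_le_one_right hs0 (by linarith))
    have h3 := B.D_le x y (h2.trans hsr)
    have h4 : K * e x y ^ 3 ≤ K * s ^ 3 := by
      have := B.one_le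
      have := B.e_nonneg x y
      gcongr
    calc D x y ≤ s * (1 - K * s ^ 2) + K * s ^ 3 := by linarith
      _ = s := by ring
  have hsub' : {y | e x y ≤ h * σ x * v} ⊆ {y | e x y ≤ h * σ x * (1 + u)} := by
    intro y hy
    simp only [Set.mem_ofPred_eq] at hy ⊢
    refine hy.trans ?_
    gcongr
    linarith
  have hmeas : MeasurableSet {y | e x y ≤ h * σ x * v} :=
    measurableSet_le (B.measurable_e_right x) measurable_const
  have h1 : 1 - m * (u + c * h ^ 2) ≤ v ^ m := by
    have h2 : 1 - (u + c * h ^ 2) ≤ v := by nlinarith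
    have h3 := one_add_mul_le_pow (a := v - 1) (by linarith) m
    rw [add_sub_cancel] at h3
    have : (m : ℝ) * -(u + c * h ^ 2) ≤ m * (v - 1) := by gcongr; linarith
    linarith
  have h2 : (1 + u) ^ m ≤ 1 + C * u := by simpa using hpow u hu0 hu
  have hv1m : v ^ m ≤ 1 := pow_le_one₀ hv0 hv1
  calc _ ≤ μ.real ({y | e x y ≤ h * σ x * (1 + u)} \ {y | e x y ≤ h * σ x * v}) :=
        measureReal_mono hsub
    _ = μ.real {y | e x y ≤ h * σ x * (1 + u)} - μ.real {y | e x y ≤ h * σ x * v} :=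
        measureReal_sdiff hsub' hmeas
    _ ≤ (1 + c * h ^ 2) * (h ^ m * (1 + u) ^ m) - (1 - c * h ^ 2) * (h ^ m * v ^ m) := by
        gcongr
    _ = h ^ m * ((1 + c * h ^ 2) * (1 + u) ^ m - (1 - c * h ^ 2) * v ^ m) := by ring
    _ ≤ h ^ m * ((C + c + C * c + m + m * c + c) * (u + h ^ 2)) := by
        have hh : 0 ≤ c * h ^ 2 := by positivity
        have e1 : (1 + c * h ^ 2) * (1 + u) ^ m ≤ (1 + c * h ^ 2) * (1 + C * u) := by gcongr
        have e2 : c * h ^ 2 * v ^ m ≤ c * h ^ 2 := mul_le_of_le_one_right hh hv1m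
        have e3 : C * u * (c * h ^ 2) ≤ C * 1 * (c * h ^ 2) := by gcongr
        have e4 : 0 ≤ (c + C * c + m * c + c) * u + (C + m) * h ^ 2 := by positivity
        gcongr
        linarith
    _ = _ := by ring

end BallGeometry

end SNN

/-! ### Counting sample points, and masses of intersections of balls -/

namespace SNN

open Filter Topology Metric

section Count

variable {α : Type*} [MeasurableSpace α] {μ : Measure α} [IsProbabilityMeasure μ]

theorem sum_indicator_eq_ncard {n : ℕ} (ξ : Fin n → α) (A : Set α) :
    ∑ j, A.indicator (fun _ => (1 : ℝ)) (ξ j) = (Set.ncard {j | ξ j ∈ A} : ℝ) := by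
  classical
  rw [Set.ncard_eq_toFinset_card']
  simp [Set.indicator_apply, Finset.sum_boole]

theorem abs_indicator_one_le (A : Set α) (z : α) : |A.indicator (fun _ => (1 : ℝ)) z| ≤ 1 := by
  by_cases h : z ∈ A <;> simp [h]

variable {n : ℕ} {k Q δ t : ℝ}

theorem measure_pi_ncard_lt_le {A : Set α} (hA : MeasurableSet A) (hk : 0 ≤ k) (hQ : 1 ≤ Q)
    (hδ0 : 0 ≤ δ) (hδ1 : δ ≤ 1) (hN : n * μ.real A ≤ Q * k) (ht : t + Q * k * δ ≤ n * μ.real A) :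
    (Measure.pi fun _ : Fin n => μ).real {ξ | (Set.ncard {j | ξ j ∈ A} : ℝ) < t} ≤
      Real.exp (-(k * δ ^ 2 / 4)) := by
  refine (measureReal_mono ?_).trans (measure_pi_lt_sum_sub_le (μ := μ) (N := n)
    (g := fun z => -A.indicator (fun _ => (1 : ℝ)) z) (measurable_const.indicator hA).neg hA (b := 1)
    (fun z => by rw [abs_neg]; exact abs_indicator_one_le A z) (fun z hz => by simp [hz])
    hk hQ hδ0 hδ1 hN)
  intro ξ hξ
  simp only [Set.mem_ofPred_eq, Finset.sum_neg_distrib, sum_indicator_eq_ncard, integral_neg,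
    integral_indicator_const _ hA, smul_eq_mul, mul_one] at hξ ⊢
  linarith

theorem measure_pi_le_ncard_le {A : Set α} (hA : MeasurableSet A) (hk : 0 ≤ k) (hQ : 1 ≤ Q)
    (hδ0 : 0 ≤ δ) (hδ1 : δ ≤ 1) (hN : n * μ.real A ≤ Q * k) (ht : n * μ.real A + Q * k * δ < t) :
    (Measure.pi fun _ : Fin n => μ).real {ξ | t ≤ (Set.ncard {j | ξ j ∈ A} : ℝ)} ≤
      Real.exp (-(k * δ ^ 2 / 4)) := by
  refine (measureReal_mono ?_).trans (measure_pi_lt_sum_sub_le (μ := μ) (N := n)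
    (g := A.indicator fun _ => (1 : ℝ)) (measurable_const.indicator hA) hA (b := 1)
    (abs_indicator_one_le A) (fun z hz => by simp [hz]) hk hQ hδ0 hδ1 hN)
  intro ξ hξ
  simp only [Set.mem_ofPred_eq, sum_indicator_eq_ncard,
    integral_indicator_const _ hA, smul_eq_mul, mul_one] at hξ ⊢
  linarith

theorem indicator_prodMk (S : Set (α × α)) (y z : α) :
    S.indicator (fun _ => (1 : ℝ)) (y, z) =
      (Prod.mk y ⁻¹' S).indicator (fun _ => (1 : ℝ)) z := rfl

theorem measure_pi_ncard_kernel_lt_le {S : Set (α × α)} (hS : MeasurableSet S)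
    (hS0 : ∀ y, (y, y) ∉ S) {l : ℕ} (hk : 0 ≤ k) (hQ : 1 ≤ Q)
    (hδ0 : 0 ≤ δ) (hδ1 : δ ≤ 1) (hN : ∀ y, n * μ.real (Prod.mk y ⁻¹' S) ≤ Q * k)
    (ht : ∀ y, l + Q * k * δ < n * μ.real (Prod.mk y ⁻¹' S)) (i : Fin n) :
    (Measure.pi fun _ : Fin n => μ).real {ξ | Set.ncard {j | (ξ i, ξ j) ∈ S} < l} ≤
      Real.exp (-(k * δ ^ 2 / 4)) := by
  obtain ⟨N, rfl⟩ : ∃ N, n = N + 1 := ⟨n - 1, by have := i.pos; omega⟩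
  push_cast at hN ht
  have hSy : ∀ y, MeasurableSet (Prod.mk y ⁻¹' S) := fun y => measurable_prodMk_left hS
  refine (measureReal_mono ?_).trans (measure_pi_lt_sum_sub_kernel_le (μ := μ) (N := N)
    (g := fun y z => -S.indicator (fun _ => (1 : ℝ)) (y, z)) (measurable_const.indicator hS).neg
    (fun y => by simp [hS0 y]) hS (b := 1)
    (fun y z => by rw [abs_neg]; exact abs_indicator_one_le S (y, z)) (fun y z hz => by simp [hz])
    hk hQ hδ0 hδ1 (fun y => le_trans (by gcongr; linarith) (hN y)) i)
  intro ξ hξ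
  simp only [Set.mem_ofPred_eq] at hξ ⊢
  simp only [indicator_prodMk, Finset.sum_neg_distrib, sum_indicator_eq_ncard, integral_neg,
    integral_indicator_const _ (hSy _), smul_eq_mul, mul_one]
  -- Only `N = n - 1` points are random once the centre is fixed. The missing expected count is at
  -- most one and is made up by integrality.
  have h1 : (Set.ncard {j | (ξ i, ξ j) ∈ S} : ℝ) + 1 ≤ l := by exact_mod_cast hξ
  have h2 : μ.real (Prod.mk (ξ i) ⁻¹' S) ≤ 1 := measureReal_le_one
  have h3 := ht (ξ i)
  have h4 : {j | ξ j ∈ Prod.mk (ξ i) ⁻¹' S} = {j | (ξ i, ξ j) ∈ S} := rfl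
  rw [h4]
  linarith

theorem measure_pi_le_ncard_kernel_le {S : Set (α × α)} (hS : MeasurableSet S)
    (hS0 : ∀ y, (y, y) ∉ S) {l : ℕ} (hk : 0 ≤ k) (hQ : 1 ≤ Q)
    (hδ0 : 0 ≤ δ) (hδ1 : δ ≤ 1) (hN : ∀ y, n * μ.real (Prod.mk y ⁻¹' S) ≤ Q * k)
    (ht : ∀ y, n * μ.real (Prod.mk y ⁻¹' S) + Q * k * δ < l) (i : Fin n) :
    (Measure.pi fun _ : Fin n => μ).real {ξ | l ≤ Set.ncard {j | (ξ i, ξ j) ∈ S}} ≤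
      Real.exp (-(k * δ ^ 2 / 4)) := by
  obtain ⟨N, rfl⟩ : ∃ N, n = N + 1 := ⟨n - 1, by have := i.pos; omega⟩
  push_cast at hN ht
  have hSy : ∀ y, MeasurableSet (Prod.mk y ⁻¹' S) := fun y => measurable_prodMk_left hS
  refine (measureReal_mono ?_).trans (measure_pi_lt_sum_sub_kernel_le (μ := μ) (N := N)
    (g := fun y z => S.indicator (fun _ => (1 : ℝ)) (y, z)) (measurable_const.indicator hS)
    (fun y => by simp [hS0 y]) hS (b := 1)
    (fun y z => abs_indicator_one_le S (y, z)) (fun y z hz => by simp [hz])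
    hk hQ hδ0 hδ1 (fun y => le_trans (by gcongr; linarith) (hN y)) i)
  intro ξ hξ
  simp only [Set.mem_ofPred_eq] at hξ ⊢
  simp only [indicator_prodMk, sum_indicator_eq_ncard,
    integral_indicator_const _ (hSy _), smul_eq_mul, mul_one]
  have h1 : (l : ℝ) ≤ (Set.ncard {j | (ξ i, ξ j) ∈ S} : ℝ) := by exact_mod_cast hξ
  have h2 : 0 ≤ μ.real (Prod.mk (ξ i) ⁻¹' S) := measureReal_nonneg
  have h3 := ht (ξ i)
  have h4 : {j | ξ j ∈ Prod.mk (ξ i) ⁻¹' S} = {j | (ξ i, ξ j) ∈ S} := rfl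
  rw [h4]
  linarith

end Count

/-- The mass of the intersection of the balls of radii `ρ x` and `ρ y` centred at `x` and `y`. -/
noncomputable def interMass {M : Type*} [MeasurableSpace M] (μ : Measure M) (D : M → M → ℝ)
    (ρ : M → ℝ) (x y : M) : ℝ :=
  μ.real ({z | D x z ≤ ρ x} ∩ {z | D y z ≤ ρ y})

namespace BallGeometry

variable {M : Type*} [MeasurableSpace M] {m : ℕ} {μ : Measure M}
  {e D : M → M → ℝ} {σ : M → ℝ} {K A r : ℝ} [IsProbabilityMeasure μ]

theorem interMass_nonneg (ρ : M → ℝ) (x y : M) : 0 ≤ interMass μ D ρ x y := measureReal_nonneg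

theorem interMass_le_one (ρ : M → ℝ) (x y : M) : interMass μ D ρ x y ≤ 1 := measureReal_le_one

theorem interMass_eq_zero (B : BallGeometry m μ e D σ K A r) {ρ : M → ℝ} {x y : M}
    (h : ρ x + ρ y < D x y) : interMass μ D ρ x y = 0 := by
  have : {z | D x z ≤ ρ x} ∩ {z | D y z ≤ ρ y} = ∅ := by
    ext z
    simp only [Set.mem_inter_iff, Set.mem_ofPred_eq, Set.mem_empty_iff_false, iff_false, not_and,
      not_le]
    intro h1
    have := B.D_triangle x z y
    rw [B.D_comm z y] at this
    linarith
  rw [interMass, this, measureReal_empty]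

theorem interMass_le (B : BallGeometry m μ e D σ K A r) (x y : M) {h : ℝ} (h0 : 0 ≤ h)
    (hr : 2 * A * h ≤ r) (hK : 4 * K * A ^ 2 * h ^ 2 ≤ 1) :
    interMass μ D (fun y => h * σ y) x y ≤ 2 * h ^ m := by
  have h1 := B.real_ball_le x h0 hr zero_le_one one_le_two
  rw [one_pow, mul_one, mul_one] at h1
  calc _ ≤ μ.real {z | e x z ≤ h * σ x} := by
        refine measureReal_mono fun z hz => ?_
        simp only [Set.mem_inter_iff, Set.mem_ofPred_eq] at hz ⊢
        exact (B.e_le x z).trans hz.1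
    _ ≤ _ := h1
    _ ≤ (1 + 1) * h ^ m := by gcongr
    _ = _ := by ring

theorem measurable_interMass (B : BallGeometry m μ e D σ K A r) {ρ : M → ℝ} (hρ : Measurable ρ)
    (x : M) : Measurable (interMass μ D ρ x) := by
  have hS : MeasurableSet {z : M × M | D x z.2 ≤ ρ x ∧ D z.1 z.2 ≤ ρ z.1} :=
    (measurableSet_le ((B.measurable_D_right x).comp measurable_snd) measurable_const).inter
      (measurableSet_le B.measurable_D (hρ.comp measurable_fst))
  exact (measurable_measure_prodMk_left (ν := μ) hS).ennreal_toReal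

/-- Stability of the mass of the intersection of two balls under a change of the radii. -/
theorem exists_abs_interMass_sub_le (B : BallGeometry m μ e D σ K A r) : ∃ C, 0 ≤ C ∧
    ∀ (ρ : M → ℝ) x y h u s, 0 ≤ h → 2 * A * h ≤ r → 4 * K * A ^ 2 * h ^ 2 ≤ 1 → 0 < h →
      0 < u → u ≤ 1 → h * σ x ≤ s → h * σ y ≤ s →
      h * σ x * (1 - u) ≤ ρ x → ρ x ≤ h * σ x * (1 + u) →
      h * σ y * (1 - u) ≤ ρ y → ρ y ≤ h * σ y * (1 + u) →
      |interMass μ D ρ x y - if D x y < 2 * s then interMass μ D (fun y => h * σ y) x y else 0| ≤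
        C * h ^ m * (u + h ^ 2) := by
  obtain ⟨C, hC, hann⟩ := B.exists_real_annulus_le
  refine ⟨3 * C, by positivity, fun ρ x y h u s h0 hr hK hh hu0 hu hxs hys hx1 hx2 hy1 hy2 => ?_⟩
  have ax := hann x h u h0 hr hK hu0.le hu
  have ay := hann y h u h0 hr hK hu0.le hu
  set X := {z | D x z ≤ h * σ x * (1 + u)} \ {z | D x z ≤ h * σ x * (1 - u)} with hX
  set Y := {z | D y z ≤ h * σ y * (1 + u)} \ {z | D y z ≤ h * σ y * (1 - u)} with hY
  have hσx := mul_pos hh (B.σ_pos x)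
  have hσy := mul_pos hh (B.σ_pos y)
  have hb : 0 ≤ C * h ^ m * (u + h ^ 2) := by positivity
  have key : ∀ ρ₁ ρ₂ : M → ℝ, ρ₁ x ≤ h * σ x * (1 + u) → h * σ x * (1 - u) ≤ ρ₂ x →
      ρ₁ y ≤ h * σ y * (1 + u) → h * σ y * (1 - u) ≤ ρ₂ y →
      interMass μ D ρ₁ x y ≤ interMass μ D ρ₂ x y + 2 * (C * h ^ m * (u + h ^ 2)) := by
    intro ρ₁ ρ₂ a1 a2 a3 a4
    -- A point lost when the radii change lies in one of the two thin annuli.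
    have hsub : {z | D x z ≤ ρ₁ x} ∩ {z | D y z ≤ ρ₁ y} ⊆
        ({z | D x z ≤ ρ₂ x} ∩ {z | D y z ≤ ρ₂ y}) ∪ (X ∪ Y) := by
      intro z hz
      simp only [hX, hY, Set.mem_inter_iff, Set.mem_union, Set.mem_sdiff, Set.mem_ofPred_eq,
        not_le] at hz ⊢
      rcases le_or_gt (D x z) (ρ₂ x) with h1 | h1
      · rcases le_or_gt (D y z) (ρ₂ y) with h2 | h2
        · exact Or.inl ⟨h1, h2⟩
        · exact Or.inr (Or.inr ⟨hz.2.trans a3, a4.trans_lt h2⟩)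
      · exact Or.inr (Or.inl ⟨hz.1.trans a1, a2.trans_lt h1⟩)
    have h1 := (measureReal_mono (μ := μ) hsub).trans (measureReal_union_le _ _)
    have h2 := measureReal_union_le (μ := μ) X Y
    simp only [interMass]
    linarith
  have k1 := key ρ (fun y => h * σ y) hx2 (by nlinarith) hy2 (by nlinarith)
  have k2 := key (fun y => h * σ y) ρ (by nlinarith) hx1 (by nlinarith) hy1
  split_ifs with hD
  · rw [abs_le]
    constructor <;> linarith
  -- Beyond the cutoff `2 s`, every common point lies at distance at least `h * σ x` from `x`, hence
  -- in the annulus about `x`. The cutoff therefore discards no more than the mass of an annulus.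
  · have hfar : interMass μ D (fun y => h * σ y) x y ≤ C * h ^ m * (u + h ^ 2) := by
      refine (measureReal_mono ?_).trans ax
      intro z hz
      simp only [hX, Set.mem_inter_iff, Set.mem_sdiff, Set.mem_ofPred_eq, not_le] at hz ⊢
      have h1 := B.D_triangle x z y
      rw [B.D_comm z y] at h1
      have h2 : h * σ x ≤ D x z := by linarith [not_lt.1 hD, hz.2]
      exact ⟨by nlinarith [hz.1], by nlinarith⟩
    rw [sub_zero, abs_of_nonneg (interMass_nonneg _ _ _)]
    linarith

/-- The contribution of the fluctuations of the radii to the nonlocal sum. -/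
theorem exists_abs_sum_interMass_sub_le (B : BallGeometry m μ e D σ K A r) : ∃ C, 0 ≤ C ∧
    ∀ (n : ℕ) (ξ : Fin n → M) (ρ : M → ℝ) x h u s (f : M → ℝ) (L : ℝ), 2 * A * h ≤ r →
      4 * K * A ^ 2 * h ^ 2 ≤ 1 → 0 < h → 0 < u → u ≤ 1 / 4 → (∀ y, h * σ y ≤ s) → s ≤ h * A →
      h * σ x * (1 - u) ≤ ρ x → ρ x ≤ h * σ x * (1 + u) →
      (∀ i, h * σ (ξ i) * (1 - u) ≤ ρ (ξ i)) → (∀ i, ρ (ξ i) ≤ h * σ (ξ i) * (1 + u)) →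
      0 ≤ L → (∀ y, D x y < 3 * s → |f x - f y| ≤ L * D x y) →
      |∑ i, interMass μ D ρ x (ξ i) * (f x - f (ξ i)) -
        ∑ i, (if D x (ξ i) < 2 * s then interMass μ D (fun y => h * σ y) x (ξ i) else 0) *
          (f x - f (ξ i))| ≤
        (Set.ncard {i | e x (ξ i) ≤ 3 * (h * A)} : ℝ) * (C * h ^ m * (u + h ^ 2) * (L * h)) := by
  classical
  obtain ⟨C, hC, hdiff⟩ := B.exists_abs_interMass_sub_le
  have hA := zero_lt_one.trans_le B.one_le'
  refine ⟨C * (3 * A), by positivity, ?_⟩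
  intro n ξ ρ x h u s f L hr hK hh hu0 hu hs hsA hx1 hx2 hy1 hy2 hL hf
  have hterm : ∀ i, |interMass μ D ρ x (ξ i) * (f x - f (ξ i)) -
      (if D x (ξ i) < 2 * s then interMass μ D (fun y => h * σ y) x (ξ i) else 0) *
          (f x - f (ξ i))| ≤
      {y | e x y ≤ 3 * (h * A)}.indicator (fun _ => (1 : ℝ)) (ξ i) *
        (C * (3 * A) * h ^ m * (u + h ^ 2) * (L * h)) := by
    intro i
    have hsx := hs x
    have hsy := hs (ξ i)
    have hσx := mul_pos hh (B.σ_pos x)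
    have hσy := mul_pos hh (B.σ_pos (ξ i))
    -- As `u ≤ 1/4`, both radii are at most `5/4 s`, so beyond `3 s` the balls are disjoint and both
    -- terms vanish.
    rcases lt_or_ge (D x (ξ i)) (3 * s) with hD | hD
    · have h1 : ξ i ∈ {y | e x y ≤ 3 * (h * A)} := by
        rw [Set.mem_ofPred_eq]
        linarith [B.e_le x (ξ i)]
      rw [Set.indicator_of_mem h1, one_mul, ← sub_mul, abs_mul]
      have h2 := hdiff ρ x (ξ i) h u s hh.le hr hK hh hu0 (by linarith) hsx hsy hx1 hx2
        (hy1 i) (hy2 i)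
      have h3 : |f x - f (ξ i)| ≤ L * (3 * (h * A)) := (hf _ hD).trans (by gcongr; linarith)
      calc _ ≤ (C * h ^ m * (u + h ^ 2)) * (L * (3 * (h * A))) := by gcongr
        _ = _ := by ring
    · have h1 : interMass μ D ρ x (ξ i) = 0 := by
        apply B.interMass_eq_zero
        have := hy2 i
        nlinarith
      rw [h1, if_neg (by linarith), sub_self, abs_zero]
      refine mul_nonneg (Set.indicator_nonneg (fun _ _ => zero_le_one) _) (by positivity)
  rw [← Finset.sum_sub_distrib]
  refine (Finset.abs_sum_le_sum_abs _ _).trans ((Finset.sum_le_sum fun i _ => hterm i).trans ?_)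
  rw [← Finset.sum_mul, sum_indicator_eq_ncard]
  exact le_of_eq rfl

end BallGeometry

end SNN

/-! ### Nearest neighbour radii and the two regimes -/

namespace SNN

open Filter Topology Metric

/-- `ρ` lies between every radius that captures fewer than `k` and every radius that captures at
least `k` of the points `ξ` other than the centre. -/
def IsKnnRadius {M : Type*} (e : M → M → ℝ) {n : ℕ} (ξ : Fin n → M) (k : ℕ) (ρ : M → ℝ) : Prop :=
  ∀ y r, 0 < r → k ≤ Set.ncard {j | 0 < e y (ξ j) ∧ e y (ξ j) ≤ r} → 0 < ρ y ∧ ρ y ≤ r ∧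
    ∀ r', Set.ncard {j | 0 < e y (ξ j) ∧ e y (ξ j) ≤ r'} < k → r' ≤ ρ y

namespace BallGeometry

variable {M : Type*} [MeasurableSpace M] {m : ℕ} {μ : Measure M}
  {e D : M → M → ℝ} {σ : M → ℝ} {K A r : ℝ} [IsProbabilityMeasure μ]

/-- The pairs of distinct points at distance at most `ρ` of the first one. -/
def nearPairs (e : M → M → ℝ) (ρ : M → ℝ) : Set (M × M) :=
  {z | 0 < e z.1 z.2 ∧ e z.1 z.2 ≤ ρ z.1}

theorem notMem_nearPairs (h : ∀ x, e x x = 0) (ρ : M → ℝ) (y : M) : (y, y) ∉ nearPairs e ρ := by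
  simp [nearPairs, h]

theorem measurableSet_nearPairs (B : BallGeometry m μ e D σ K A r) {ρ : M → ℝ}
    (hρ : Measurable ρ) : MeasurableSet (nearPairs e ρ) :=
  (measurableSet_lt measurable_const B.measurable_e).inter
    (measurableSet_le B.measurable_e (hρ.comp measurable_fst))

/-- Excluding the centre costs nothing, since `ball_le` with radius `0` shows that points have no
mass. -/
theorem real_nearPairs (B : BallGeometry m μ e D σ K A r) (ρ : M → ℝ) (y : M) :
    μ.real (Prod.mk y ⁻¹' nearPairs e ρ) = μ.real {z | e y z ≤ ρ y} := by
  have h0 : μ.real {z | e y z ≤ 0} = 0 := by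
    have := B.ball_le y 0 le_rfl B.r_pos.le
    simp only [zero_div, zero_pow B.m_ne_zero, mul_zero] at this
    exact le_antisymm this measureReal_nonneg
  apply le_antisymm
  · refine measureReal_mono fun z hz => ?_
    simp only [nearPairs, Set.mem_preimage, Set.mem_ofPred_eq] at hz ⊢
    exact hz.2
  · have hsub : {z | e y z ≤ ρ y} ⊆ Prod.mk y ⁻¹' nearPairs e ρ ∪ {z | e y z ≤ 0} := by
      intro z hz
      simp only [nearPairs, Set.mem_union, Set.mem_preimage, Set.mem_ofPred_eq] at hz ⊢
      rcases le_or_gt (e y z) 0 with h | h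
      · exact Or.inr h
      · exact Or.inl ⟨h, hz⟩
    have := (measureReal_mono (μ := μ) hsub).trans (measureReal_union_le _ _)
    linarith

theorem measureReal_union_iUnion_le {α : Type*} [MeasurableSpace α] {P : Measure α}
    [IsProbabilityMeasure P] {n : ℕ} {S : Set α} {T : Fin n → Set α} {E : ℝ}
    (hS : P.real S ≤ E) (hT : ∀ i, P.real (T i) ≤ E) :
    P.real (S ∪ ⋃ i, T i) ≤ (n + 1) * E := by
  have h1 := measureReal_union_le (μ := P) S (⋃ i, T i)
  have h2 := measureReal_iUnion_fintype_le (μ := P) T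
  have h3 := Finset.sum_le_sum (s := Finset.univ) fun i _ => hT i
  simp only [Finset.sum_const, Finset.card_univ, Fintype.card_fin, nsmul_eq_mul] at h3
  linarith

section Radii

variable {n k : ℕ} {Q δ : ℝ} {ρ : M → ℝ}

/-- The event that at `x` or at a sample point, radius `ρ` captures fewer than `k` points. -/
def fewNear (e : M → M → ℝ) (n k : ℕ) (ρ : M → ℝ) (x : M) : Set (Fin n → M) :=
  {ξ | Set.ncard {j | 0 < e x (ξ j) ∧ e x (ξ j) ≤ ρ x} < k} ∪
    ⋃ i, {ξ | Set.ncard {j | 0 < e (ξ i) (ξ j) ∧ e (ξ i) (ξ j) ≤ ρ (ξ i)} < k}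

/-- The event that at `x` or at a sample point, radius `ρ` captures at least `k` points. -/
def manyNear (e : M → M → ℝ) (n k : ℕ) (ρ : M → ℝ) (x : M) : Set (Fin n → M) :=
  {ξ | k ≤ Set.ncard {j | 0 < e x (ξ j) ∧ e x (ξ j) ≤ ρ x}} ∪
    ⋃ i, {ξ | k ≤ Set.ncard {j | 0 < e (ξ i) (ξ j) ∧ e (ξ i) (ξ j) ≤ ρ (ξ i)}}

theorem real_fewNear_le (B : BallGeometry m μ e D σ K A r) (hρ : Measurable ρ)
    (hQ : 1 ≤ Q) (hδ0 : 0 ≤ δ) (hδ1 : δ ≤ 1) (hN : ∀ y, n * μ.real {z | e y z ≤ ρ y} ≤ Q * k)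
    (ht : ∀ y, k + Q * k * δ < n * μ.real {z | e y z ≤ ρ y}) (x : M) :
    (Measure.pi fun _ : Fin n => μ).real (fewNear e n k ρ x) ≤
      (n + 1) * Real.exp (-(k * δ ^ 2 / 4)) := by
  have hS := B.measurableSet_nearPairs hρ
  simp_rw [← B.real_nearPairs] at hN ht
  refine measureReal_union_iUnion_le ?_ fun i => ?_
  · refine (measureReal_mono ?_).trans (measure_pi_ncard_lt_le (t := k)
      (measurable_prodMk_left hS (x := x)) k.cast_nonneg hQ hδ0 hδ1 (hN x) (ht x).le)
    intro ξ hξ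
    simp only [Set.mem_ofPred_eq, Nat.cast_lt] at hξ ⊢
    exact hξ
  · exact measure_pi_ncard_kernel_lt_le hS (notMem_nearPairs B.e_self ρ) k.cast_nonneg hQ hδ0 hδ1
      hN ht i

theorem real_manyNear_le (B : BallGeometry m μ e D σ K A r) (hρ : Measurable ρ)
    (hQ : 1 ≤ Q) (hδ0 : 0 ≤ δ) (hδ1 : δ ≤ 1) (hN : ∀ y, n * μ.real {z | e y z ≤ ρ y} ≤ Q * k)
    (ht : ∀ y, n * μ.real {z | e y z ≤ ρ y} + Q * k * δ < k) (x : M) :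
    (Measure.pi fun _ : Fin n => μ).real (manyNear e n k ρ x) ≤
      (n + 1) * Real.exp (-(k * δ ^ 2 / 4)) := by
  have hS := B.measurableSet_nearPairs hρ
  simp_rw [← B.real_nearPairs] at hN ht
  refine measureReal_union_iUnion_le ?_ fun i => ?_
  · refine (measureReal_mono ?_).trans (measure_pi_le_ncard_le (t := k)
      (measurable_prodMk_left hS (x := x)) k.cast_nonneg hQ hδ0 hδ1 (hN x) (ht x))
    intro ξ hξ
    simp only [Set.mem_ofPred_eq, Nat.cast_le] at hξ ⊢
    exact hξ
  · exact measure_pi_le_ncard_kernel_le hS (notMem_nearPairs B.e_self ρ) k.cast_nonneg hQ hδ0 hδ1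
      hN ht i

end Radii

/-- The integrand of the deterministic operator. -/
noncomputable def truncMass (μ : Measure M) (D : M → M → ℝ) (ρ : M → ℝ) (s : ℝ) (f : M → ℝ)
    (x y : M) : ℝ :=
  (if D x y < 2 * s then interMass μ D ρ x y else 0) * (f x - f y)

theorem measurable_truncMass (B : BallGeometry m μ e D σ K A r) {ρ : M → ℝ} (hρ : Measurable ρ)
    (s : ℝ) {f : M → ℝ} (hf : Measurable f) (x : M) : Measurable (truncMass μ D ρ s f x) :=
  (Measurable.ite (measurableSet_lt (B.measurable_D_right x) measurable_const)
    (B.measurable_interMass hρ x) measurable_const).mul (measurable_const.sub hf)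

theorem abs_truncMass_le {ρ : M → ℝ} {s b L : ℝ} {f : M → ℝ} {x y : M} (hs : 0 < s)
    (hL : 0 ≤ L) (hb : interMass μ D ρ x y ≤ b)
    (hf : ∀ y, D x y < 3 * s → |f x - f y| ≤ L * D x y) :
    |truncMass μ D ρ s f x y| ≤ b * (L * (2 * s)) := by
  have hI := interMass_nonneg (μ := μ) (D := D) ρ x y
  have hb0 := hI.trans hb
  rw [truncMass]
  split_ifs with h
  · rw [abs_mul, abs_of_nonneg hI]
    have h1 : |f x - f y| ≤ L * (2 * s) := (hf y (by linarith)).trans (by gcongr)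
    gcongr
  · rw [zero_mul, abs_zero]
    positivity

set_option maxHeartbeats 2000000 in
/-- The nonlocal operators of the sample and of the density are close, when the neighbourhoods
are small. -/
theorem exists_small_scale (B : BallGeometry m μ e D σ K A r) :
    ∃ C h₀ δ₀, 0 < C ∧ 0 < h₀ ∧ 0 < δ₀ ∧ δ₀ ≤ 1 ∧
      ∀ (n k : ℕ) (h : ℝ) (x : M) (f : M → ℝ) (L s δ : ℝ), 1 ≤ n → 0 < h →
        n * h ^ m = k → h ≤ h₀ → 0 < δ → h ^ 2 ≤ δ → δ ≤ δ₀ → (∀ y, h * σ y ≤ s) → s ≤ h * A →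
        0 ≤ L → Measurable f → (∀ y, D x y < 3 * s → |f x - f y| ≤ L * D x y) →
        ∃ Bad : Set (Fin n → M),
          (Measure.pi fun _ : Fin n => μ).real Bad ≤ 7 * n * Real.exp (-(k * δ ^ 2 / 4)) ∧
          ∀ ξ ∉ Bad, ∀ ρ, IsKnnRadius e ξ k ρ → (0 < ρ x ∧ ∀ i, 0 < ρ (ξ i)) ∧
            |∑ i, interMass μ D ρ x (ξ i) * (f x - f (ξ i)) -
              n * ∫ y, truncMass μ D (fun y => h * σ y) s f x y ∂μ| ≤
              C * (k * h ^ m * δ * (L * h)) := by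
  obtain ⟨C, hC, hsum⟩ := B.exists_abs_sum_interMass_sub_le
  have hA1 := B.one_le'
  have hA := zero_lt_one.trans_le hA1
  have hK1 := B.one_le
  have hK := zero_lt_one.trans_le hK1
  have hr := B.r_pos
  set Q : ℝ := 2 * 2 ^ m with hQ
  have hQ1 : 1 ≤ Q := by
    have : (1 : ℝ) ≤ 2 ^ m := one_le_pow₀ one_le_two
    linarith
  set c := 8 * K * A ^ 2 with hc
  have hc0 : 0 < c := by positivity
  -- Changing the radius by a factor `1 ± K' δ` moves the expected count past `k` by enough to cover
  -- the Bernstein deviation `Q k δ` and the curvature bias `c h² ≤ c δ`; the `1` leaves strict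
  -- room.
  set K' := Q + c + 1 with hK'
  have hK'1 : 1 ≤ K' := by linarith
  -- `Q₂ * k` bounds the expected number of sample points at distance at most `3 h A`, which is at
  -- most `3 A² h` in units of `σ x`.
  set Q₂ : ℝ := 2 * (3 * A ^ 2) ^ m with hQ₂
  have hQ₂1 : 1 ≤ Q₂ := by
    have : (1 : ℝ) ≤ (3 * A ^ 2) ^ m := one_le_pow₀ (by nlinarith)
    linarith
  refine ⟨3 * Q₂ * (C * (K' + 1)) + Q₂ * (4 * A), min (r / (3 * A)) (1 / (3 * A * K)),
    1 / (4 * K'), by positivity, by positivity, by positivity, ?_, ?_⟩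
  · rw [div_le_one (by positivity)]
    linarith
  intro n k h x f L s δ hn hh hnk hh0 hδ hhδ hδ₀ hs hsA hL hfm hf
  have hh1 : 3 * A * h ≤ r := by
    have := hh0.trans (min_le_left _ _)
    rw [le_div_iff₀ (by positivity)] at this
    linarith
  have hh2 : 3 * A * K * h ≤ 1 := by
    have := hh0.trans (min_le_right _ _)
    rw [le_div_iff₀ (by positivity)] at this
    linarith
  have hh3 : 2 * A * h ≤ r := by nlinarith
  have hKs : K * (3 * (h * A)) ^ 2 ≤ 1 := by
    have h1 : (3 * A * K * h) ^ 2 ≤ 1 := pow_le_one₀ (by positivity) hh2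
    have h2 : K * (3 * (h * A)) ^ 2 * 1 ≤ K * (3 * (h * A)) ^ 2 * K := by gcongr
    calc _ = K * (3 * (h * A)) ^ 2 * 1 := by ring
      _ ≤ _ := h2
      _ = (3 * A * K * h) ^ 2 := by ring
      _ ≤ 1 := h1
  have hK4 : 4 * K * A ^ 2 * h ^ 2 ≤ 1 := by
    have : 0 ≤ K * A ^ 2 * h ^ 2 := by positivity
    have e1 : K * (3 * (h * A)) ^ 2 = 9 * (K * A ^ 2 * h ^ 2) := by ring
    linarith
  set u := K' * δ with hu
  have hu0 : 0 < u := by positivity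
  have hu4 : u ≤ 1 / 4 := by
    rw [le_div_iff₀ (by positivity)] at hδ₀
    linarith
  have hδ1 : δ ≤ 1 := by nlinarith
  have hk0 : (0 : ℝ) < k := by rw [← hnk]; positivity
  have hn0 : (0 : ℝ) < n := by exact_mod_cast hn
  have hs0 : 0 < s := (mul_pos hh (B.σ_pos x)).trans_le (hs x)
  have hnQ : ∀ v, 0 ≤ v → v ≤ 2 → ∀ y, n * μ.real {z | e y z ≤ h * σ y * v} ≤ Q * k := by
    intro v hv0 hv y
    calc n * μ.real {z | e y z ≤ h * σ y * v}
        ≤ n * ((1 + 4 * K * A ^ 2 * h ^ 2) * (h ^ m * v ^ m)) := by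
          gcongr; exact B.real_ball_le y hh.le hh3 hv0 hv
      _ ≤ n * ((1 + 1) * (h ^ m * 2 ^ m)) := by gcongr
      _ = Q * (n * h ^ m) := by rw [hQ]; ring
      _ = Q * k := by rw [hnk]
  have hch : c * h ^ 2 ≤ c * δ := by gcongr
  have hρm : ∀ v : ℝ, Measurable fun y => h * σ y * v := fun v =>
    (B.measurable_σ.const_mul h).mul_const v
  have hfew := B.real_fewNear_le (n := n) (k := k) (hρm (1 + u)) hQ1 hδ.le hδ1
    (hnQ _ (by linarith) (by linarith)) (fun y => by
      calc k + Q * k * δ < k * (1 + u - c * h ^ 2) := by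
            have : 0 < k * (u - c * h ^ 2 - Q * δ) := mul_pos hk0 (by rw [hu, hK']; linarith)
            linarith
        _ = n * (h ^ m * (1 + u - c * h ^ 2)) := by rw [← hnk]; ring
        _ ≤ _ := by
            gcongr
            exact B.le_real_ball_one_add y hh.le hh3 hK4 hu0.le (by linarith)) x
  have hmany := B.real_manyNear_le (n := n) (k := k) (hρm (1 - u)) hQ1 hδ.le hδ1
    (hnQ _ (by linarith) (by linarith)) (fun y => by
      calc n * μ.real {z | e y z ≤ h * σ y * (1 - u)} + Q * k * δ
          ≤ n * (h ^ m * (1 - u + 4 * K * A ^ 2 * h ^ 2)) + Q * k * δ := by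
            gcongr
            exact B.real_ball_one_sub_le y hh.le hh3 hu0.le (by linarith)
        _ = k * (1 - u + 4 * K * A ^ 2 * h ^ 2 + Q * δ) := by rw [← hnk]; ring
        _ < k * 1 := by
            have : 0 ≤ 4 * K * A ^ 2 * h ^ 2 := by positivity
            have : 4 * K * A ^ 2 * h ^ 2 ≤ c * h ^ 2 := by rw [hc]; nlinarith
            gcongr
            rw [hu, hK']
            linarith
        _ = k := mul_one _) x
  have hA0 : MeasurableSet {y | e x y ≤ 3 * (h * A)} :=
    measurableSet_le (B.measurable_e_right x) measurable_const
  have hnA : n * μ.real {y | e x y ≤ 3 * (h * A)} ≤ Q₂ * k := by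
    have h1 := B.ball_le x (3 * (h * A)) (by positivity) (by linarith)
    have h2 : 3 * (h * A) / σ x ≤ 3 * A ^ 2 * h := by
      rw [div_le_iff₀ (B.σ_pos x)]
      have h3 : 1 ≤ A * σ x := by
        have := B.le_σ x
        rwa [inv_le_iff_one_le_mul₀ hA, mul_comm] at this
      nlinarith [mul_pos hh hA]
    have h0 : 0 ≤ 3 * (h * A) / σ x := by have := B.σ_pos x; positivity
    calc n * μ.real {y | e x y ≤ 3 * (h * A)} ≤ n * ((1 + 1) * (3 * A ^ 2 * h) ^ m) := by
          gcongr
          exact h1.trans (by gcongr)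
      _ = Q₂ * (n * h ^ m) := by rw [hQ₂, mul_pow]; ring
      _ = _ := by rw [hnk]
  have hcount := measure_pi_le_ncard_le (μ := μ) (n := n) (t := 3 * (Q₂ * k)) hA0 hk0.le hQ₂1 hδ.le
    hδ1 hnA (by nlinarith [mul_pos (zero_lt_one.trans_le hQ₂1) hk0])
  set g := truncMass μ D (fun y => h * σ y) s f x with hg
  have hgm : Measurable g := B.measurable_truncMass (B.measurable_σ.const_mul h) s hfm x
  have hgb : ∀ y, |g y| ≤ 2 * h ^ m * (L * (2 * (h * A))) := fun y =>
    (abs_truncMass_le hs0 hL (B.interMass_le x y hh.le hh3 hK4) hf).trans (by gcongr)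
  have hg0 : ∀ y ∉ {y | e x y ≤ 3 * (h * A)}, g y = 0 := by
    intro y hy
    rw [Set.mem_ofPred_eq, not_le] at hy
    have : ¬ D x y < 2 * s := by
      have := B.e_le x y
      nlinarith
    rw [hg, truncMass, if_neg this, zero_mul]
  have hG1 := measure_pi_lt_sum_sub_le (μ := μ) (N := n) hgm hA0 hgb hg0 hk0.le hQ₂1 hδ.le hδ1 hnA
  have hG2 := measure_pi_lt_sum_sub_le (μ := μ) (N := n) hgm.neg hA0
    (fun y => by rw [Pi.neg_apply, abs_neg]; exact hgb y)
    (fun y hy => by rw [Pi.neg_apply, hg0 y hy, neg_zero]) hk0.le hQ₂1 hδ.le hδ1 hnA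
  set P := Measure.pi fun _ : Fin n => μ with hP
  set E := Real.exp (-(k * δ ^ 2 / 4)) with hE
  set S₁ : Set (Fin n → M) := fewNear e n k (fun y => h * σ y * (1 + u)) x
  set S₂ : Set (Fin n → M) := manyNear e n k (fun y => h * σ y * (1 - u)) x
  set S₃ := {ξ : Fin n → M | 3 * (Q₂ * k) ≤
    (Set.ncard {j | ξ j ∈ {y | e x y ≤ 3 * (h * A)}} : ℝ)}
  set b := 2 * h ^ m * (L * (2 * (h * A)))
  set S₄ := {ξ : Fin n → M | Q₂ * b * k * δ < ∑ i, g (ξ i) - n * ∫ z, g z ∂μ}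
  set S₅ := {ξ : Fin n → M | Q₂ * b * k * δ < ∑ i, (-g) (ξ i) - n * ∫ z, (-g) z ∂μ}
  -- Radii too large, radii too small, too many neighbours, and the two-sided deviation of the sum
  -- with deterministic radii: `2 (n + 1) + 3 ≤ 7 n` exponentials.
  refine ⟨S₁ ∪ (S₂ ∪ (S₃ ∪ (S₄ ∪ S₅))), ?_, ?_⟩
  · have u1 := measureReal_union_le (μ := P) S₁ (S₂ ∪ (S₃ ∪ (S₄ ∪ S₅)))
    have u2 := measureReal_union_le (μ := P) S₂ (S₃ ∪ (S₄ ∪ S₅))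
    have u3 := measureReal_union_le (μ := P) S₃ (S₄ ∪ S₅)
    have u4 := measureReal_union_le (μ := P) S₄ S₅
    have hE0 : 0 < E := Real.exp_pos _
    have hn1 : (1 : ℝ) ≤ n := by exact_mod_cast hn
    nlinarith
  · intro ξ hξ ρ hρ
    simp only [Set.mem_union, not_or] at hξ
    obtain ⟨b1, b2, b3, b4, b5⟩ := hξ
    simp only [S₁, fewNear, Set.mem_union, Set.mem_iUnion, Set.mem_ofPred_eq, not_or, not_exists,
      not_lt] at b1
    simp only [S₂, manyNear, Set.mem_union, Set.mem_iUnion, Set.mem_ofPred_eq, not_or, not_exists,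
      not_le] at b2
    simp only [S₃, Set.mem_ofPred_eq, not_le] at b3
    simp only [S₄, Set.mem_ofPred_eq, not_lt] at b4
    simp only [S₅, Set.mem_ofPred_eq, not_lt, Pi.neg_apply, Finset.sum_neg_distrib,
      integral_neg] at b5
    have hpos : ∀ y, 0 < h * σ y * (1 + u) := fun y =>
      mul_pos (mul_pos hh (B.σ_pos y)) (by linarith)
    have hx := hρ x _ (hpos x) b1.1
    have hy := fun i => hρ (ξ i) _ (hpos _) (b1.2 i)
    have hmain := hsum n ξ ρ x h u s f L hh3 hK4 hh hu0 hu4 hs hsA (hx.2.2 _ b2.1) hx.2.1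
      (fun i => (hy i).2.2 _ (b2.2 i)) (fun i => (hy i).2.1) hL hf
    have hdev : |∑ i, g (ξ i) - n * ∫ y, g y ∂μ| ≤ Q₂ * b * k * δ := by
      rw [abs_le]
      constructor <;> linarith
    have hcn : (Set.ncard {i | e x (ξ i) ≤ 3 * (h * A)} : ℝ) ≤ 3 * (Q₂ * k) := b3.le
    have huδ : u + h ^ 2 ≤ (K' + 1) * δ := by rw [hu]; linarith
    refine ⟨⟨hx.1, fun i => (hy i).1⟩, ?_⟩
    calc _ ≤ |∑ i, interMass μ D ρ x (ξ i) * (f x - f (ξ i)) - ∑ i, g (ξ i)| +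
          |∑ i, g (ξ i) - n * ∫ y, g y ∂μ| := abs_sub_le _ _ _
      _ ≤ 3 * (Q₂ * k) * (C * h ^ m * ((K' + 1) * δ) * (L * h)) + Q₂ * b * k * δ := by
          refine add_le_add (hmain.trans ?_) hdev
          gcongr
      _ = _ := by simp only [b]; ring

/-- The crude comparison of the nonlocal operators of the sample and of the density. -/
theorem large_scale (B : BallGeometry m μ e D σ K A r) {κ : ℝ} (hκ0 : 0 < κ) (hκ1 : κ ≤ 1)
    {n k : ℕ} (hk : 1 ≤ k) (hn : 1 ≤ n) (hκ : κ * n ≤ k) {x : M} {f : M → ℝ} {L s : ℝ} (hs : 0 < s)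
    {ε : M → ℝ}
    (hball : ∀ y, 13 / 10 * k ≤ n * μ.real {z | e y z ≤ 6 / 5 * s}) (hL : 0 ≤ L)
    (hf : ∀ y, D x y < 3 * s → |f x - f y| ≤ L * D x y) :
    ∃ Bad : Set (Fin n → M),
      (Measure.pi fun _ : Fin n => μ).real Bad ≤
        2 * n * Real.exp (-(k * (κ / 5) ^ 2 / 4)) ∧
      ∀ ξ ∉ Bad, ∀ ρ, IsKnnRadius e ξ k ρ → (0 < ρ x ∧ ∀ i, 0 < ρ (ξ i)) ∧
        |∑ i, interMass μ D ρ x (ξ i) * (f x - f (ξ i)) -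
          n * ∫ y, truncMass μ D ε s f x y ∂μ| ≤ 5 * n * (L * s) := by
  have hk0 : (0 : ℝ) < k := by exact_mod_cast hk
  have hn1 : (1 : ℝ) ≤ n := by exact_mod_cast hn
  -- With `Q = 1/κ` the bound `n ≤ Q k` is trivially enough, and `δ = κ/5` makes the deviation
  -- `k/5`, so the threshold `6/5 k` lies below the expected `13/10 k`. Radii of at most `6/5 s`
  -- interact only within `12/5 s < 3 s`.
  have hfew := B.real_fewNear_le (n := n) (k := k) (ρ := fun _ => 6 / 5 * s) (Q := 1 / κ)
    (δ := κ / 5) measurable_const (by rw [le_div_iff₀ hκ0]; linarith) (by positivity)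
    (by linarith) (fun y => by
      have h1 : μ.real {z | e y z ≤ 6 / 5 * s} ≤ 1 := measureReal_le_one
      calc n * μ.real {z | e y z ≤ 6 / 5 * s} ≤ n * 1 := by gcongr
        _ ≤ 1 / κ * k := by rw [div_mul_eq_mul_div, le_div_iff₀ hκ0]; linarith) (fun y => by
      have e1 : k + 1 / κ * k * (κ / 5) = (6 / 5 : ℝ) * k := by field_simp; ring
      rw [e1]
      linarith [hball y]) x
  refine ⟨fewNear e n k (fun _ => 6 / 5 * s) x, hfew.trans ?_, fun ξ hξ ρ hρ => ?_⟩
  · gcongr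
    linarith
  simp only [fewNear, Set.mem_union, Set.mem_iUnion, Set.mem_ofPred_eq, not_or, not_exists,
    not_lt] at hξ
  have hx := hρ x _ (by positivity) hξ.1
  have hy := fun i => hρ (ξ i) _ (by positivity) (hξ.2 i)
  have h1 : |∑ i, interMass μ D ρ x (ξ i) * (f x - f (ξ i))| ≤ n * (L * (3 * s)) := by
    refine (Finset.abs_sum_le_sum_abs _ _).trans ?_
    have : ∀ i ∈ Finset.univ, |interMass μ D ρ x (ξ i) * (f x - f (ξ i))| ≤ L * (3 * s) := by
      intro i _
      rcases lt_or_ge (D x (ξ i)) (3 * s) with hD | hD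
      · rw [abs_mul, abs_of_nonneg (interMass_nonneg _ _ _)]
        have h2 : |f x - f (ξ i)| ≤ L * (3 * s) := (hf _ hD).trans (by gcongr)
        calc _ ≤ 1 * (L * (3 * s)) := by
              gcongr
              exact interMass_le_one _ _ _
          _ = _ := one_mul _
      · rw [B.interMass_eq_zero (by linarith [hx.2.1, (hy i).2.1]), zero_mul, abs_zero]
        positivity
    simpa using Finset.sum_le_sum this
  have h2 : |∫ y, truncMass μ D ε s f x y ∂μ| ≤ 1 * (L * (2 * s)) := by
    have h3 : ∀ y, ‖truncMass μ D ε s f x y‖ ≤ 1 * (L * (2 * s)) := fun y =>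
      abs_truncMass_le hs hL (interMass_le_one ε x y) hf
    have := norm_integral_le_of_norm_le_const (μ := μ) (ae_of_all μ h3)
    simpa using this
  refine ⟨⟨hx.1, fun i => (hy i).1⟩, ?_⟩
  calc _ ≤ |∑ i, interMass μ D ρ x (ξ i) * (f x - f (ξ i))| +
        |n * ∫ y, truncMass μ D ε s f x y ∂μ| := abs_sub _ _
    _ ≤ n * (L * (3 * s)) + n * (1 * (L * (2 * s))) := by
        rw [abs_mul, Nat.abs_cast]
        gcongr
    _ = _ := by ring

end BallGeometry

end SNN

/-! ### Translation of the operators into the abstract setting -/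

namespace SNN

open Filter Topology Metric

/-! ### Radii of nearest neighbours -/

section Knn

variable {d : ℕ} {M : Type*} {ι : M → EuclideanSpace ℝ (Fin d)} {n : ℕ} {ξ : Fin n → M}

theorem nbrCount_mono (x : M) {r r' : ℝ} (h : r ≤ r') : nbrCount ι ξ r x ≤ nbrCount ι ξ r' x :=
  Set.ncard_le_ncard (fun _ hi => ⟨hi.1, hi.2.trans h⟩) (Set.toFinite _)

/-- The admissible `r` rules out the infimum of the empty set. Positivity holds because, with `k ≥
1`, every admissible radius is at least the smallest of the finitely many positive distances. -/
theorem isKnnRadius_knnRadius (ξ : Fin n → M) {k : ℕ} (hk : 1 ≤ k) :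
    IsKnnRadius (fun y z => ‖ι z - ι y‖) ξ k (knnRadius ι ξ k) := by
  intro y r hr hkr
  simp_rw [← dist_eq_norm] at hkr ⊢
  set S := {r : ℝ | 0 < r ∧ k ≤ nbrCount ι ξ r y} with hS
  have hbdd : BddBelow S := ⟨0, fun _ h => h.1.le⟩
  have hrS : r ∈ S := ⟨hr, hkr⟩
  refine ⟨?_, csInf_le hbdd hrS, fun r' hr' => ?_⟩
  · obtain ⟨c, hc0, hc⟩ : ∃ c > 0, ∀ i, 0 < dist (ι (ξ i)) (ι y) → c ≤ dist (ι (ξ i)) (ι y) := by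
      rcases {i : Fin n | 0 < dist (ι (ξ i)) (ι y)}.eq_empty_or_nonempty with h | h
      · exact ⟨1, one_pos, fun i hi => absurd (h.subset hi) (Set.notMem_empty _)⟩
      · obtain ⟨i, hi, hmin⟩ := Set.exists_min_image _ (fun i => dist (ι (ξ i)) (ι y))
          (Set.toFinite _) h
        exact ⟨_, hi, hmin⟩
    refine hc0.trans_le (le_csInf ⟨r, hrS⟩ fun t ht => ?_)
    obtain ⟨i, hi⟩ : {i : Fin n | 0 < dist (ι (ξ i)) (ι y) ∧ dist (ι (ξ i)) (ι y) ≤ t}.Nonempty :=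
      Set.nonempty_of_ncard_ne_zero (by have := ht.2; rw [nbrCount] at this; omega)
    exact (hc i hi.1).trans hi.2
  · refine le_csInf ⟨r, hrS⟩ fun t ht => ?_
    by_contra! hlt
    have := nbrCount_mono (ι := ι) (ξ := ξ) y hlt.le
    have h2 := ht.2
    have h3 : nbrCount ι ξ r' y < k := hr'
    omega

end Knn

/-! ### The operators as integrals against the sampling measure -/

theorem eta_div {t ρ : ℝ} (ht : 0 ≤ t) (hρ : 0 < ρ) : eta (t / ρ) = if t ≤ ρ then 1 else 0 := by
  classical
  rw [eta, Set.indicator_apply]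
  have : t / ρ ∈ Set.Icc (0 : ℝ) 1 ↔ t ≤ ρ := by
    rw [Set.mem_Icc, div_le_one hρ]
    exact and_iff_right (by positivity)
  simp [this]

section Operators

variable {m d : ℕ} {M : Type*} [MeasurableSpace M] {ι : M → EuclideanSpace ℝ (Fin d)} {p : M → ℝ}

theorem integral_density (hp : Measurable p) (hp0 : ∀ x, 0 ≤ p x) (g : M → ℝ) :
    ∫ z, g z ∂((vol m ι).withDensity fun x => ENNReal.ofReal (p x)) = ∫ z, g z * p z ∂(vol m ι) := by
  rw [integral_withDensity_eq_integral_toReal_smul hp.ennreal_ofReal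
    (ae_of_all _ fun _ => ENNReal.ofReal_lt_top)]
  refine integral_congr_ae (ae_of_all _ fun z => ?_)
  simp only [smul_eq_mul, ENNReal.toReal_ofReal (hp0 z)]
  ring

/-- Positive radii are essential: division by zero would make `eta (t / 0) = eta 0 = 1`, an infinite
ball. -/
theorem weight_eq_interMass (hp : Measurable p) (hp0 : ∀ x, 0 ≤ p x)
    (hD : ∀ x, Measurable (geoDist ι x)) {ρ : M → ℝ} {x y : M} (hx : 0 < ρ x) (hy : 0 < ρ y) :
    weight m ι p ρ x y =
      interMass ((vol m ι).withDensity fun x => ENNReal.ofReal (p x)) (geoDist ι) ρ x y := by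
  have hS : MeasurableSet ({z | geoDist ι x z ≤ ρ x} ∩ {z | geoDist ι y z ≤ ρ y}) :=
    (measurableSet_le (hD x) measurable_const).inter (measurableSet_le (hD y) measurable_const)
  rw [interMass, ← mul_one (Measure.real _ _), ← smul_eq_mul, ← integral_indicator_const _ hS,
    integral_density hp hp0, weight]
  refine integral_congr_ae (ae_of_all _ fun z => ?_)
  simp only [eta_div (geoDist_nonneg x z) hx, eta_div (geoDist_nonneg y z) hy,
    Set.indicator_apply, Set.mem_inter_iff, Set.mem_ofPred_eq]
  by_cases h1 : geoDist ι x z ≤ ρ x <;> by_cases h2 : geoDist ι y z ≤ ρ y <;> simp [h1, h2]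

theorem L1_eq (hp : Measurable p) (hp0 : ∀ x, 0 ≤ p x) (hD : ∀ x, Measurable (geoDist ι x))
    {n k : ℕ} {ξ : Fin n → M} {f : M → ℝ} {x : M} (hx : 0 < knnRadius ι ξ k x)
    (hξ : ∀ i, 0 < knnRadius ι ξ k (ξ i)) :
    L1 m ι p k ξ f x = (ballVol m * n / k) ^ (1 + 2 / (m : ℝ)) / (2 ^ (m + 2) * k) *
      ∑ i, interMass ((vol m ι).withDensity fun x => ENNReal.ofReal (p x)) (geoDist ι)
        (knnRadius ι ξ k) x (ξ i) * (f x - f (ξ i)) := by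
  rw [L1]
  congr 1
  exact Finset.sum_congr rfl fun i _ => by rw [weight_eq_interMass hp hp0 hD hx (hξ i)]

/-- The extra power `α n / k` in the prefactor of `L2` supplies exactly the factor `n / k` that
makes the prefactor equal to that of `L1`. -/
theorem L2_eq (hp : Measurable p) (hp0 : ∀ x, 0 ≤ p x) (hD : ∀ x, Measurable (geoDist ι x))
    {n k : ℕ} (hn : 1 ≤ n) (hk : 1 ≤ k) {f : M → ℝ} {x : M} (hε : ∀ y, 0 < detRadius m p n k y) :
    L2 m ι p n k f x = (ballVol m * n / k) ^ (1 + 2 / (m : ℝ)) / (2 ^ (m + 2) * k) *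
      (n * ∫ y, BallGeometry.truncMass ((vol m ι).withDensity fun x => ENNReal.ofReal (p x))
        (geoDist ι) (detRadius m p n k) (maxRadius m p n k) f x y
          ∂((vol m ι).withDensity fun x => ENNReal.ofReal (p x))) := by
  have hS : MeasurableSet (geoBall ι x (2 * maxRadius m p n k)) :=
    measurableSet_lt (hD x) measurable_const
  rw [L2, integral_density hp hp0, ← integral_indicator hS]
  have hn0 : (0 : ℝ) < n := by exact_mod_cast hn
  have hk0 : (0 : ℝ) < k := by exact_mod_cast hk
  have hα := ballVol_pos m
  have hint : ∫ y, (geoBall ι x (2 * maxRadius m p n k)).indicator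
      (fun y => weight m ι p (detRadius m p n k) x y * (f x - f y) * p y) y ∂(vol m ι) =
      ∫ y, BallGeometry.truncMass ((vol m ι).withDensity fun x => ENNReal.ofReal (p x))
        (geoDist ι) (detRadius m p n k) (maxRadius m p n k) f x y * p y ∂(vol m ι) := by
    refine integral_congr_ae (ae_of_all _ fun y => ?_)
    simp only [Set.indicator_apply, geoBall, Set.mem_ofPred_eq, BallGeometry.truncMass,
      weight_eq_interMass hp hp0 hD (hε x) (hε y)]
    split_ifs <;> simp
  rw [hint, show (2 : ℝ) + 2 / m = 1 + 2 / m + 1 by ring,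
    Real.rpow_add_one (by positivity : ballVol m * n / k ≠ 0)]
  field_simp

end Operators

/-- The global Lipschitz constant bounds the quotients, so the supremum is not a default value. -/
theorem abs_sub_le_lipSeminorm {d : ℕ} {M : Type*} {ι : M → EuclideanSpace ℝ (Fin d)}
    (hD : ∀ y z, y ≠ z → 0 < geoDist ι y z) {f : M → ℝ} (hf : IsLip ι f) {B : Set M} {y z : M}
    (hy : y ∈ B) (hz : z ∈ B) : |f y - f z| ≤ lipSeminorm ι f B * geoDist ι y z := by
  rcases eq_or_ne y z with rfl | hyz
  · simp [geoDist_self]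
  obtain ⟨L, hL⟩ := hf
  rw [← div_le_iff₀ (hD y z hyz)]
  refine le_csSup ⟨L, ?_⟩ ⟨y, hy, z, hz, hyz, rfl⟩
  rintro q ⟨a, -, b, -, hab, rfl⟩
  rw [div_le_iff₀ (hD a b hab)]
  exact hL a b

theorem lipSeminorm_nonneg {d : ℕ} {M : Type*} (ι : M → EuclideanSpace ℝ (Fin d)) (f : M → ℝ)
    (B : Set M) : 0 ≤ lipSeminorm ι f B := by
  refine Real.sSup_nonneg ?_
  rintro q ⟨y, -, z, -, -, rfl⟩
  exact div_nonneg (abs_nonneg _) (geoDist_nonneg y z)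

/-! ### The deterministic radii -/

section Radii

variable {m : ℕ} {M : Type*} {p : M → ℝ}

/-- The radius of the ball of `ℝᵐ` whose mass for the constant density `p x` is `1`. -/
noncomputable def unitRadius (m : ℕ) (p : M → ℝ) (x : M) : ℝ :=
  (ballVol m * p x) ^ (-(1 / (m : ℝ)))

theorem unitRadius_pos (hp : ∀ x, 0 < p x) (x : M) : 0 < unitRadius m p x :=
  Real.rpow_pos_of_pos (mul_pos (ballVol_pos m) (hp x)) _

theorem unitRadius_pow (hm : m ≠ 0) (hp : ∀ x, 0 < p x) (x : M) :
    unitRadius m p x ^ m = (ballVol m * p x)⁻¹ := by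
  rw [unitRadius, Real.rpow_neg (mul_pos (ballVol_pos m) (hp x)).le, inv_pow, one_div,
    Real.rpow_inv_natCast_pow (mul_pos (ballVol_pos m) (hp x)).le hm]

theorem detRadius_eq (hp : ∀ x, 0 < p x) (n k : ℕ) (x : M) :
    detRadius m p n k x = ((k : ℝ) / n) ^ (1 / (m : ℝ)) * unitRadius m p x := by
  have h0 := mul_pos (ballVol_pos m) (hp x)
  rw [detRadius, unitRadius, Real.rpow_neg h0.le, ← Real.inv_rpow h0.le,
    ← Real.mul_rpow (by positivity) (by positivity)]
  congr 1
  rw [← div_eq_mul_inv, div_div, mul_assoc]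

theorem unitRadius_anti (hp : ∀ x, 0 < p x) {x y : M} (h : p x ≤ p y) :
    unitRadius m p y ≤ unitRadius m p x := by
  refine Real.rpow_le_rpow_of_nonpos (mul_pos (ballVol_pos m) (hp x)) ?_ (by simp)
  exact mul_le_mul_of_nonneg_left h (ballVol_pos m).le

end Radii

end SNN

/-! ### Assembly -/

namespace SNN

open Filter Topology Metric

section Final

variable {m d : ℕ} {M : Type*} [TopologicalSpace M] [CompactSpace M] [ConnectedSpace M]
  [MeasurableSpace M] [BorelSpace M] {ι : M → EuclideanSpace ℝ (Fin d)} {p : M → ℝ}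

theorem isProbabilityMeasure_density (hp0 : ∀ x, 0 ≤ p x) (hint : ∫ x, p x ∂(vol m ι) = 1) :
    IsProbabilityMeasure ((vol m ι).withDensity fun x => ENNReal.ofReal (p x)) := by
  have hi : Integrable p (vol m ι) := by
    by_contra h
    rw [integral_undef h] at hint
    exact zero_ne_one hint
  refine ⟨?_⟩
  rw [withDensity_apply _ MeasurableSet.univ, Measure.restrict_univ,
    ← ofReal_integral_eq_lintegral_ofReal hi (ae_of_all _ hp0), hint, ENNReal.ofReal_one]

theorem exists_ballGeometry (G : TangentData m ι p) (hm : m ≠ 0) (hι : Topology.IsEmbedding ι)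
    (hpc : Continuous p) (hpos : ∀ x, 0 < p x) (hint : ∫ x, p x ∂(vol m ι) = 1) :
    ∃ K A r, BallGeometry m ((vol m ι).withDensity fun x => ENNReal.ofReal (p x))
      (fun y z => ‖ι z - ι y‖) (geoDist ι) (unitRadius m p) K A r := by
  have hcont := hι.continuous
  have := hι.secondCountableTopology
  have hme : MeasurableEmbedding ι :=
    (hcont.isClosedEmbedding hι.injective).measurableEmbedding
  have hprob := isProbabilityMeasure_density (fun x => (hpos x).le) hint
  obtain ⟨x₀, -, hx₀⟩ := isCompact_univ.exists_isMinOn Set.univ_nonempty hpc.continuousOn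
  obtain ⟨x₁, -, hx₁⟩ := isCompact_univ.exists_isMaxOn Set.univ_nonempty hpc.continuousOn
  obtain ⟨C, r₁, hC, hr₁, hr₁1, hCr, hball⟩ := G.exists_measure_ball_bounds hme (hpos x₀)
    fun x => hx₀ (Set.mem_univ x)
  set μ := (vol m ι).withDensity fun x => ENNReal.ofReal (p x) with hμ
  have hσ := unitRadius_pos (m := m) hpos
  set A := max 1 (max (unitRadius m p x₀) (unitRadius m p x₁)⁻¹) with hA
  have hA1 : 1 ≤ A := le_max_left _ _
  have hA0 : 0 < A := zero_lt_one.trans_le hA1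
  set K := max C G.K with hK
  have hσm : ∀ x s, (s / unitRadius m p x) ^ m = p x * (ballVol m * s ^ m) := fun x s => by
    rw [div_pow, unitRadius_pow hm hpos, div_inv_eq_mul]
    ring
  have hpow : ∀ x s, 0 ≤ s → 0 ≤ (s / unitRadius m p x) ^ m := fun x s hs =>
    pow_nonneg (div_nonneg hs (hσ x).le) m
  have hGr := G.r_pos
  refine ⟨K, A, min r₁ (G.r / 2), ⟨hm, G.one_le.trans (le_max_right _ _), hA1,
    lt_min hr₁ (by positivity), fun _ _ => norm_nonneg _, fun x => by simp,
    G.norm_sub_le_geoDist hcont, fun x y hxy => ?_, geoDist_comm,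
    G.geoDist_triangle hcont, ?_, (G.continuous_geoDist hcont).measurable, ?_, fun x => ?_,
    fun x => ?_, fun x s hs hsr => ?_, fun x s hs hsr => ?_⟩⟩
  · refine (G.geoDist_le (lt_of_le_of_lt (hxy.trans (min_le_right _ _)) (by linarith))).trans ?_
    gcongr
    exact le_max_right _ _
  · exact (Continuous.measurable (by fun_prop : Continuous fun z : M × M => ‖ι z.2 - ι z.1‖))
  · have : Measurable p := hpc.measurable
    unfold unitRadius
    fun_prop
  · rw [inv_le_comm₀ hA0 (hσ x)]
    refine le_trans ?_ ((le_max_right _ _).trans (le_max_right _ _))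
    exact inv_anti₀ (hσ x₁) (unitRadius_anti hpos (hx₁ (Set.mem_univ x)))
  · exact (unitRadius_anti hpos (hx₀ (Set.mem_univ x))).trans
      ((le_max_left _ _).trans (le_max_right _ _))
  · have h1 := (hball x s hs (hsr.trans (min_le_left _ _))).2
    rw [← hσm] at h1
    have h2 : 0 ≤ (1 + C * s ^ 2) * (s / unitRadius m p x) ^ m :=
      mul_nonneg (by positivity) (hpow x s hs)
    refine (ENNReal.toReal_le_of_le_ofReal h2 h1).trans ?_
    refine mul_le_mul_of_nonneg_right ?_ (hpow x s hs)
    gcongr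
    exact le_max_left _ _
  · have h1 := (hball x s hs (hsr.trans (min_le_left _ _))).1
    rw [← hσm] at h1
    refine le_trans ?_ ((ENNReal.ofReal_le_iff_le_toReal (measure_ne_top _ _)).1 h1)
    refine mul_le_mul_of_nonneg_right ?_ (hpow x s hs)
    gcongr
    exact le_max_left _ _

/-- Below a third of the reach, balls have at least their nominal mass. -/
theorem le_real_ball_of_reach (G : TangentData m ι p) (hm : 2 ≤ m) (hι : MeasurableEmbedding ι)
    (hcont : Continuous ι) {a : ℝ} (ha : 0 < a) (hp : ∀ x, a ≤ p x)
    [IsProbabilityMeasure ((vol m ι).withDensity fun x => ENNReal.ofReal (p x))]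
    {s : ℝ} (hs : 0 < s) (hsR : 6 * s ≤ reach (Set.range ι)) (y : M) :
    13 / 10 * (a * (ballVol m * s ^ m)) ≤
      ((vol m ι).withDensity fun x => ENNReal.ofReal (p x)).real
        {z | ‖ι z - ι y‖ ≤ 6 / 5 * s} := by
  have hR0 : 0 < reach (Set.range ι) := by linarith
  have h1 := G.le_vol_of_reach hι hR0
    (G.two_mul_norm_orthogonal_le (isCompact_range hcont) hR0
      fun z hz => existsUnique_of_infDist_lt_reach z hz) y hs.le hsR
  have hα := ballVol_pos m
  have hS : MeasurableSet {z | ‖ι z - ι y‖ ≤ 6 / 5 * s} :=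
    measurableSet_le (Continuous.measurable (by fun_prop)) measurable_const
  have h2 : ENNReal.ofReal (a * (ballVol m * (117 / 100 * s) ^ m)) ≤
      ((vol m ι).withDensity fun x => ENNReal.ofReal (p x)) {z | ‖ι z - ι y‖ ≤ 6 / 5 * s} := by
    rw [withDensity_apply _ hS, ENNReal.ofReal_mul ha.le]
    calc _ ≤ ENNReal.ofReal a * vol m ι {z | ‖ι z - ι y‖ ≤ 6 / 5 * s} := by gcongr
      _ = ∫⁻ _ in {z | ‖ι z - ι y‖ ≤ 6 / 5 * s}, ENNReal.ofReal a ∂(vol m ι) := by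
          rw [setLIntegral_const]
      _ ≤ _ := lintegral_mono fun z => ENNReal.ofReal_le_ofReal (hp z)
  refine le_trans ?_ ((ENNReal.ofReal_le_iff_le_toReal (measure_ne_top _ _)).1 h2)
  -- Dimension at least two is used here: `1.17² > 1.3`.
  have h3 : (13 / 10 : ℝ) ≤ (117 / 100) ^ m :=
    le_trans (by norm_num) (pow_le_pow_right₀ (by norm_num : (1 : ℝ) ≤ 117 / 100) hm)
  calc _ = a * ballVol m * s ^ m * (13 / 10) := by ring
    _ ≤ a * ballVol m * s ^ m * (117 / 100) ^ m := by gcongr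
    _ = _ := by ring

/-- The deviation of the sample operator, for the law of the sample on the product space. -/
theorem exists_measure_pi_bound (G : TangentData m ι p) (hm : 2 ≤ m) (hι : Topology.IsEmbedding ι)
    (hpc : Continuous p) (hpos : ∀ x, 0 < p x) (hint : ∫ x, p x ∂(vol m ι) = 1) :
    ∃ C > (0 : ℝ), ∃ c > (0 : ℝ), ∀ n k : ℕ, 1 ≤ k → k ≤ n →
      3 * ((k : ℝ) / n) ^ (1 / (m : ℝ)) <
        (ballVol m * ⨅ x, p x) ^ (1 / (m : ℝ)) * min 1 (reach (Set.range ι) / 2) →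
      ∀ (f : M → ℝ), IsLip ι f → ∀ (x : M) (t : ℝ),
        ((k : ℝ) / n) ^ (1 / (m : ℝ)) ≤ t → t ≤ ((k : ℝ) / n) ^ (-(1 / (m : ℝ))) →
        ∃ Bad : Set (Fin n → M),
          (Measure.pi fun _ : Fin n =>
            (vol m ι).withDensity fun x => ENNReal.ofReal (p x)).real Bad ≤
            C * n * Real.exp (-(c * k * ((k : ℝ) / n) ^ (2 / (m : ℝ)) * t ^ 2)) ∧
          ∀ ξ ∉ Bad, |L1 m ι p k ξ f x - L2 m ι p n k f x| ≤
            C * lipSeminorm ι f (geoBall ι x (3 * maxRadius m p n k)) * t := by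
  have hm0 : m ≠ 0 := by omega
  have hmR : (m : ℝ) ≠ 0 := by exact_mod_cast hm0
  have hcont := hι.continuous
  have hsc := hι.secondCountableTopology
  have hme : MeasurableEmbedding ι :=
    (hcont.isClosedEmbedding hι.injective).measurableEmbedding
  have hprob := isProbabilityMeasure_density (fun x => (hpos x).le) hint
  obtain ⟨K, A, r, B⟩ := exists_ballGeometry G hm0 hι hpc hpos hint
  set μ := (vol m ι).withDensity fun x => ENNReal.ofReal (p x) with hμ
  obtain ⟨x₀, -, hx₀⟩ := isCompact_univ.exists_isMinOn Set.univ_nonempty hpc.continuousOn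
  have hmin : ∀ x, p x₀ ≤ p x := fun x => hx₀ (Set.mem_univ x)
  have hinf : ⨅ x, p x = p x₀ :=
    le_antisymm (ciInf_le ⟨p x₀, by rintro _ ⟨x, rfl⟩; exact hmin x⟩ x₀) (le_ciInf hmin)
  obtain ⟨C₁, h₀, δ₀, hC₁, hh₀, hδ₀, hδ₀1, hsmall⟩ := B.exists_small_scale
  have hA1 := B.one_le'
  have hA0 : 0 < A := zero_lt_one.trans_le hA1
  have hα := ballVol_pos m
  set β : ℝ := ballVol m ^ (1 + 2 / (m : ℝ)) / 2 ^ (m + 2) with hβ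
  have hβ0 : 0 < β := by positivity
  -- The threshold between the regimes; above it `k / n ≥ h₁ ^ m = κ`.
  set h₁ := min h₀ δ₀ with hh₁
  have hh₁0 : 0 < h₁ := lt_min hh₀ hδ₀
  have hh₁1 : h₁ ≤ 1 := (min_le_right _ _).trans hδ₀1
  set κ := h₁ ^ m with hκ
  have hκ0 : 0 < κ := by positivity
  have hκ1 : κ ≤ 1 := pow_le_one₀ hh₁0.le hh₁1
  set C₂ := β * C₁ with hC₂
  -- For `h > h₁` the prefactor `β / (h ^ (m + 2) k)` meets the crude bound `5 n L h A`; with `n / k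
  -- = h⁻ᵐ` this is `5 A β L h / h ^ (2 m + 2)`, and `h ≤ t`.
  set C₃ := 5 * A * β / h₁ ^ (2 * m + 2) with hC₃
  have hC₂0 : 0 < C₂ := by positivity
  have hC₃0 : 0 < C₃ := by positivity
  set c := min (δ₀ ^ 2 / 4) ((κ / 5) ^ 2 / 4) with hc
  have hc0 : 0 < c := by positivity
  refine ⟨7 + C₂ + C₃, by positivity, c, hc0, ?_⟩
  intro n k hk hkn hsep f hf x t ht1 ht2
  have hn : 1 ≤ n := hk.trans hkn
  have hk0 : (0 : ℝ) < k := by exact_mod_cast hk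
  have hn0 : (0 : ℝ) < n := by exact_mod_cast hn
  have hkn0 : 0 < (k : ℝ) / n := by positivity
  rw [Real.rpow_neg hkn0.le] at ht2
  have hsq : ((k : ℝ) / n) ^ (2 / (m : ℝ)) = (((k : ℝ) / n) ^ (1 / (m : ℝ))) ^ 2 := by
    rw [← Real.rpow_mul_natCast hkn0.le]
    congr 1
    push_cast
    ring
  rw [hsq]
  have hhm : (((k : ℝ) / n) ^ (1 / (m : ℝ))) ^ m = k / n := by
    rw [one_div, Real.rpow_inv_natCast_pow hkn0.le hm0]
  have hdet := detRadius_eq (m := m) hpos n k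
  set h := ((k : ℝ) / n) ^ (1 / (m : ℝ)) with hh
  have hh0 : 0 < h := by positivity
  have hh1 : h ≤ 1 := Real.rpow_le_one hkn0.le
    (by rw [div_le_one hn0]; exact_mod_cast hkn) (by positivity)
  have hnk : n * h ^ m = k := by rw [hhm]; field_simp
  have ht0 : 0 < t := hh0.trans_le ht1
  have hδ1 : h * t ≤ 1 := by
    calc h * t ≤ h * h⁻¹ := by gcongr
      _ = 1 := mul_inv_cancel₀ hh0.ne'
  have hσ := unitRadius_pos (m := m) hpos
  have hε : detRadius m p n k = fun y => h * unitRadius m p y := funext hdet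
  have hs : maxRadius m p n k = h * unitRadius m p x₀ := by
    have hle : ∀ y, detRadius m p n k y ≤ h * unitRadius m p x₀ := fun y => by
      rw [hdet]
      exact mul_le_mul_of_nonneg_left (unitRadius_anti hpos (hmin y)) hh0.le
    refine le_antisymm (ciSup_le hle) ?_
    rw [← hdet x₀]
    exact le_ciSup (f := detRadius m p n k) ⟨_, by rintro _ ⟨y, rfl⟩; exact hle y⟩ x₀
  have hεpos : ∀ y, 0 < detRadius m p n k y := fun y => by
    rw [hdet]
    exact mul_pos hh0 (hσ y)
  have hDpos : ∀ y z, y ≠ z → 0 < geoDist ι y z := fun y z hyz => by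
    refine lt_of_lt_of_le ?_ (G.norm_sub_le_geoDist hcont y z)
    exact norm_pos_iff.2 (sub_ne_zero.2 fun h => hyz (hι.injective h).symm)
  have hpm : Measurable p := hpc.measurable
  have hp0 : ∀ y, 0 ≤ p y := fun y => (hpos y).le
  have hDm : ∀ y, Measurable (geoDist ι y) := B.measurable_D_right
  set s := maxRadius m p n k with hsdef
  have hs0 : 0 < s := by rw [hs]; exact mul_pos hh0 (hσ x₀)
  have hεs : ∀ y, h * unitRadius m p y ≤ s := fun y => by
    rw [hs]
    exact mul_le_mul_of_nonneg_left (unitRadius_anti hpos (hmin y)) hh0.le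
  have hsA : s ≤ h * A := by
    rw [hs]
    exact mul_le_mul_of_nonneg_left (B.σ_le x₀) hh0.le
  set L := lipSeminorm ι f (geoBall ι x (3 * s)) with hL
  have hL0 : 0 ≤ L := lipSeminorm_nonneg ι f _
  have hfL : ∀ y, geoDist ι x y < 3 * s → |f x - f y| ≤ L * geoDist ι x y := fun y hy => by
    refine abs_sub_le_lipSeminorm hDpos hf ?_ hy
    rw [geoBall, Set.mem_ofPred_eq, geoDist_self]
    positivity
  have hfm : Measurable f := by
    refine Continuous.measurable (continuous_iff_continuousAt.2 fun y => ?_)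
    obtain ⟨L', hL'⟩ := hf
    have hlim : Tendsto (fun z => L' * geoDist ι z y) (𝓝 y) (𝓝 0) := by
      have h1 : Continuous fun z => L' * geoDist ι z y :=
        ((G.continuous_geoDist hcont).comp (continuous_id.prodMk continuous_const)).const_mul L'
      simpa [geoDist_self] using h1.tendsto y
    rw [ContinuousAt, tendsto_iff_dist_tendsto_zero]
    exact squeeze_zero (fun _ => dist_nonneg) (fun z => hL' z y) hlim
  have hpref : (ballVol m * n / k) ^ (1 + 2 / (m : ℝ)) / (2 ^ (m + 2) * k) =
      β / (h ^ m * h ^ 2 * k) := by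
    have e1 : ballVol m * n / k = ballVol m * ((k : ℝ) / n)⁻¹ := by rw [inv_div]; ring
    have e2 : ((k : ℝ) / n) ^ (1 + 2 / (m : ℝ)) = h ^ m * h ^ 2 := by
      rw [Real.rpow_add hkn0, Real.rpow_one, hsq, hhm]
    rw [e1, Real.mul_rpow hα.le (by positivity), Real.inv_rpow hkn0.le, e2, hβ]
    field_simp
  have hdiff : ∀ ξ : Fin n → M, 0 < knnRadius ι ξ k x → (∀ i, 0 < knnRadius ι ξ k (ξ i)) →
      |L1 m ι p k ξ f x - L2 m ι p n k f x| = β / (h ^ m * h ^ 2 * k) *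
        |∑ i, interMass μ (geoDist ι) (knnRadius ι ξ k) x (ξ i) * (f x - f (ξ i)) -
          n * ∫ y, BallGeometry.truncMass μ (geoDist ι) (fun y => h * unitRadius m p y) s f x y
            ∂μ| := by
    intro ξ hx hξ
    rw [L1_eq hpm hp0 hDm hx hξ, L2_eq hpm hp0 hDm hn hk hεpos, ← mul_sub, abs_mul, hpref,
      abs_of_pos (by positivity : 0 < β / (h ^ m * h ^ 2 * k)), hε]
  have hn1 : (1 : ℝ) ≤ n := by exact_mod_cast hn
  have hht0 : 0 < h * t := by positivity
  have hhtsq : c * k * h ^ 2 * t ^ 2 = c * (k * (h * t) ^ 2) := by ring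
  rw [hhtsq]
  rcases le_or_gt h h₁ with hle | hgt
  -- The prefactor turns the error `k h^m δ L h` into a multiple of `L δ / h ≤ L t`. The truncation
  -- costs only a constant in the exponent, since `h t ≤ 1` gives `δ₀ h t ≤ δ`; and `h ≤ t` gives
  -- `h² ≤ δ`.
  · set δ := min (h * t) δ₀ with hδ
    have hδ0 : 0 < δ := lt_min hht0 hδ₀
    have hhδ : h ^ 2 ≤ δ := by
      refine le_min (by rw [sq]; gcongr) ?_
      calc h ^ 2 ≤ h := by rw [sq]; exact mul_le_of_le_one_right hh0.le hh1
        _ ≤ δ₀ := hle.trans (min_le_right _ _)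
    obtain ⟨Bad, hBad, hgood⟩ := hsmall n k h x f L s δ hn hh0 hnk (hle.trans (min_le_left _ _))
      hδ0 hhδ (min_le_right _ _) hεs hsA hL0 hfm hfL
    refine ⟨Bad, hBad.trans ?_, fun ξ hξ => ?_⟩
    · have hδδ : δ₀ * (h * t) ≤ δ := by
        refine le_min ?_ ?_
        · exact mul_le_of_le_one_left hht0.le hδ₀1
        · exact mul_le_of_le_one_right hδ₀.le hδ1
      have h1 : c * (k * (h * t) ^ 2) ≤ k * δ ^ 2 / 4 := by
        calc c * (k * (h * t) ^ 2) ≤ δ₀ ^ 2 / 4 * (k * (h * t) ^ 2) := by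
              gcongr
              exact min_le_left _ _
          _ = k * (δ₀ * (h * t)) ^ 2 / 4 := by ring
          _ ≤ _ := by gcongr
      gcongr
      linarith
    · obtain ⟨⟨hx, hi⟩, hmain⟩ := hgood ξ hξ _ (isKnnRadius_knnRadius ξ hk)
      rw [hdiff ξ hx hi]
      calc _ ≤ β / (h ^ m * h ^ 2 * k) * (C₁ * (k * h ^ m * δ * (L * h))) := by gcongr
        _ = C₂ * L * (δ / h) := by rw [hC₂]; field_simp
        _ ≤ (7 + C₂ + C₃) * L * t := by
            have : δ / h ≤ t := by
              rw [div_le_iff₀ hh0, mul_comm]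
              exact min_le_left _ _
            gcongr
            linarith
  · have hball : ∀ y, 13 / 10 * k ≤ n * μ.real {z | ‖ι z - ι y‖ ≤ 6 / 5 * s} := by
      intro y
      -- The hypothesis on `k / n` reads `3 ε⋆ < min 1 (R / 2)`.
      have hsR : 6 * s ≤ reach (Set.range ι) := by
        have h1 : 3 * s < min 1 (reach (Set.range ι) / 2) := by
          have e1 : unitRadius m p x₀ = ((ballVol m * p x₀) ^ (1 / (m : ℝ)))⁻¹ :=
            Real.rpow_neg (mul_pos hα (hpos x₀)).le _
          have e2 : 0 < (ballVol m * p x₀) ^ (1 / (m : ℝ)) :=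
            Real.rpow_pos_of_pos (mul_pos hα (hpos x₀)) _
          rw [hinf, ← div_lt_iff₀' e2] at hsep
          rw [hs, e1, ← mul_assoc, ← div_eq_mul_inv]
          exact hsep
        have := h1.trans_le (min_le_right _ _)
        linarith
      have h1 := le_real_ball_of_reach G hm hme hcont (hpos x₀) hmin hs0 hsR y
      have h2 : p x₀ * (ballVol m * s ^ m) = h ^ m := by
        rw [hs, mul_pow, unitRadius_pow hm0 hpos]
        have := hpos x₀
        field_simp
      rw [h2] at h1
      calc (13 / 10 : ℝ) * k = n * (13 / 10 * h ^ m) := by rw [← hnk]; ring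
        _ ≤ _ := by gcongr
    have hκn : κ * n ≤ k := by
      rw [← hnk, mul_comm, hκ]
      gcongr
    obtain ⟨Bad, hBad, hgood⟩ := B.large_scale hκ0 hκ1 hk hn hκn
      (ε := fun y => h * unitRadius m p y) hs0 hball hL0 hfL
    refine ⟨Bad, hBad.trans ?_, fun ξ hξ => ?_⟩
    · have h1 : c * (k * (h * t) ^ 2) ≤ k * (κ / 5) ^ 2 / 4 := by
        calc c * (k * (h * t) ^ 2) ≤ (κ / 5) ^ 2 / 4 * (k * 1) := by
              gcongr
              · exact min_le_right _ _
              · exact pow_le_one₀ hht0.le hδ1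
          _ = _ := by ring
      gcongr
      linarith
    · obtain ⟨⟨hx, hi⟩, hmain⟩ := hgood ξ hξ _ (isKnnRadius_knnRadius ξ hk)
      rw [hdiff ξ hx hi]
      calc _ ≤ β / (h ^ m * h ^ 2 * k) * (5 * n * (L * s)) := by gcongr
        _ ≤ β / (h ^ m * h ^ 2 * k) * (5 * n * (L * (h * A))) := by gcongr
        _ = 5 * A * β / h ^ (2 * m + 2) * L * h := by
            rw [← hnk]
            field_simp
            ring
        _ ≤ C₃ * L * t := by
            rw [hC₃]
            gcongr
        _ ≤ (7 + C₂ + C₃) * L * t := by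
            gcongr
            linarith

end Final

end SNN

theorem lemma4p3 {m d : ℕ} (hm : 2 ≤ m)
    {M : Type*} [TopologicalSpace M] [CompactSpace M] [ConnectedSpace M]
    [ChartedSpace (EuclideanSpace ℝ (Fin m)) M] [IsManifold (𝓡 m) ∞ M]
    [MeasurableSpace M] [BorelSpace M]
    (ι : M → EuclideanSpace ℝ (Fin d))
    (hι : Manifold.IsSmoothEmbedding (𝓡 m) 𝓘(ℝ, EuclideanSpace ℝ (Fin d)) ∞ ι)
    (p : M → ℝ) (hp : ContMDiff (𝓡 m) 𝓘(ℝ, ℝ) 2 p) (hpos : ∀ x, 0 < p x)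
    (hint : ∫ x, p x ∂(SNN.vol m ι) = 1) :
    ∃ C > (0 : ℝ), ∃ c > (0 : ℝ),
      ∀ n k : ℕ, 1 ≤ k → k ≤ n →
        3 * ((k : ℝ) / n) ^ (1 / (m : ℝ)) <
          (SNN.ballVol m * ⨅ x, p x) ^ (1 / (m : ℝ)) *
            min 1 (SNN.reach (Set.range ι) / 2) →
        ∀ {Ω : Type*} [MeasurableSpace Ω] (P : Measure Ω) [IsProbabilityMeasure P]
          (X : Fin n → Ω → M), (∀ i, Measurable (X i)) → iIndepFun X P →
          (∀ i, P.map (X i) = (SNN.vol m ι).withDensity (fun x => ENNReal.ofReal (p x))) →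
          ∀ (f : M → ℝ), SNN.IsLip ι f → ∀ (x : M) (t : ℝ),
            ((k : ℝ) / n) ^ (1 / (m : ℝ)) ≤ t → t ≤ ((k : ℝ) / n) ^ (-(1 / (m : ℝ))) →
            P.real {s | C * SNN.lipSeminorm ι f
                  (SNN.geoBall ι x (3 * SNN.maxRadius m p n k)) * t <
                |SNN.L1 m ι p k (fun i => X i s) f x - SNN.L2 m ι p n k f x|} ≤
              C * n * Real.exp (-(c * k * ((k : ℝ) / n) ^ (2 / (m : ℝ)) * t ^ 2)) := by
  obtain ⟨G⟩ := SNN.nonempty_tangentData hι hp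
  obtain ⟨C, hC, c, hc, hmain⟩ := SNN.exists_measure_pi_bound G hm hι.isEmbedding hp.continuous
    hpos hint
  refine ⟨C, hC, c, hc, fun n k hk hkn hsep Ω _ P _ X hX hindep hlaw f hf x t ht1 ht2 => ?_⟩
  obtain ⟨Bad, hBad, hgood⟩ := hmain n k hk hkn hsep f hf x t ht1 ht2
  have hprob := SNN.isProbabilityMeasure_density (fun x => (hpos x).le) hint
  have hmap := hindep.map_fun_eq_pi_map fun i => (hX i).aemeasurable
  simp_rw [hlaw] at hmap
  refine le_trans ?_ hBad
  rw [← hmap]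
  refine ENNReal.toReal_mono (by rw [hmap]; exact measure_ne_top _ _) ?_
  -- `Bad` is not known to be measurable; the inequality between the measure of a preimage and the
  -- pushforward holds for every set.
  refine le_trans (measure_mono fun s hs => ?_)
    (Measure.le_map_apply (measurable_pi_lambda _ hX).aemeasurable Bad)
  by_contra hcon
  exact absurd (hgood _ hcon) (not_le.2 hs)
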